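/- Let $M$ be a smooth four-dimensional manifold (Hausdorff, second countable). Fix a smooth derivative operator (affine connection) $\nabla$ on $M$, a smooth Riemannian metric $e_{ab}$ on $M$, used to define pointwise norms of tensors by $|t_{a_1\dots a_n}|^2=e^{a_1b_1}\cdots e^{a_nb_n}t_{a_1\dots a_n}t_{b_1\dots b_n}$, and a constant $\Lambda\in\mathbb R$. Let $g_{ab}(\lambda)$, $\lambda\ge 0$, be smooth Lorentz metrics of signature $(-,+,+,+)$ on $M$, and put $g^{(0)}_{ab}=g_{ab}(0)$ and $h_{ab}(\lambda)=g_{ab}(\lambda)-g^{(0)}_{ab}$. A family of covariant tensor fields $A_{a_1\dots a_n}(\lambda)$ is said to converge weakly to $B_{a_1\dots a_n}$, written $\operatorname{w-lim}_{\lambda\to0}A(\lambda)=B$, if $\int_M f^{a_1\dots a_n}A_{a_1\dots a_n}(\lambda)\to\int_M f^{a_1\dots a_n}B_{a_1\dots a_n}$ as $\lambda\to0^+$ for every smooth tensor field $f^{a_1\dots a_n}$ of compact support, the volume element being that of $g^{(0)}$. Suppose: (i) for all $\lambda>0$, $G_{ab}(g(\lambda))+\Lambda g_{ab}(\lambda)=8\pi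 T_{ab}(\lambda)$, where $T_{ab}(\lambda)t^at^b\ge0$ for every vector $t^a$ that is timelike with respect to $g_{ab}(\lambda)$; (ii) there is a smooth positive function $C_1$ on $M$ with $|h_{ab}(\lambda,x)|\le\lambda C_1(x)$ for all $\lambda>0$ and $x\in M$; (iii) there is a smooth positive function $C_2$ on $M$ with $|\nabla_ch_{ab}(\lambda,x)|\le C_2(x)$ for all $\lambda>0$ and $x\in M$; (iv) there is a smooth tensor field $\mu_{abcdef}$ on $M$ with $\operatorname{w-lim}_{\lambda\to0}\left[\nabla_ah_{cd}(\lambda)\nabla_bh_{ef}(\lambda)\right]=\mu_{abcdef}$. Raise indices with $g^{(0)}$, let $\alpha_{abcdef}=\mu_{[c|[ab]|d]ef}=\frac14\left(\mu_{cabdef}-\mu_{cbadef}-\mu_{dabcef}+\mu_{dbacef}\right)$, and define the effective gravitational stress-energy tensor $t^{(0)}_{ab}$ by $$8\pi t^{(0)}_{ab}=\alpha_a{}^c{}_b{}^d{}_{cd}+\tfrac32\,\alpha^{cd}{}_{cdab}-2\,\alpha_{(a}{}^{cd}{}_{|cd|b)}-\tfrac14\,g^{(0)}_{ab}\left\{\alpha^{cd}{}_{cd}{}^e{}_e-2\,\alpha^{cde}{}_{cde}\right\}.$$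 Then: (a) $T^{(0)}_{ab}=\operatorname{w-lim}_{\lambda\to0}T_{ab}(\lambda)$ exists as a smooth tensor field, and $G_{ab}(g^{(0)})+\Lambda g^{(0)}_{ab}=8\pi T^{(0)}_{ab}+8\pi t^{(0)}_{ab}$; (b) $\operatorname{w-lim}_{\lambda\to0}h_{ef}(\lambda)T_{ab}(\lambda)=0$; (c) $\alpha_a{}^c{}_{bcef}=0$, and hence $8\pi t^{(0)}_{ab}=\alpha_a{}^c{}_b{}^d{}_{cd}$; (d) $t^{(0)}_{ab}$ is traceless: $t^{(0)a}{}_a=0$. -/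

import Mathlib

open scoped Manifold ContDiff Topology
open MeasureTheory

noncomputable section

namespace Spacetime

/-- The model space of a four-dimensional manifold. -/
abbrev E4 : Type := EuclideanSpace ℝ (Fin 4)

/-- The standard basis of the model space. -/
def stdVec (a : Fin 4) : E4 := EuclideanSpace.single a 1

section

variable (M : Type*) [TopologicalSpace M] [ChartedSpace E4 M]

/-- Local homeomorphisms from `M` to the model space. -/
abbrev Chart := OpenPartialHomeomorph M E4

/-- The smooth coordinate charts of the manifold: all members of its maximal smooth atlas. -/
abbrev charts : Set (Chart M) := IsManifold.maximalAtlas (𝓡 4) ∞ M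

/-- Covariant tensor fields of rank `k` (no regularity required). -/
abbrev Cov (k : ℕ) : Type _ :=
  (x : M) → MultilinearMap ℝ (fun _ : Fin k => TangentSpace (𝓡 4) x) ℝ

/-- Contravariant tensor fields of rank `k` (no regularity required). -/
abbrev Con (k : ℕ) : Type _ :=
  (x : M) → MultilinearMap ℝ (fun _ : Fin k => TangentSpace (𝓡 4) x →L[ℝ] ℝ) ℝ

/-- Arrays of `k`-index components of a covariant tensor field: for each chart `φ`, each point
`x` (of the domain of `φ`) and each multi-index, a number. -/
abbrev Comp (k : ℕ) : Type _ := Chart M → M → (Fin k → Fin 4) → ℝ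

end

variable {M : Type*} [TopologicalSpace M] [ChartedSpace E4 M]

/-- The coordinate vector field `∂_a` of the chart `φ`, at points of its domain. -/
def coordVec (φ : Chart M) (a : Fin 4) (x : M) : TangentSpace (𝓡 4) x :=
  (mfderiv 𝓘(ℝ, E4) (𝓡 4) φ.symm (φ x) (stdVec a) : E4)

/-- The coordinate one-form `dx^a` of the chart `φ`, at points of its domain. -/
def coordForm (φ : Chart M) (a : Fin 4) (x : M) : TangentSpace (𝓡 4) x →L[ℝ] ℝ :=
  (EuclideanSpace.proj a : E4 →L[ℝ] ℝ).comp (mfderiv (𝓡 4) 𝓘(ℝ, E4) φ x)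

/-- Coordinate components `A_{i_1 … i_k}` of a covariant tensor field. -/
def Cov.comp {k : ℕ} (A : Cov M k) : Comp M k := fun φ x i =>
  A x (fun j => coordVec φ (i j) x)

/-- Coordinate components `f^{i_1 … i_k}` of a contravariant tensor field. -/
def Con.comp {k : ℕ} (f : Con M k) (φ : Chart M) (x : M) (i : Fin k → Fin 4) : ℝ :=
  f x (fun j => coordForm φ (i j) x)

/-- A covariant tensor field is smooth: its components in every chart are smooth. -/
def Cov.Smooth {k : ℕ} (A : Cov M k) : Prop :=
  ∀ φ ∈ charts M, ∀ i, ContDiffOn ℝ ∞ (fun y : E4 => A.comp φ (φ.symm y) i) φ.target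

/-- A contravariant tensor field is smooth: its components in every chart are smooth. -/
def Con.Smooth {k : ℕ} (f : Con M k) : Prop :=
  ∀ φ ∈ charts M, ∀ i, ContDiffOn ℝ ∞ (fun y : E4 => f.comp φ (φ.symm y) i) φ.target

/-- Test tensor fields: smooth contravariant tensor fields of compact support. -/
def IsTest {k : ℕ} (f : Con M k) : Prop :=
  f.Smooth ∧ ∃ K : Set M, IsCompact K ∧ ∀ x, x ∉ K → f x = 0

/-- A smooth Lorentz metric of signature `(-,+,+,+)`. -/
def IsLorentz (g : Cov M 2) : Prop :=
  g.Smooth ∧ ∀ x, ∃ b : Module.Basis (Fin 4) ℝ (TangentSpace (𝓡 4) x), ∀ i j,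
    g x ![b i, b j] = if i = j then (if i = 0 then -1 else 1) else 0

/-- A smooth Riemannian metric. -/
def IsRiemannian (e : Cov M 2) : Prop :=
  e.Smooth ∧ (∀ x v w, e x ![v, w] = e x ![w, v]) ∧ ∀ x v, v ≠ 0 → 0 < e x ![v, v]

/-- The weak energy condition for `T` with respect to the Lorentz metric `g`. -/
def WeakEnergy (g T : Cov M 2) : Prop :=
  ∀ x v, g x ![v, v] < 0 → 0 ≤ T x ![v, v]

/-- The matrix `g_{ab}` of a metric in a chart. -/
def metricMatrix (g : Cov M 2) (φ : Chart M) (x : M) : Matrix (Fin 4) (Fin 4) ℝ :=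
  Matrix.of fun a b => g.comp φ x ![a, b]

/-- The inverse metric `g^{ab}` in a chart. -/
def inv (g : Cov M 2) (φ : Chart M) (x : M) : Matrix (Fin 4) (Fin 4) ℝ :=
  (metricMatrix g φ x)⁻¹

/-- The partial derivative `∂_a u` in the chart `φ`. -/
def pd (φ : Chart M) (a : Fin 4) (u : M → ℝ) (x : M) : ℝ :=
  fderiv ℝ (fun y : E4 => u (φ.symm y)) (φ x) (stdVec a)

/-- The Christoffel symbols
`Γ^c_{ab} = (1/2) g^{cd} (∂_a g_{bd} + ∂_b g_{ad} - ∂_d g_{ab})`. -/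
def christoffel (g : Cov M 2) (φ : Chart M) (c a b : Fin 4) (x : M) : ℝ :=
  (1 / 2) * ∑ d, inv g φ x c d *
    (pd φ a (fun z => g.comp φ z ![b, d]) x + pd φ b (fun z => g.comp φ z ![a, d]) x
      - pd φ d (fun z => g.comp φ z ![a, b]) x)

/-- The Ricci tensor
`R_{ab} = ∂_c Γ^c_{ab} - ∂_a Γ^c_{cb} + Γ^d_{ab} Γ^c_{cd} - Γ^d_{cb} Γ^c_{da}`. -/
def ricci (g : Cov M 2) (φ : Chart M) (x : M) (a b : Fin 4) : ℝ :=
  ∑ c, (pd φ c (christoffel g φ c a b) x - pd φ a (christoffel g φ c c b) x)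
    + ∑ c, ∑ d, (christoffel g φ d a b x * christoffel g φ c c d x
      - christoffel g φ d c b x * christoffel g φ c d a x)

/-- The Einstein tensor `G_{ab} = R_{ab} - (1/2) g_{ab} g^{cd} R_{cd}`. -/
def einstein (g : Cov M 2) (φ : Chart M) (x : M) (a b : Fin 4) : ℝ :=
  ricci g φ x a b
    - (1 / 2) * g.comp φ x ![a, b] * ∑ c, ∑ d, inv g φ x c d * ricci g φ x c d

/-- Norm of a covariant tensor with respect to the Riemannian metric `e`:
`|A|^2 = e^{i_1 j_1} … e^{i_k j_k} A_{i_1 … i_k} A_{j_1 … j_k}`. -/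
def tensorNorm (e : Cov M 2) {k : ℕ} (A : Comp M k) (φ : Chart M) (x : M) : ℝ :=
  Real.sqrt (∑ i : Fin k → Fin 4, ∑ j : Fin k → Fin 4,
    (∏ l, inv e φ x (i l) (j l)) * A φ x i * A φ x j)

/-- An affine connection on `M`, i.e. a covariant derivative on its tangent bundle. -/
abbrev Connection (M : Type*) [TopologicalSpace M] [ChartedSpace E4 M]
    [IsManifold (𝓡 4) ∞ M] : Type _ :=
  CovariantDerivative (𝓡 4) E4 (TangentSpace (𝓡 4) : M → Type _)

/-- The covariant derivative of a rank two covariant tensor field,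
`∇_a h_{bc} = ∂_a (h(∂_b, ∂_c)) - h(∇_a ∂_b, ∂_c) - h(∂_b, ∇_a ∂_c)`;
the differentiation index comes first. -/
def covDeriv [IsManifold (𝓡 4) ∞ M] (D : Connection M) (h : Cov M 2) : Comp M 3 :=
  fun φ x i =>
    pd φ (i 0) (fun z => h.comp φ z ![i 1, i 2]) x
      - h x ![D (coordVec φ (i 1)) x (coordVec φ (i 0) x), coordVec φ (i 2) x]
      - h x ![coordVec φ (i 1) x, D (coordVec φ (i 2)) x (coordVec φ (i 0) x)]

/-- The volume measure of `g`, given in each chart by `√|det g_{ab}| d^4x`: the least measure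
on `M` that dominates all these chart measures. (Chart measures agree on overlaps, so on the
domain of each chart it is equal to the chart measure.) -/
def volumeMeasure [MeasurableSpace M] (g : Cov M 2) : Measure M :=
  ⨆ φ ∈ charts M,
    (((volume : Measure E4).restrict φ.target).withDensity
      (fun y => ENNReal.ofReal (Real.sqrt |(metricMatrix g φ (φ.symm y)).det|))).map φ.symm

/-- The full contraction `f^{i_1 … i_k} A_{i_1 … i_k}`, a scalar function on `M`
(evaluated at each point in the preferred chart there). -/
def contract {k : ℕ} (f : Con M k) (A : Comp M k) (x : M) : ℝ :=
  ∑ i : Fin k → Fin 4, f.comp (chartAt E4 x) x i * A (chartAt E4 x) x i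

/-- `A(s) → B` weakly as `s → 0`, `s > 0`: convergence of the integrals against every test
tensor field. -/
def WeakLim [MeasurableSpace M] (vol : Measure M) {k : ℕ} (A : ℝ → Comp M k) (B : Comp M k) :
    Prop :=
  ∀ f : Con M k, IsTest f →
    Filter.Tendsto (fun s => ∫ x, contract f (A s) x ∂vol) (𝓝[>] 0)
      (𝓝 (∫ x, contract f B x ∂vol))

/-- `α_{abcdef} = μ_{[c|[ab]|d]ef}`, antisymmetrized (with weight) over `ab` and over `cd`. -/
def alpha (μ : Cov M 6) (φ : Chart M) (x : M) (a b c d e f : Fin 4) : ℝ :=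
  (1 / 4) * (μ.comp φ x ![c, a, b, d, e, f] - μ.comp φ x ![c, b, a, d, e, f]
    - μ.comp φ x ![d, a, b, c, e, f] + μ.comp φ x ![d, b, a, c, e, f])

/-- Contraction of two pairs of indices, `g^{c c'} g^{d d'} F_{c c' d d'}`. -/
def tr2 (g : Cov M 2) (φ : Chart M) (x : M) (F : Fin 4 → Fin 4 → Fin 4 → Fin 4 → ℝ) : ℝ :=
  ∑ c, ∑ c', ∑ d, ∑ d', inv g φ x c c' * inv g φ x d d' * F c c' d d'

/-- Contraction of three pairs of indices,
`g^{c c'} g^{d d'} g^{e e'} F_{c c' d d' e e'}`. -/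
def tr3 (g : Cov M 2) (φ : Chart M) (x : M)
    (F : Fin 4 → Fin 4 → Fin 4 → Fin 4 → Fin 4 → Fin 4 → ℝ) : ℝ :=
  ∑ e, ∑ e', inv g φ x e e' * tr2 g φ x (fun c c' d d' => F c c' d d' e e')

/-- The effective gravitational stress-energy tensor `t_{ab}` of `μ` on the background `g`:
`8π t_{ab} = α_a^c_b^d_{cd} + (3/2) α^{cd}_{cdab} - 2 α_{(a}^{cd}_{|cd|b)}
  - (1/4) g_{ab} (α^{cd}_{cd}^e_e - 2 α^{cde}_{cde})`. -/
def effStress (g : Cov M 2) (μ : Cov M 6) (φ : Chart M) (x : M) (a b : Fin 4) : ℝ :=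
  (1 / (8 * Real.pi)) *
    (tr2 g φ x (fun c c' d d' => alpha μ φ x a c b d c' d')
      + (3 / 2) * tr2 g φ x (fun c c' d d' => alpha μ φ x c d c' d' a b)
      - 2 * ((1 / 2) * (tr2 g φ x (fun c c' d d' => alpha μ φ x a c d c' d' b)
          + tr2 g φ x (fun c c' d d' => alpha μ φ x b c d c' d' a)))
      - (1 / 4) * g.comp φ x ![a, b] *
        (tr3 g φ x (fun c c' d d' e e' => alpha μ φ x c d c' d' e e')
          - 2 * tr3 g φ x (fun c c' d d' e e' => alpha μ φ x c d e c' d' e')))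

end Spacetime

end

open Spacetime

/-!
All statements are local, and on the domain of a chart everything can be expressed with partial
derivatives: since `h = O(s)`, the derivatives `∇h` and `∂h` differ by `O(s)`, so `μ` is also the
weak limit of `∂h ∂h`. The curvature of `g(s)` is the curvature of the background, plus a total
derivative of terms tending to zero, plus terms quadratic in `∂h`, plus `O(s)` terms; hence the
Ricci tensors converge weakly (`MetricFamily.wk_ric`), the quadratic terms contributing a
contraction of `μ`.

The weak energy condition enters through an `L¹` bound. Testing the Einstein tensor against a fixed
function gives a quantity that stays bounded, by integration by parts. Since `T(t, t) ≥ 0` for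
vectors `t` that are timelike with respect to the background (and hence, near a point, with respect
to all `g(s)` with `s` small), the functions `T(t, t)` are bounded in `L¹` locally, and by
polarisation so are all components of `T` and, after trace reversal, of the Ricci tensor. Hence
`h T → 0` and `h Ric → 0` weakly. Computing the second limit by parts in terms of `μ` gives a linear
identity for `μ`, equivalent to `α_a^c_{bcef} = 0` (`MuSymm.alpha_contract`). With this identity the
limit of the Ricci tensors is that of the background minus `α_a^c_b^d_{cd}`
(`MuSymm.ric_eq_neg_alpha`), whose trace vanishes, and the remaining terms in the effective
stress-energy tensor drop out. This is `MetricFamily.exists_local_limits`.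

To transfer this to the manifold, test tensor fields are cut into pieces supported in charts by a
partition of unity (`weakLim_of_chartWk`), the volume measure being the chart measure on the domain
of a chart (`volumeMeasure_restrict`). The limit of the matter tensors is found separately in each
chart; that these limits fit together to a tensor field follows from the uniqueness of weak limits
(`ChartWk.comp_eq`), so the transformation law of the Einstein tensor is not needed. The bilinear
expression `∇h ∇h` can be evaluated in any chart because `∇h` is a tensor field
(`covDerivTensor_comp`).
-/

noncomputable section

namespace Spacetime

section

open Filter

/-! ### Weak convergence of families of functions on the model space -/

/-- The partial derivative `∂_a f` on the model space. -/
def pder (a : Fin 4) (f : E4 → ℝ) (y : E4) : ℝ := fderiv ℝ f y (stdVec a)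

/-- Scalar test functions with support in `B`. -/
structure IsTestOn (B : Set E4) (u : E4 → ℝ) : Prop where
  smooth : ContDiff ℝ ∞ u
  compact : HasCompactSupport u
  supp : tsupport u ⊆ B

/-- Families of continuous functions on `B` that are bounded uniformly in `B` and in small
`s > 0`. -/
structure Bd (B : Set E4) (F : ℝ → E4 → ℝ) : Prop where
  cont : ∀ s, 0 < s → ContinuousOn (F s) B
  bound : ∃ C, ∀ᶠ s in 𝓝[>] (0 : ℝ), ∀ y ∈ B, |F s y| ≤ C

/-- Families of continuous functions on `B` that are `O(s)` uniformly in `B`. -/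
structure Sml (B : Set E4) (F : ℝ → E4 → ℝ) : Prop where
  cont : ∀ s, 0 < s → ContinuousOn (F s) B
  bound : ∃ C, ∀ᶠ s in 𝓝[>] (0 : ℝ), ∀ y ∈ B, |F s y| ≤ C * s

/-- Weak convergence `F s → L` as `s → 0⁺`, tested with functions supported in `B`; continuity
of all functions involved is part of the notion. -/
structure Wk (B : Set E4) (F : ℝ → E4 → ℝ) (L : E4 → ℝ) : Prop where
  cont : ∀ s, 0 < s → ContinuousOn (F s) B
  contL : ContinuousOn L B
  lim : ∀ u, IsTestOn B u →
    Tendsto (fun s => ∫ y, u y * F s y) (𝓝[>] 0) (𝓝 (∫ y, u y * L y))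

variable {B : Set E4} {F F' G : ℝ → E4 → ℝ} {L L' : E4 → ℝ}

lemma eventually_pos : ∀ᶠ s in 𝓝[>] (0 : ℝ), 0 < s := self_mem_nhdsWithin

lemma continuous_of_tsupport_subset {u f : E4 → ℝ} (hB : IsOpen B) (hu : Continuous u)
    (hs : tsupport u ⊆ B) (hf : ContinuousOn f B) : Continuous (fun y => u y * f y) := by
  rw [continuous_iff_continuousAt]
  intro y
  by_cases hy : y ∈ tsupport u
  · exact hu.continuousAt.mul (hf.continuousAt (hB.mem_nhds (hs hy)))
  · have h0 : u =ᶠ[𝓝 y] 0 := notMem_tsupport_iff_eventuallyEq.mp hy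
    have : (fun y => u y * f y) =ᶠ[𝓝 y] fun _ => 0 := by
      filter_upwards [h0] with z hz
      simp [hz]
    exact continuousAt_const.congr this.symm

lemma contDiff_of_tsupport_subset {u f : E4 → ℝ} (hB : IsOpen B) (hu : ContDiff ℝ ∞ u)
    (hs : tsupport u ⊆ B) (hf : ContDiffOn ℝ ∞ f B) : ContDiff ℝ ∞ (fun y => u y * f y) := by
  rw [contDiff_iff_contDiffAt]
  intro y
  by_cases hy : y ∈ tsupport u
  · exact hu.contDiffAt.mul (hf.contDiffAt (hB.mem_nhds (hs hy)))
  · have h0 : u =ᶠ[𝓝 y] 0 := notMem_tsupport_iff_eventuallyEq.mp hy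
    have : (fun y => u y * f y) =ᶠ[𝓝 y] fun _ => 0 := by
      filter_upwards [h0] with z hz
      simp [hz]
    exact contDiffAt_const.congr_of_eventuallyEq this

lemma IsTestOn.mul {u f : E4 → ℝ} (hB : IsOpen B) (hu : IsTestOn B u)
    (hf : ContDiffOn ℝ ∞ f B) : IsTestOn B (fun y => u y * f y) :=
  ⟨contDiff_of_tsupport_subset hB hu.smooth hu.supp hf, hu.compact.mul_right,
    (tsupport_mul_subset_left).trans hu.supp⟩

lemma IsTestOn.integrable {u f : E4 → ℝ} (hB : IsOpen B) (hu : IsTestOn B u)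
    (hf : ContinuousOn f B) : Integrable (fun y => u y * f y) :=
  (continuous_of_tsupport_subset hB hu.smooth.continuous hu.supp hf).integrable_of_hasCompactSupport
    hu.compact.mul_right

lemma IsTestOn.mono {u : E4 → ℝ} {B' : Set E4} (hu : IsTestOn B u) (h : B ⊆ B') :
    IsTestOn B' u := ⟨hu.smooth, hu.compact, hu.supp.trans h⟩

lemma pder_eq_zero_of_notMem {u : E4 → ℝ} (a : Fin 4) {y : E4} (hy : y ∉ tsupport u) :
    pder a u y = 0 := by
  have h : fderiv ℝ u y = 0 := by
    have := notMem_tsupport_iff_eventuallyEq.mp hy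
    rw [this.fderiv_eq]; simp
  simp [pder, h]

lemma IsTestOn.pder {u : E4 → ℝ} (hu : IsTestOn B u) (a : Fin 4) :
    IsTestOn B (pder a u) := by
  refine ⟨?_, hu.compact.fderiv_apply ℝ _, ?_⟩
  · exact (hu.smooth.fderiv_right (m := ∞) (by simp)).clm_apply contDiff_const
  · refine Set.Subset.trans ?_ hu.supp
    refine closure_minimal ?_ (isClosed_tsupport u)
    intro y hy
    by_contra h
    exact hy (pder_eq_zero_of_notMem a h)

lemma contDiffOn_pder {f : E4 → ℝ} (hB : IsOpen B) (hf : ContDiffOn ℝ ∞ f B) (a : Fin 4) :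
    ContDiffOn ℝ ∞ (pder a f) B :=
  (hf.fderiv_of_isOpen hB (m := ∞) (by simp)).clm_apply contDiffOn_const

/-- Integration by parts against a test function. -/
lemma IsTestOn.integral_pder {u f : E4 → ℝ} (hB : IsOpen B) (hu : IsTestOn B u)
    (hf : ContDiffOn ℝ ∞ f B) (a : Fin 4) :
    ∫ y, u y * Spacetime.pder a f y = -∫ y, Spacetime.pder a u y * f y := by
  refine integral_mul_fderiv_eq_neg_fderiv_mul_of_integrable (μ := volume) (v := stdVec a)
    ?_ ?_ ?_ ?_ ?_
  · exact (hu.pder a).integrable hB hf.continuousOn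
  · exact hu.integrable hB (contDiffOn_pder hB hf a).continuousOn
  · exact hu.integrable hB hf.continuousOn
  · intro x _
    exact (hu.smooth.differentiable (by simp)).differentiableAt
  · intro x hx
    exact (hf.contDiffAt (hB.mem_nhds (hu.supp hx))).differentiableAt (by simp)

namespace Bd

lemma add (h : Bd B F) (h' : Bd B F') : Bd B (fun s y => F s y + F' s y) := by
  obtain ⟨C, hC⟩ := h.bound
  obtain ⟨C', hC'⟩ := h'.bound
  refine ⟨fun s hs => (h.cont s hs).add (h'.cont s hs), C + C', ?_⟩
  filter_upwards [hC, hC'] with s h1 h2 y hy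
  exact (abs_add_le _ _).trans (add_le_add (h1 y hy) (h2 y hy))

lemma mul (h : Bd B F) (h' : Bd B F') : Bd B (fun s y => F s y * F' s y) := by
  obtain ⟨C, hC⟩ := h.bound
  obtain ⟨C', hC'⟩ := h'.bound
  refine ⟨fun s hs => (h.cont s hs).mul (h'.cont s hs), C * C', ?_⟩
  filter_upwards [hC, hC'] with s h1 h2 y hy
  rw [abs_mul]
  exact mul_le_mul (h1 y hy) (h2 y hy) (abs_nonneg _) ((abs_nonneg _).trans (h1 y hy))

lemma const (c : ℝ) : Bd B (fun _ _ => c) :=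
  ⟨fun _ _ => continuousOn_const, |c|, Eventually.of_forall fun _ _ _ => le_rfl⟩

lemma const_mul (c : ℝ) (h : Bd B F) : Bd B (fun s y => c * F s y) := (Bd.const c).mul h

lemma neg (h : Bd B F) : Bd B (fun s y => -F s y) := by simpa using h.const_mul (-1)

lemma sub (h : Bd B F) (h' : Bd B F') : Bd B (fun s y => F s y - F' s y) := by
  simpa [sub_eq_add_neg] using h.add h'.neg

lemma sum {ι : Type*} (I : Finset ι) {F : ι → ℝ → E4 → ℝ} (h : ∀ i ∈ I, Bd B (F i)) :
    Bd B (fun s y => ∑ i ∈ I, F i s y) := by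
  classical
  induction I using Finset.induction_on with
  | empty => simpa using Bd.const 0
  | insert a I ha ih =>
    simp only [Finset.sum_insert ha]
    exact (h a (by simp)).add (ih fun i hi => h i (by simp [hi]))

lemma mono {B' : Set E4} (h : Bd B F) (hB : B' ⊆ B) : Bd B' F := by
  obtain ⟨C, hC⟩ := h.bound
  exact ⟨fun s hs => (h.cont s hs).mono hB, C, hC.mono fun s hs y hy => hs y (hB hy)⟩

lemma congr (h : Bd B F) (h' : ∀ s, 0 < s → ∀ y ∈ B, F' s y = F s y) : Bd B F' := by
  obtain ⟨C, hC⟩ := h.bound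
  refine ⟨fun s hs => (h.cont s hs).congr (h' s hs), C, ?_⟩
  filter_upwards [hC, eventually_pos] with s h1 h2 y hy
  rw [h' s h2 y hy]; exact h1 y hy

end Bd

namespace Sml

lemma add (h : Sml B F) (h' : Sml B F') : Sml B (fun s y => F s y + F' s y) := by
  obtain ⟨C, hC⟩ := h.bound
  obtain ⟨C', hC'⟩ := h'.bound
  refine ⟨fun s hs => (h.cont s hs).add (h'.cont s hs), C + C', ?_⟩
  filter_upwards [hC, hC'] with s h1 h2 y hy
  rw [add_mul]
  exact (abs_add_le _ _).trans (add_le_add (h1 y hy) (h2 y hy))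

lemma mul_bd (h : Sml B F) (h' : Bd B F') : Sml B (fun s y => F s y * F' s y) := by
  obtain ⟨C, hC⟩ := h.bound
  obtain ⟨C', hC'⟩ := h'.bound
  refine ⟨fun s hs => (h.cont s hs).mul (h'.cont s hs), C * C', ?_⟩
  filter_upwards [hC, hC'] with s h1 h2 y hy
  rw [abs_mul, mul_right_comm]
  exact mul_le_mul (h1 y hy) (h2 y hy) (abs_nonneg _) ((abs_nonneg _).trans (h1 y hy))

lemma bd_mul (h' : Bd B F') (h : Sml B F) : Sml B (fun s y => F' s y * F s y) := by
  simpa [mul_comm] using h.mul_bd h'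

lemma zero : Sml B (fun _ _ => (0 : ℝ)) :=
  ⟨fun _ _ => continuousOn_const, 0, Eventually.of_forall fun _ _ _ => by simp⟩

lemma const_mul (c : ℝ) (h : Sml B F) : Sml B (fun s y => c * F s y) := bd_mul (Bd.const c) h

lemma neg (h : Sml B F) : Sml B (fun s y => -F s y) := by simpa using h.const_mul (-1)

lemma sub (h : Sml B F) (h' : Sml B F') : Sml B (fun s y => F s y - F' s y) := by
  simpa [sub_eq_add_neg] using h.add h'.neg

lemma sum {ι : Type*} (I : Finset ι) {F : ι → ℝ → E4 → ℝ} (h : ∀ i ∈ I, Sml B (F i)) :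
    Sml B (fun s y => ∑ i ∈ I, F i s y) := by
  classical
  induction I using Finset.induction_on with
  | empty => simpa using Sml.zero
  | insert a I ha ih =>
    simp only [Finset.sum_insert ha]
    exact (h a (by simp)).add (ih fun i hi => h i (by simp [hi]))

lemma congr (h : Sml B F) (h' : ∀ s, 0 < s → ∀ y ∈ B, F' s y = F s y) : Sml B F' := by
  obtain ⟨C, hC⟩ := h.bound
  refine ⟨fun s hs => (h.cont s hs).congr (h' s hs), C, ?_⟩
  filter_upwards [hC, eventually_pos] with s h1 h2 y hy
  rw [h' s h2 y hy]; exact h1 y hy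

lemma bd (h : Sml B F) : Bd B F := by
  obtain ⟨C, hC⟩ := h.bound
  refine ⟨h.cont, |C|, ?_⟩
  filter_upwards [hC, Ioo_mem_nhdsGT (show (0 : ℝ) < 1 by norm_num)] with s h1 h2 y hy
  refine (h1 y hy).trans ((le_abs_self _).trans ?_)
  rw [abs_mul, abs_of_pos h2.1]
  exact mul_le_of_le_one_right (abs_nonneg _) h2.2.le

lemma mono {B' : Set E4} (h : Sml B F) (hB : B' ⊆ B) : Sml B' F := by
  obtain ⟨C, hC⟩ := h.bound
  exact ⟨fun s hs => (h.cont s hs).mono hB, C, hC.mono fun s hs y hy => hs y (hB hy)⟩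

/-- Uniform convergence to zero implies weak convergence to zero. -/
lemma wk (h : Sml B F) : Wk B F (fun _ => 0) := by
  refine ⟨h.cont, continuousOn_const, fun u hu => ?_⟩
  obtain ⟨C, hC⟩ := h.bound
  have hi : Integrable (fun y => |u y|) :=
    (hu.smooth.continuous.integrable_of_hasCompactSupport hu.compact).abs
  simp only [mul_zero, integral_zero]
  have hlim : Tendsto (fun s : ℝ => (C * s) * ∫ y, |u y|) (𝓝[>] 0) (𝓝 0) := by
    have : Tendsto (fun s : ℝ => (C * s) * ∫ y, |u y|) (𝓝 0) (𝓝 ((C * 0) * ∫ y, |u y|)) :=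
      ((continuous_const.mul continuous_id).mul continuous_const).tendsto _
    simp only [mul_zero, zero_mul] at this
    exact this.mono_left nhdsWithin_le_nhds
  refine squeeze_zero_norm' ?_ hlim
  filter_upwards [hC] with s hs
  rw [← integral_const_mul]
  refine norm_integral_le_of_norm_le (hi.const_mul _) (Eventually.of_forall fun y => ?_)
  rw [Real.norm_eq_abs, abs_mul, mul_comm]
  by_cases hy : y ∈ tsupport u
  · exact mul_le_mul_of_nonneg_right (hs y (hu.supp hy)) (abs_nonneg _)
  · simp [image_eq_zero_of_notMem_tsupport hy]

end Sml

namespace Wk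

lemma const (hL : ContinuousOn L B) : Wk B (fun _ => L) L :=
  ⟨fun _ _ => hL, hL, fun _ _ => tendsto_const_nhds⟩

lemma zero : Wk B (fun _ _ => 0) (fun _ => 0) := const continuousOn_const

lemma congr (h : Wk B F L) (h' : ∀ s, 0 < s → ∀ y ∈ B, F' s y = F s y)
    (hL : ∀ y ∈ B, L' y = L y) : Wk B F' L' := by
  refine ⟨fun s hs => (h.cont s hs).congr (h' s hs), h.contL.congr hL, fun u hu => ?_⟩
  have e : ∀ f g : E4 → ℝ, (∀ y ∈ B, f y = g y) → ∫ y, u y * f y = ∫ y, u y * g y := by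
    intro f g hfg
    refine integral_congr_ae (Eventually.of_forall fun y => ?_)
    by_cases hy : y ∈ tsupport u
    · simp [hfg y (hu.supp hy)]
    · simp [image_eq_zero_of_notMem_tsupport hy]
  rw [e L' L hL]
  refine (h.lim u hu).congr' ?_
  filter_upwards [eventually_pos] with s hs
  exact (e _ _ (h' s hs)).symm

lemma add (hB : IsOpen B) (h : Wk B F L) (h' : Wk B F' L') :
    Wk B (fun s y => F s y + F' s y) (fun y => L y + L' y) := by
  refine ⟨fun s hs => (h.cont s hs).add (h'.cont s hs), h.contL.add h'.contL, fun u hu => ?_⟩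
  have e : ∀ f g : E4 → ℝ, ContinuousOn f B → ContinuousOn g B →
      ∫ y, u y * (f y + g y) = (∫ y, u y * f y) + ∫ y, u y * g y := by
    intro f g hf hg
    simp only [mul_add]
    exact integral_add (hu.integrable hB hf) (hu.integrable hB hg)
  rw [e L L' h.contL h'.contL]
  refine ((h.lim u hu).add (h'.lim u hu)).congr' ?_
  filter_upwards [eventually_pos] with s hs
  exact (e _ _ (h.cont s hs) (h'.cont s hs)).symm

/-- Smooth coefficients may be moved into the test function. -/
lemma smul (hB : IsOpen B) {c : E4 → ℝ} (hc : ContDiffOn ℝ ∞ c B) (h : Wk B F L) :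
    Wk B (fun s y => c y * F s y) (fun y => c y * L y) := by
  refine ⟨fun s hs => hc.continuousOn.mul (h.cont s hs), hc.continuousOn.mul h.contL,
    fun u hu => ?_⟩
  simpa only [mul_assoc] using h.lim _ (hu.mul hB hc)

lemma const_mul (hB : IsOpen B) (c : ℝ) (h : Wk B F L) :
    Wk B (fun s y => c * F s y) (fun y => c * L y) :=
  h.smul hB (c := fun _ => c) contDiffOn_const

lemma sub (hB : IsOpen B) (h : Wk B F L) (h' : Wk B F' L') :
    Wk B (fun s y => F s y - F' s y) (fun y => L y - L' y) :=
  (h.add hB (h'.const_mul hB (-1))).congr (fun _ _ _ _ => by ring) (fun _ _ => by ring)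

lemma sum (hB : IsOpen B) {ι : Type*} (I : Finset ι) {F : ι → ℝ → E4 → ℝ} {L : ι → E4 → ℝ}
    (h : ∀ i ∈ I, Wk B (F i) (L i)) :
    Wk B (fun s y => ∑ i ∈ I, F i s y) (fun y => ∑ i ∈ I, L i y) := by
  classical
  induction I using Finset.induction_on with
  | empty => simpa using Wk.zero
  | insert a I ha ih =>
    simp only [Finset.sum_insert ha]
    exact (h a (by simp)).add hB (ih fun i hi => h i (by simp [hi]))

lemma add_sml (hB : IsOpen B) (h : Wk B F L) (h' : Sml B F') :
    Wk B (fun s y => F s y + F' s y) L :=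
  (h.add hB h'.wk).congr (fun _ _ _ _ => rfl) (fun _ _ => by simp)

lemma of_sub_sml (hB : IsOpen B) (h : Wk B F L) (h' : Sml B (fun s y => F' s y - F s y)) :
    Wk B F' L :=
  (h.add_sml hB h').congr (fun _ _ _ _ => by ring) (fun _ _ => rfl)

lemma mono {B' : Set E4} (h : Wk B F L) (hB : B' ⊆ B) : Wk B' F L :=
  ⟨fun s hs => (h.cont s hs).mono hB, h.contL.mono hB, fun u hu => h.lim u (hu.mono hB)⟩

/-- Differentiation is weakly continuous. -/
lemma pder (hB : IsOpen B) (h : Wk B F L) (hF : ∀ s, 0 < s → ContDiffOn ℝ ∞ (F s) B)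
    (hL : ContDiffOn ℝ ∞ L B) (a : Fin 4) :
    Wk B (fun s => Spacetime.pder a (F s)) (Spacetime.pder a L) := by
  refine ⟨fun s hs => (contDiffOn_pder hB (hF s hs) a).continuousOn,
    (contDiffOn_pder hB hL a).continuousOn, fun u hu => ?_⟩
  rw [hu.integral_pder hB hL]
  refine ((h.lim _ (hu.pder a)).neg).congr' ?_
  filter_upwards [eventually_pos] with s hs
  rw [hu.integral_pder hB (hF s hs)]

/-- Uniqueness of weak limits. -/
lemma unique (hB : IsOpen B) (h : Wk B F L) (h' : Wk B F L') : ∀ y ∈ B, L y = L' y := by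
  have hc : ContinuousOn (fun y => L y - L' y) B := h.contL.sub h'.contL
  have key := hB.ae_eq_zero_of_integral_contDiff_smul_eq_zero (μ := volume)
    (f := fun y => L y - L' y) (hc.locallyIntegrableOn hB.measurableSet) ?_
  · have h2 : (fun y => L y - L' y) =ᵐ[volume.restrict B] fun _ => 0 := by
      rw [EventuallyEq, ae_restrict_iff' hB.measurableSet]
      exact key
    have h3 := Measure.eqOn_of_ae_eq h2 hc continuousOn_const
      (by rw [hB.interior_eq]; exact subset_closure)
    intro y hy
    exact sub_eq_zero.mp (h3 hy)
  · intro u h1 h2 h3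
    have hu : IsTestOn B u := ⟨h1, h2, h3⟩
    simp only [smul_eq_mul, mul_sub]
    rw [integral_sub (hu.integrable hB h.contL) (hu.integrable hB h'.contL), sub_eq_zero]
    exact tendsto_nhds_unique (h.lim u hu) (h'.lim u hu)

end Wk

/-- `F s = F₀ + D s + O(s)`, where `D s` is bounded and tends weakly to zero. -/
structure Expand (B : Set E4) (F : ℝ → E4 → ℝ) (F₀ : E4 → ℝ) (D : ℝ → E4 → ℝ) : Prop where
  smooth : ContDiffOn ℝ ∞ F₀ B
  bdd₀ : Bd B (fun _ => F₀)
  bdd : Bd B D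
  wk : Wk B D (fun _ => 0)
  rem : Sml B (fun s y => F s y - F₀ y - D s y)

namespace Expand

variable {F₀ F₀' : E4 → ℝ} {D D' : ℝ → E4 → ℝ}

lemma tendsto (hB : IsOpen B) (h : Expand B F F₀ D) : Wk B F F₀ :=
  (((Wk.const h.smooth.continuousOn).add hB h.wk).add_sml hB h.rem).congr
    (fun _ _ _ _ => by ring) (fun _ _ => by simp)

lemma bd_self (h : Expand B F F₀ D) : Bd B F :=
  ((h.bdd₀.add h.bdd).add h.rem.bd).congr (fun _ _ _ _ => by ring)

/-- The weak limit of a product differs from the product of the weak limits by the weak limit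
of the product of the oscillating parts. -/
lemma mul (hB : IsOpen B) (h : Expand B F F₀ D) (h' : Expand B F' F₀' D')
    (hL : Wk B (fun s y => D s y * D' s y) L) :
    Wk B (fun s y => F s y * F' s y) (fun y => F₀ y * F₀' y + L y) := by
  have h1 : Wk B (fun s y => F₀ y * F₀' y) (fun y => F₀ y * F₀' y) :=
    Wk.const (h.smooth.continuousOn.mul h'.smooth.continuousOn)
  have h2 := h'.wk.smul hB h.smooth
  have h3 := h.wk.smul hB h'.smooth
  have h4 := h.rem.mul_bd h'.bd_self
  have h5 := Sml.bd_mul (h.bdd₀.add h.bdd) h'.rem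
  exact (((((h1.add hB h2).add hB h3).add hB hL).add_sml hB h4).add_sml hB h5).congr
    (fun _ _ _ _ => by ring) (fun _ _ => by ring)

end Expand

end

section

open Filter

/-! ### Curvature of a metric in local coordinates -/

/-- Real `4 × 4` matrices. -/
abbrev Mat4 : Type := Matrix (Fin 4) (Fin 4) ℝ

/-- The Christoffel symbols `Γ^c_{ab}` of a matrix-valued function. -/
def locChr (γ : E4 → Mat4) (c a b : Fin 4) (y : E4) : ℝ :=
  (1 / 2) * ∑ d, (γ y)⁻¹ c d *
    (pder a (fun z => γ z b d) y + pder b (fun z => γ z a d) y - pder d (fun z => γ z a b) y)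

/-- The Ricci tensor `R_{ab}` of a matrix-valued function. -/
def locRic (γ : E4 → Mat4) (a b : Fin 4) (y : E4) : ℝ :=
  ∑ c, (pder c (locChr γ c a b) y - pder a (locChr γ c c b) y)
    + ∑ c, ∑ d, (locChr γ d a b y * locChr γ c c d y - locChr γ d c b y * locChr γ c d a y)

/-- Smooth symmetric nondegenerate matrix-valued functions on `B`. -/
structure IsMetricOn (B : Set E4) (γ : E4 → Mat4) : Prop where
  smooth : ∀ a b, ContDiffOn ℝ ∞ (fun y => γ y a b) B
  symm : ∀ y ∈ B, (γ y).IsSymm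
  det : ∀ y ∈ B, (γ y).det ≠ 0

lemma contDiffOn_det {B : Set E4} {γ : E4 → Mat4}
    (h : ∀ a b, ContDiffOn ℝ ∞ (fun y => γ y a b) B) :
    ContDiffOn ℝ ∞ (fun y => (γ y).det) B := by
  simp only [Matrix.det_apply']
  refine ContDiffOn.sum fun σ _ => contDiffOn_const.mul ?_
  exact contDiffOn_prod fun i _ => h _ _

lemma contDiffOn_matrix_inv {B : Set E4} {γ : E4 → Mat4}
    (h : ∀ a b, ContDiffOn ℝ ∞ (fun y => γ y a b) B) (hd : ∀ y ∈ B, (γ y).det ≠ 0)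
    (a b : Fin 4) : ContDiffOn ℝ ∞ (fun y => (γ y)⁻¹ a b) B := by
  have h1 : ∀ y, (γ y)⁻¹ a b = ((γ y).det)⁻¹ * ((γ y).updateRow b (Pi.single a 1)).det := by
    intro y
    rw [Matrix.inv_def, Matrix.smul_apply, Ring.inverse_eq_inv', Matrix.adjugate_apply, smul_eq_mul]
  simp only [h1]
  refine ((contDiffOn_det h).inv hd).mul ?_
  refine contDiffOn_det fun i j => ?_
  by_cases hi : i = b
  · subst hi
    simpa using contDiffOn_const
  · simpa [Matrix.updateRow_ne hi] using h i j

namespace IsMetricOn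

variable {B : Set E4} {γ : E4 → Mat4}

lemma inv_smooth (h : IsMetricOn B γ) (a b : Fin 4) :
    ContDiffOn ℝ ∞ (fun y => (γ y)⁻¹ a b) B :=
  contDiffOn_matrix_inv h.smooth h.det a b

lemma inv_symm (h : IsMetricOn B γ) {y : E4} (hy : y ∈ B) (a b : Fin 4) :
    (γ y)⁻¹ a b = (γ y)⁻¹ b a := by
  have : ((γ y)⁻¹).IsSymm := by
    rw [Matrix.IsSymm, Matrix.transpose_nonsing_inv, h.symm y hy]
  exact (this.apply b a)

lemma mul_inv (h : IsMetricOn B γ) {y : E4} (hy : y ∈ B) : γ y * (γ y)⁻¹ = 1 :=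
  Matrix.mul_nonsing_inv _ (isUnit_iff_ne_zero.mpr (h.det y hy))

lemma inv_mul (h : IsMetricOn B γ) {y : E4} (hy : y ∈ B) : (γ y)⁻¹ * γ y = 1 :=
  Matrix.nonsing_inv_mul _ (isUnit_iff_ne_zero.mpr (h.det y hy))

lemma pder_smooth (hB : IsOpen B) (h : IsMetricOn B γ) (c a b : Fin 4) :
    ContDiffOn ℝ ∞ (pder c (fun y => γ y a b)) B := contDiffOn_pder hB (h.smooth a b) c

lemma chr_smooth (hB : IsOpen B) (h : IsMetricOn B γ) (c a b : Fin 4) :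
    ContDiffOn ℝ ∞ (locChr γ c a b) B := by
  refine contDiffOn_const.mul (ContDiffOn.sum fun d _ => (h.inv_smooth c d).mul ?_)
  exact ((h.pder_smooth hB _ _ _).add (h.pder_smooth hB _ _ _)).sub (h.pder_smooth hB _ _ _)

lemma ric_smooth (hB : IsOpen B) (h : IsMetricOn B γ) (a b : Fin 4) :
    ContDiffOn ℝ ∞ (locRic γ a b) B := by
  refine ContDiffOn.add (ContDiffOn.sum fun c _ => ?_)
    (ContDiffOn.sum fun c _ => ContDiffOn.sum fun d _ => ?_)
  · exact (contDiffOn_pder hB (h.chr_smooth hB _ _ _) _).sub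
      (contDiffOn_pder hB (h.chr_smooth hB _ _ _) _)
  · exact ((h.chr_smooth hB _ _ _).mul (h.chr_smooth hB _ _ _)).sub
      ((h.chr_smooth hB _ _ _).mul (h.chr_smooth hB _ _ _))

end IsMetricOn

section pder_rules

variable {B : Set E4} {y : E4}

lemma differentiableAt_of_contDiffOn {f : E4 → ℝ} (hB : IsOpen B) (hf : ContDiffOn ℝ ∞ f B)
    (hy : y ∈ B) : DifferentiableAt ℝ f y :=
  (hf.contDiffAt (hB.mem_nhds hy)).differentiableAt (by simp)

lemma pder_sub {f g : E4 → ℝ} (a : Fin 4) (hf : DifferentiableAt ℝ f y)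
    (hg : DifferentiableAt ℝ g y) :
    pder a (fun z => f z - g z) y = pder a f y - pder a g y := by
  simp only [pder]
  rw [fderiv_fun_sub hf hg]; rfl

lemma pder_mul {f g : E4 → ℝ} (a : Fin 4) (hf : DifferentiableAt ℝ f y)
    (hg : DifferentiableAt ℝ g y) :
    pder a (fun z => f z * g z) y = pder a f y * g y + f y * pder a g y := by
  simp only [pder]
  rw [fderiv_fun_mul hf hg]
  simp; ring

lemma pder_const_mul {f : E4 → ℝ} (a : Fin 4) (c : ℝ) (hf : DifferentiableAt ℝ f y) :
    pder a (fun z => c * f z) y = c * pder a f y := by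
  simp only [pder]
  rw [fderiv_const_mul hf]; rfl

lemma pder_sum {ι : Type*} (I : Finset ι) {f : ι → E4 → ℝ} (a : Fin 4)
    (hf : ∀ i ∈ I, DifferentiableAt ℝ (f i) y) :
    pder a (fun z => ∑ i ∈ I, f i z) y = ∑ i ∈ I, pder a (f i) y := by
  simp only [pder]
  rw [fderiv_fun_sum hf]
  simp

lemma pder_congr {f g : E4 → ℝ} (a : Fin 4) (hB : IsOpen B) (hy : y ∈ B)
    (h : ∀ z ∈ B, f z = g z) : pder a f y = pder a g y := by
  have : f =ᶠ[𝓝 y] g := by filter_upwards [hB.mem_nhds hy] with z hz using h z hz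
  simp only [pder, this.fderiv_eq]

/-- Partial derivatives commute. -/
lemma pder_comm {f : E4 → ℝ} (hB : IsOpen B) (hf : ContDiffOn ℝ ∞ f B) (hy : y ∈ B)
    (a b : Fin 4) : pder a (pder b f) y = pder b (pder a f) y := by
  have hc : ContDiffAt ℝ ∞ f y := hf.contDiffAt (hB.mem_nhds hy)
  have hs : IsSymmSndFDerivAt ℝ f y :=
    hc.isSymmSndFDerivAt (by simpa using WithTop.coe_le_coe.2 (le_top : (2 : ℕ∞) ≤ ⊤))
  have hd : DifferentiableAt ℝ (fderiv ℝ f) y :=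
    (hc.fderiv_right (m := 1) (by norm_cast)).differentiableAt (by simp)
  have key : ∀ u v : E4, fderiv ℝ (fun z => fderiv ℝ f z v) y u = fderiv ℝ (fderiv ℝ f) y u v := by
    intro u v
    rw [fderiv_clm_apply hd (differentiableAt_const v)]
    simp
  have e : ∀ a b : Fin 4, pder a (pder b f) y
      = fderiv ℝ (fderiv ℝ f) y (stdVec a) (stdVec b) := fun a b => key _ _
  rw [e, e]
  exact hs _ _

end pder_rules

namespace IsMetricOn

variable {B : Set E4} {γ : E4 → Mat4}

/-- `∂_c g^{ab} = -g^{ad} (∂_c g_{de}) g^{eb}`. -/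
lemma pder_inv (hB : IsOpen B) (h : IsMetricOn B γ) {y : E4} (hy : y ∈ B) (c a b : Fin 4) :
    pder c (fun z => (γ z)⁻¹ a b) y
      = -∑ d, ∑ e, (γ y)⁻¹ a d * pder c (fun z => γ z d e) y * (γ y)⁻¹ e b := by
  have hd1 : ∀ i j, DifferentiableAt ℝ (fun z => γ z i j) y := fun i j =>
    differentiableAt_of_contDiffOn hB (h.smooth i j) hy
  have hd2 : ∀ i j, DifferentiableAt ℝ (fun z => (γ z)⁻¹ i j) y := fun i j =>
    differentiableAt_of_contDiffOn hB (h.inv_smooth i j) hy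
  -- differentiate `g⁻¹ g = 1`
  have h1 : ∀ e, ∑ d, (pder c (fun z => (γ z)⁻¹ a d) y * γ y d e
      + (γ y)⁻¹ a d * pder c (fun z => γ z d e) y) = 0 := by
    intro e
    have : pder c (fun z => ∑ d, (γ z)⁻¹ a d * γ z d e) y = 0 := by
      rw [pder_congr c hB hy (g := fun _ => (1 : Mat4) a e)]
      · simp [pder]
      · intro z hz
        rw [← h.inv_mul hz, Matrix.mul_apply]
    rw [pder_sum _ _ fun d _ => (hd2 a d).fun_mul (hd1 d e)] at this
    rw [← this]
    exact Finset.sum_congr rfl fun d _ => (pder_mul c (hd2 a d) (hd1 d e)).symm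
  let P : Mat4 := Matrix.of fun i j => pder c (fun z => (γ z)⁻¹ i j) y
  let Q : Mat4 := Matrix.of fun i j => pder c (fun z => γ z i j) y
  have h2 : (P * γ y + (γ y)⁻¹ * Q) * (γ y)⁻¹ = P + (γ y)⁻¹ * Q * (γ y)⁻¹ := by
    rw [add_mul, mul_assoc, h.mul_inv hy, mul_one]
  have h3 : ((P * γ y + (γ y)⁻¹ * Q) * (γ y)⁻¹) a b = 0 := by
    rw [Matrix.mul_apply]
    refine Finset.sum_eq_zero fun e _ => ?_
    have : (P * γ y + (γ y)⁻¹ * Q) a e = 0 := by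
      rw [Matrix.add_apply, Matrix.mul_apply, Matrix.mul_apply, ← Finset.sum_add_distrib]
      exact h1 e
    rw [this, zero_mul]
  rw [h2, Matrix.add_apply] at h3
  have h4 : ((γ y)⁻¹ * Q * (γ y)⁻¹) a b
      = ∑ d, ∑ e, (γ y)⁻¹ a d * pder c (fun z => γ z d e) y * (γ y)⁻¹ e b := by
    simp only [Matrix.mul_apply, Finset.sum_mul]
    rw [Finset.sum_comm]
    rfl
  rw [h4] at h3
  exact eq_neg_of_add_eq_zero_left h3

lemma chr_symm (hB : IsOpen B) (h : IsMetricOn B γ) {y : E4} (hy : y ∈ B) (c a b : Fin 4) :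
    locChr γ c a b y = locChr γ c b a y := by
  have hs : ∀ d, pder d (fun z => γ z a b) y = pder d (fun z => γ z b a) y := fun d =>
    pder_congr d hB hy fun z hz => (h.symm z hz).apply b a
  simp only [locChr]
  congr 1
  refine Finset.sum_congr rfl fun d _ => ?_
  rw [hs d]; ring

/-- The contracted Christoffel symbol `Γ^c_{cb} = (1/2) g^{cd} ∂_b g_{cd}`. -/
lemma chr_contract (hB : IsOpen B) (h : IsMetricOn B γ) {y : E4} (hy : y ∈ B) (b : Fin 4) :
    ∑ c, locChr γ c c b y
      = (1 / 2) * ∑ c, ∑ d, (γ y)⁻¹ c d * pder b (fun z => γ z c d) y := by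
  have hs : ∀ d a b, pder d (fun z => γ z a b) y = pder d (fun z => γ z b a) y := fun d a b =>
    pder_congr d hB hy fun z hz => (h.symm z hz).apply b a
  simp only [locChr, ← Finset.mul_sum]
  congr 1
  have e1 : ∀ c d, (γ y)⁻¹ c d * (pder c (fun z => γ z b d) y + pder b (fun z => γ z c d) y
        - pder d (fun z => γ z c b) y)
      = (γ y)⁻¹ c d * pder b (fun z => γ z c d) y
        + ((γ y)⁻¹ c d * pder c (fun z => γ z b d) y - (γ y)⁻¹ c d * pder d (fun z => γ z b c) y) := by
    intro c d
    rw [hs d c b]; ring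
  simp only [e1, Finset.sum_add_distrib, Finset.sum_sub_distrib]
  rw [Finset.sum_comm (f := fun c d => (γ y)⁻¹ c d * pder d (fun z => γ z b c) y)]
  rw [add_eq_left, sub_eq_zero]
  refine Finset.sum_congr rfl fun c _ => Finset.sum_congr rfl fun d _ => ?_
  rw [h.inv_symm hy]

/-- The Ricci tensor is symmetric. -/
lemma ric_symm (hB : IsOpen B) (h : IsMetricOn B γ) {y : E4} (hy : y ∈ B) (a b : Fin 4) :
    locRic γ a b y = locRic γ b a y := by
  have hd : ∀ c i j, DifferentiableAt ℝ (locChr γ c i j) y := fun c i j =>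
    differentiableAt_of_contDiffOn hB (h.chr_smooth hB c i j) hy
  have hd1 : ∀ i j, DifferentiableAt ℝ (fun z => (γ z)⁻¹ i j) y := fun i j =>
    differentiableAt_of_contDiffOn hB (h.inv_smooth i j) hy
  have hd2 : ∀ c i j, DifferentiableAt ℝ (pder c fun z => γ z i j) y := fun c i j =>
    differentiableAt_of_contDiffOn hB (h.pder_smooth hB c i j) hy
  have h1 : ∀ a b, ∑ c, pder a (locChr γ c c b) y
      = (1 / 2) * ∑ c, ∑ d, (-(∑ e, ∑ f, (γ y)⁻¹ c e * pder a (fun z => γ z e f) y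
            * (γ y)⁻¹ f d) * pder b (fun z => γ z c d) y
          + (γ y)⁻¹ c d * pder a (pder b fun z => γ z c d) y) := by
    intro a b
    rw [← pder_sum _ _ fun c _ => hd c c b,
      pder_congr a hB hy fun z hz => h.chr_contract hB hz b,
      pder_const_mul _ _ (DifferentiableAt.fun_sum fun c _ => DifferentiableAt.fun_sum fun d _ =>
        (hd1 c d).fun_mul (hd2 b c d)),
      pder_sum _ _ fun c _ => DifferentiableAt.fun_sum fun d _ => (hd1 c d).fun_mul (hd2 b c d)]
    congr 1
    refine Finset.sum_congr rfl fun c _ => ?_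
    rw [pder_sum _ _ fun d _ => (hd1 c d).fun_mul (hd2 b c d)]
    refine Finset.sum_congr rfl fun d _ => ?_
    rw [pder_mul a (hd1 c d) (hd2 b c d), h.pder_inv hB hy]
  have h2 : ∑ c, pder a (locChr γ c c b) y = ∑ c, pder b (locChr γ c c a) y := by
    rw [h1, h1]
    congr 1
    simp only [Finset.sum_add_distrib]
    congr 1
    · simp only [neg_mul, Finset.sum_neg_distrib, Finset.sum_mul, neg_inj]
      -- both sides are `g^{ce} (∂_a g_{ef}) g^{fd} (∂_b g_{cd})`
      have : ∀ F : Fin 4 → Fin 4 → Fin 4 → Fin 4 → ℝ,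
          ∑ c, ∑ d, ∑ e, ∑ f, F c d e f = ∑ c, ∑ d, ∑ e, ∑ f, F e f c d := by
        intro F
        calc ∑ c, ∑ d, ∑ e, ∑ f, F c d e f
            = ∑ p : Fin 4 × Fin 4, ∑ q : Fin 4 × Fin 4, F p.1 p.2 q.1 q.2 := by
              simp only [Fintype.sum_prod_type]
          _ = ∑ q : Fin 4 × Fin 4, ∑ p : Fin 4 × Fin 4, F p.1 p.2 q.1 q.2 := Finset.sum_comm
          _ = _ := by simp only [Fintype.sum_prod_type]
      rw [this]
      refine Finset.sum_congr rfl fun c _ => Finset.sum_congr rfl fun d _ =>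
        Finset.sum_congr rfl fun e _ => Finset.sum_congr rfl fun f _ => ?_
      rw [h.inv_symm hy e c, h.inv_symm hy d f]; ring
    · refine Finset.sum_congr rfl fun c _ => Finset.sum_congr rfl fun d _ => ?_
      rw [pder_comm hB (h.smooth c d) hy]
  have h3 : ∀ c, pder c (locChr γ c a b) y = pder c (locChr γ c b a) y := fun c =>
    pder_congr c hB hy fun z hz => h.chr_symm hB hz c a b
  simp only [locRic, Finset.sum_sub_distrib, h2, h3]
  congr 2
  · exact Finset.sum_congr rfl fun c _ => Finset.sum_congr rfl fun d _ => by
      rw [h.chr_symm hB hy d a b]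
  · rw [Finset.sum_comm]
    refine Finset.sum_congr rfl fun c _ => Finset.sum_congr rfl fun d _ => ?_
    rw [h.chr_symm hB hy c d b, h.chr_symm hB hy d c a]; ring

end IsMetricOn

end

section

open Filter

/-! ### One-parameter families of metrics with oscillating first derivatives -/

lemma Bd.exists_uniform {B : Set E4} {ι : Type*} [Fintype ι] {F : ι → ℝ → E4 → ℝ}
    (h : ∀ i, Bd B (F i)) :
    ∃ K, 0 ≤ K ∧ ∀ᶠ s in 𝓝[>] (0 : ℝ), ∀ i, ∀ y ∈ B, |F i s y| ≤ K := by
  choose C hC using fun i => (h i).bound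
  refine ⟨∑ i, |C i|, Finset.sum_nonneg fun _ _ => abs_nonneg _, ?_⟩
  filter_upwards [eventually_all.mpr hC] with s hs i y hy
  exact (hs i y hy).trans ((le_abs_self _).trans
    (Finset.single_le_sum (f := fun i => |C i|) (fun _ _ => abs_nonneg _) (Finset.mem_univ i)))

lemma Sml.exists_uniform {B : Set E4} {ι : Type*} [Fintype ι] {F : ι → ℝ → E4 → ℝ}
    (h : ∀ i, Sml B (F i)) :
    ∃ K, 0 ≤ K ∧ ∀ᶠ s in 𝓝[>] (0 : ℝ), ∀ i, ∀ y ∈ B, |F i s y| ≤ K * s := by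
  choose C hC using fun i => (h i).bound
  refine ⟨∑ i, |C i|, Finset.sum_nonneg fun _ _ => abs_nonneg _, ?_⟩
  filter_upwards [eventually_all.mpr hC, eventually_pos] with s hs hs0 i y hy
  refine (hs i y hy).trans (mul_le_mul_of_nonneg_right ((le_abs_self _).trans
    (Finset.single_le_sum (f := fun i => |C i|) (fun _ _ => abs_nonneg _) (Finset.mem_univ i)))
    hs0.le)

/-- The derivative `∂_c h_{ab}` of the deviation `h = γ s - γ 0`. -/
def osc (γ : ℝ → E4 → Mat4) (c a b : Fin 4) (s : ℝ) : E4 → ℝ :=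
  pder c (fun z => γ s z a b - γ 0 z a b)

/-- The leading oscillating part
`(1/2) g₀^{cd} (∂_a h_{bd} + ∂_b h_{ad} - ∂_d h_{ab})` of the Christoffel symbols. -/
def oscChr (γ : ℝ → E4 → Mat4) (c a b : Fin 4) (s : ℝ) (y : E4) : ℝ :=
  (1 / 2) * ∑ d, (γ 0 y)⁻¹ c d * (osc γ a b d s y + osc γ b a d s y - osc γ d a b s y)

/-- A family of metrics on `B` with `h = O(s)` and `∂h` bounded, uniformly on `B`. -/
structure MetricFamily (B : Set E4) (γ : ℝ → E4 → Mat4) : Prop where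
  isOpen : IsOpen B
  metric : ∀ s, 0 ≤ s → IsMetricOn B (γ s)
  bdd : ∀ a b, Bd B (fun _ y => γ 0 y a b)
  bdd_inv : ∀ a b, Bd B (fun _ y => (γ 0 y)⁻¹ a b)
  bdd_pder : ∀ c a b, Bd B (fun _ => pder c (fun z => γ 0 z a b))
  sml : ∀ a b, Sml B (fun s y => γ s y a b - γ 0 y a b)
  bdd_osc : ∀ c a b, Bd B (osc γ c a b)

/-- The functions `m c a b d e f` are the weak limits of `∂_c h_{ab} ∂_d h_{ef}`. -/
def HasQuadLimit (B : Set E4) (γ : ℝ → E4 → Mat4)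
    (m : Fin 4 → Fin 4 → Fin 4 → Fin 4 → Fin 4 → Fin 4 → E4 → ℝ) : Prop :=
  ∀ c a b d e f, Wk B (fun s y => osc γ c a b s y * osc γ d e f s y) (m c a b d e f)

namespace MetricFamily

variable {B : Set E4} {γ : ℝ → E4 → Mat4}

lemma mono {B' : Set E4} (h : MetricFamily B γ) (hB' : IsOpen B') (hs : B' ⊆ B) :
    MetricFamily B' γ where
  isOpen := hB'
  metric s h0 := ⟨fun a b => ((h.metric s h0).smooth a b).mono hs,
    fun y hy => (h.metric s h0).symm y (hs hy), fun y hy => (h.metric s h0).det y (hs hy)⟩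
  bdd a b := (h.bdd a b).mono hs
  bdd_inv a b := (h.bdd_inv a b).mono hs
  bdd_pder c a b := (h.bdd_pder c a b).mono hs
  sml a b := (h.sml a b).mono hs
  bdd_osc c a b := (h.bdd_osc c a b).mono hs

lemma dev_smooth (h : MetricFamily B γ) {s : ℝ} (hs : 0 < s) (a b : Fin 4) :
    ContDiffOn ℝ ∞ (fun y => γ s y a b - γ 0 y a b) B :=
  ((h.metric s hs.le).smooth a b).sub ((h.metric 0 le_rfl).smooth a b)

lemma osc_smooth (h : MetricFamily B γ) {s : ℝ} (hs : 0 < s) (c a b : Fin 4) :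
    ContDiffOn ℝ ∞ (osc γ c a b s) B :=
  contDiffOn_pder h.isOpen (h.dev_smooth hs a b) c

lemma osc_symm (h : MetricFamily B γ) {s : ℝ} (hs : 0 < s) (c a b : Fin 4) {y : E4}
    (hy : y ∈ B) : osc γ c a b s y = osc γ c b a s y :=
  pder_congr c h.isOpen hy fun z hz => by
    rw [((h.metric s hs.le).symm z hz).apply b a, ((h.metric 0 le_rfl).symm z hz).apply b a]

lemma pder_eq_add_osc (h : MetricFamily B γ) {s : ℝ} (hs : 0 < s) (c a b : Fin 4) {y : E4}
    (hy : y ∈ B) :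
    pder c (fun z => γ s z a b) y = pder c (fun z => γ 0 z a b) y + osc γ c a b s y := by
  rw [osc, pder_sub c
    (differentiableAt_of_contDiffOn h.isOpen ((h.metric s hs.le).smooth a b) hy)
    (differentiableAt_of_contDiffOn h.isOpen ((h.metric 0 le_rfl).smooth a b) hy)]
  ring

lemma bdd_self (h : MetricFamily B γ) (a b : Fin 4) : Bd B (fun s y => γ s y a b) :=
  ((h.bdd a b).add (h.sml a b).bd).congr fun _ _ _ _ => by ring

lemma bdd_pder_self (h : MetricFamily B γ) (c a b : Fin 4) :
    Bd B (fun s => pder c (fun z => γ s z a b)) :=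
  ((h.bdd_pder c a b).add (h.bdd_osc c a b)).congr fun _ hs _ hy => h.pder_eq_add_osc hs c a b hy

/-- `g^{ab}(s) - g₀^{ab} = -g₀^{ac} h_{cd}(s) g^{db}(s)`. -/
lemma inv_sub (h : MetricFamily B γ) {s : ℝ} (hs : 0 < s) {y : E4} (hy : y ∈ B) (a b : Fin 4) :
    (γ s y)⁻¹ a b - (γ 0 y)⁻¹ a b
      = -∑ c, ∑ d, (γ 0 y)⁻¹ a c * (γ s y c d - γ 0 y c d) * (γ s y)⁻¹ d b := by
  have h1 : (γ 0 y)⁻¹ * (γ s y - γ 0 y) * (γ s y)⁻¹ = (γ 0 y)⁻¹ - (γ s y)⁻¹ := by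
    rw [mul_sub, (h.metric 0 le_rfl).inv_mul hy, sub_mul, mul_assoc,
      (h.metric s hs.le).mul_inv hy, mul_one, one_mul]
  have h2 := congrFun (congrFun h1 a) b
  rw [Matrix.sub_apply, Matrix.mul_apply] at h2
  simp only [Matrix.mul_apply, Finset.sum_mul, Matrix.sub_apply] at h2
  rw [Finset.sum_comm] at h2
  rw [h2]; ring

lemma bdd_inv_self (h : MetricFamily B γ) (a b : Fin 4) :
    Bd B (fun s y => (γ s y)⁻¹ a b) := by
  obtain ⟨K, hK0, hK⟩ := Bd.exists_uniform (fun p : Fin 4 × Fin 4 => h.bdd_inv p.1 p.2)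
  obtain ⟨C, hC0, hC⟩ := Sml.exists_uniform (fun p : Fin 4 × Fin 4 => h.sml p.1 p.2)
  refine ⟨fun s hs => ((h.metric s hs.le).inv_smooth a b).continuousOn, 2 * K, ?_⟩
  have hsmall : ∀ᶠ s in 𝓝[>] (0 : ℝ), 16 * K * C * s ≤ 1 / 2 := by
    have : Tendsto (fun s : ℝ => 16 * K * C * s) (𝓝[>] 0) (𝓝 (16 * K * C * 0)) :=
      ((continuous_const.mul continuous_id).tendsto _).mono_left nhdsWithin_le_nhds
    rw [mul_zero] at this
    exact this.eventually_le_const (by norm_num)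
  filter_upwards [hK, hC, hsmall, eventually_pos] with s h1 h2 h3 hs y hy
  -- estimate the largest entry of the inverse matrix in terms of itself
  obtain ⟨p, -, hp⟩ := Finset.exists_max_image (Finset.univ : Finset (Fin 4 × Fin 4))
    (fun p => |(γ s y)⁻¹ p.1 p.2|) ⟨(0, 0), Finset.mem_univ _⟩
  set X := |(γ s y)⁻¹ p.1 p.2| with hX
  have hX0 : 0 ≤ X := abs_nonneg _
  have key : X ≤ K + 16 * K * C * s * X := by
    have e : (γ s y)⁻¹ p.1 p.2 = (γ 0 y)⁻¹ p.1 p.2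
        + -∑ c, ∑ d, (γ 0 y)⁻¹ p.1 c * (γ s y c d - γ 0 y c d) * (γ s y)⁻¹ d p.2 := by
      rw [← h.inv_sub hs hy]; ring
    have e' : X ≤ |(γ 0 y)⁻¹ p.1 p.2|
        + |-∑ c, ∑ d, (γ 0 y)⁻¹ p.1 c * (γ s y c d - γ 0 y c d) * (γ s y)⁻¹ d p.2| := by
      rw [hX]
      conv_lhs => rw [e]
      exact abs_add_le _ _
    refine e'.trans (add_le_add (h1 p y hy) ?_)
    rw [abs_neg]
    calc |∑ c, ∑ d, (γ 0 y)⁻¹ p.1 c * (γ s y c d - γ 0 y c d) * (γ s y)⁻¹ d p.2|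
        ≤ ∑ c, ∑ d, |(γ 0 y)⁻¹ p.1 c * (γ s y c d - γ 0 y c d) * (γ s y)⁻¹ d p.2| :=
          (Finset.abs_sum_le_sum_abs _ _).trans
            (Finset.sum_le_sum fun c _ => Finset.abs_sum_le_sum_abs _ _)
      _ ≤ ∑ _c : Fin 4, ∑ _d : Fin 4, K * (C * s) * X := by
          refine Finset.sum_le_sum fun c _ => Finset.sum_le_sum fun d _ => ?_
          rw [abs_mul, abs_mul]
          have := h1 (p.1, c) y hy
          have := h2 (c, d) y hy
          have := hp (d, p.2) (Finset.mem_univ _)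
          have : 0 ≤ C * s := by positivity
          gcongr
      _ = 16 * K * C * s * X := by simp; ring
  have h4 := hp (a, b) (Finset.mem_univ _)
  simp only at h4
  nlinarith [mul_le_mul_of_nonneg_right h3 hX0]

lemma inv_sml (h : MetricFamily B γ) (a b : Fin 4) :
    Sml B (fun s y => (γ s y)⁻¹ a b - (γ 0 y)⁻¹ a b) :=
  (Sml.sum Finset.univ fun c _ => Sml.sum Finset.univ fun d _ =>
    (Sml.bd_mul (h.bdd_inv a c) (h.sml c d)).mul_bd (h.bdd_inv_self d b)).neg.congr
    fun _ hs _ hy => h.inv_sub hs hy a b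

lemma bdd_pder_inv_self (h : MetricFamily B γ) (c a b : Fin 4) :
    Bd B (fun s => pder c (fun z => (γ s z)⁻¹ a b)) :=
  (Bd.sum Finset.univ fun d _ => Bd.sum Finset.univ fun e _ =>
    ((h.bdd_inv_self a d).mul (h.bdd_pder_self c d e)).mul (h.bdd_inv_self e b)).neg.congr
    fun s hs _ hy => (h.metric s hs.le).pder_inv h.isOpen hy c a b

lemma wk_osc (h : MetricFamily B γ) (c a b : Fin 4) : Wk B (osc γ c a b) (fun _ => 0) :=
  ((h.sml a b).wk.pder h.isOpen (fun _ hs => h.dev_smooth hs a b) contDiffOn_const c).congr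
    (fun _ _ _ _ => rfl) (fun y _ => by simp [pder])

lemma expand_osc (h : MetricFamily B γ) (c a b : Fin 4) :
    Expand B (osc γ c a b) (fun _ => 0) (osc γ c a b) where
  smooth := contDiffOn_const
  bdd₀ := Bd.const 0
  bdd := h.bdd_osc c a b
  wk := h.wk_osc c a b
  rem := Sml.zero.congr fun _ _ _ _ => by ring

lemma expand_chr (h : MetricFamily B γ) (c a b : Fin 4) :
    Expand B (fun s => locChr (γ s) c a b) (locChr (γ 0) c a b) (oscChr γ c a b) where
  smooth := (h.metric 0 le_rfl).chr_smooth h.isOpen c a b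
  bdd₀ := Bd.const_mul _ <| Bd.sum _ fun d _ => (h.bdd_inv c d).mul
    (((h.bdd_pder _ _ _).add (h.bdd_pder _ _ _)).sub (h.bdd_pder _ _ _))
  bdd := Bd.const_mul _ <| Bd.sum _ fun d _ => (h.bdd_inv c d).mul
    (((h.bdd_osc _ _ _).add (h.bdd_osc _ _ _)).sub (h.bdd_osc _ _ _))
  wk := (Wk.const_mul h.isOpen (1 / 2) <| Wk.sum h.isOpen Finset.univ fun d _ =>
      (((h.wk_osc a b d).add h.isOpen (h.wk_osc b a d)).sub h.isOpen (h.wk_osc d a b)).smul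
        h.isOpen ((h.metric 0 le_rfl).inv_smooth c d)).congr
      (fun _ _ _ _ => rfl) (fun _ _ => by simp)
  rem := by
    refine (Sml.const_mul (1 / 2) <| Sml.sum Finset.univ fun d _ => (h.inv_sml c d).mul_bd
      (((h.bdd_pder_self a b d).add (h.bdd_pder_self b a d)).sub
        (h.bdd_pder_self d a b))).congr fun s hs y hy => ?_
    simp only [locChr, oscChr, h.pder_eq_add_osc hs _ _ _ hy, ← mul_sub, ← Finset.sum_sub_distrib]
    congr 1
    exact Finset.sum_congr rfl fun d _ => by ring

lemma bdd_chr (h : MetricFamily B γ) (c a b : Fin 4) : Bd B (fun s => locChr (γ s) c a b) :=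
  (h.expand_chr c a b).bd_self

end MetricFamily

section QuadraticLimits

variable {B : Set E4} {γ : ℝ → E4 → Mat4}
  {m : Fin 4 → Fin 4 → Fin 4 → Fin 4 → Fin 4 → Fin 4 → E4 → ℝ}

/-- The weak limit of `∂_p h_{ef} D^c_{ab}`, with `D` the oscillating part of the Christoffel
symbols. -/
def limOscChr (γ₀ : E4 → Mat4) (m : Fin 4 → Fin 4 → Fin 4 → Fin 4 → Fin 4 → Fin 4 → E4 → ℝ)
    (p e f c a b : Fin 4) (y : E4) : ℝ :=
  (1 / 2) * ∑ d, (γ₀ y)⁻¹ c d * (m p e f a b d y + m p e f b a d y - m p e f d a b y)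

/-- The weak limit of `D^c_{ab} D^{c'}_{a'b'}`, with `D` the oscillating part of the Christoffel
symbols. -/
def limChrChr (γ₀ : E4 → Mat4) (m : Fin 4 → Fin 4 → Fin 4 → Fin 4 → Fin 4 → Fin 4 → E4 → ℝ)
    (c a b c' a' b' : Fin 4) (y : E4) : ℝ :=
  (1 / 2) * ∑ d, (γ₀ y)⁻¹ c d * (limOscChr γ₀ m a b d c' a' b' y
    + limOscChr γ₀ m b a d c' a' b' y - limOscChr γ₀ m d a b c' a' b' y)

/-- The anomalous part of the weak limit of the Ricci tensor. -/
def limRic (γ₀ : E4 → Mat4) (m : Fin 4 → Fin 4 → Fin 4 → Fin 4 → Fin 4 → Fin 4 → E4 → ℝ)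
    (a b : Fin 4) (y : E4) : ℝ :=
  ∑ c, ∑ d, (limChrChr γ₀ m d a b c c d y - limChrChr γ₀ m d c b c d a y)

namespace MetricFamily

lemma wk_osc_chr (h : MetricFamily B γ) (hm : HasQuadLimit B γ m) (p e f c a b : Fin 4) :
    Wk B (fun s y => osc γ p e f s y * oscChr γ c a b s y) (limOscChr (γ 0) m p e f c a b) := by
  refine (Wk.const_mul h.isOpen (1 / 2) <| Wk.sum h.isOpen Finset.univ fun d _ =>
      (((hm p e f a b d).add h.isOpen (hm p e f b a d)).sub h.isOpen (hm p e f d a b)).smul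
        h.isOpen ((h.metric 0 le_rfl).inv_smooth c d)).congr (fun s _ y _ => ?_) (fun _ _ => rfl)
  rw [oscChr, mul_left_comm, Finset.mul_sum]
  congr 1
  exact Finset.sum_congr rfl fun d _ => by ring

lemma wk_chr_chr (h : MetricFamily B γ) (hm : HasQuadLimit B γ m) (c a b c' a' b' : Fin 4) :
    Wk B (fun s y => oscChr γ c a b s y * oscChr γ c' a' b' s y)
      (limChrChr (γ 0) m c a b c' a' b') := by
  refine (Wk.const_mul h.isOpen (1 / 2) <| Wk.sum h.isOpen Finset.univ fun d _ =>
      (((h.wk_osc_chr hm a b d c' a' b').add h.isOpen (h.wk_osc_chr hm b a d c' a' b')).sub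
        h.isOpen (h.wk_osc_chr hm d a b c' a' b')).smul
        h.isOpen ((h.metric 0 le_rfl).inv_smooth c d)).congr (fun s _ y _ => ?_) (fun _ _ => rfl)
  rw [oscChr, mul_assoc, Finset.sum_mul]
  congr 1
  exact Finset.sum_congr rfl fun d _ => by ring

/-- The weak limit of the Ricci tensor. -/
lemma wk_ric (h : MetricFamily B γ) (hm : HasQuadLimit B γ m) (a b : Fin 4) :
    Wk B (fun s => locRic (γ s) a b) (fun y => locRic (γ 0) a b y + limRic (γ 0) m a b y) := by
  have hO := h.isOpen
  have h1 : ∀ c a b d, Wk B (fun s => pder d (locChr (γ s) c a b)) (pder d (locChr (γ 0) c a b)) :=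
    fun c a b d => ((h.expand_chr c a b).tendsto hO).pder hO
      (fun s hs => (h.metric s hs.le).chr_smooth hO c a b) (h.expand_chr c a b).smooth d
  have h2 : ∀ c a b c' a' b', Wk B (fun s y => locChr (γ s) c a b y * locChr (γ s) c' a' b' y)
      (fun y => locChr (γ 0) c a b y * locChr (γ 0) c' a' b' y
        + limChrChr (γ 0) m c a b c' a' b' y) := fun c a b c' a' b' =>
    (h.expand_chr c a b).mul hO (h.expand_chr c' a' b') (h.wk_chr_chr hm c a b c' a' b')
  refine (Wk.add hO (Wk.sum hO Finset.univ fun c _ => (h1 c a b c).sub hO (h1 c c b a))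
    (Wk.sum hO Finset.univ fun c _ => Wk.sum hO Finset.univ fun d _ =>
      (h2 d a b c c d).sub hO (h2 d c b c d a))).congr (fun _ _ _ _ => rfl) (fun y _ => ?_)
  rw [locRic, limRic, add_assoc]
  congr 1
  simp only [← Finset.sum_add_distrib]
  exact Finset.sum_congr rfl fun c _ => Finset.sum_congr rfl fun d _ => by ring

/-- The weak limit of `h_{ef} R_{ab}`, computed by integration by parts. -/
lemma wk_dev_ric (h : MetricFamily B γ) (hm : HasQuadLimit B γ m) (e f a b : Fin 4) :
    Wk B (fun s y => (γ s y e f - γ 0 y e f) * locRic (γ s) a b y)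
      (fun y => -∑ c, (limOscChr (γ 0) m c e f c a b y - limOscChr (γ 0) m a e f c c b y)) := by
  have hO := h.isOpen
  have h1 : ∀ p c a b, Wk B (fun s y => (γ s y e f - γ 0 y e f) * pder p (locChr (γ s) c a b) y)
      (fun y => -limOscChr (γ 0) m p e f c a b y) := by
    intro p c a b
    have k1 : Wk B (fun s => pder p (fun z => (γ s z e f - γ 0 z e f) * locChr (γ s) c a b z))
        (fun _ => 0) :=
      (((h.sml e f).mul_bd (h.bdd_chr c a b)).wk.pder hO
        (fun s hs => (h.dev_smooth hs e f).mul ((h.metric s hs.le).chr_smooth hO c a b))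
        contDiffOn_const p).congr (fun _ _ _ _ => rfl) (fun _ _ => by simp [pder])
    have k2 := (h.expand_osc p e f).mul hO (h.expand_chr c a b) (h.wk_osc_chr hm p e f c a b)
    refine (k1.sub hO k2).congr (fun s hs y hy => ?_) (fun _ _ => by ring)
    rw [pder_mul p (differentiableAt_of_contDiffOn hO (h.dev_smooth hs e f) hy)
      (differentiableAt_of_contDiffOn hO ((h.metric s hs.le).chr_smooth hO c a b) hy), osc]
    ring
  have h2 : ∀ c a b c' a' b', Bd B (fun s y => locChr (γ s) c a b y * locChr (γ s) c' a' b' y) :=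
    fun c a b c' a' b' => (h.bdd_chr c a b).mul (h.bdd_chr c' a' b')
  have h3 := (h.sml e f).mul_bd (Bd.sum Finset.univ fun c _ => Bd.sum Finset.univ fun d _ =>
    (h2 d a b c c d).sub (h2 d c b c d a))
  refine ((Wk.sum hO Finset.univ fun c _ => (h1 c c a b).sub hO (h1 a c c b)).add_sml hO h3).congr
    (fun s _ y _ => ?_) (fun y _ => ?_)
  · rw [locRic, mul_add, Finset.mul_sum]
    congr 1
    exact Finset.sum_congr rfl fun c _ => by ring
  · rw [← Finset.sum_neg_distrib]
    exact Finset.sum_congr rfl fun c _ => by ring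

end MetricFamily

namespace HasQuadLimit

lemma mono {B' : Set E4} (hm : HasQuadLimit B γ m) (hs : B' ⊆ B) : HasQuadLimit B' γ m :=
  fun c a b d e f => (hm c a b d e f).mono hs

lemma symm_left (hm : HasQuadLimit B γ m) (h : MetricFamily B γ) {y : E4} (hy : y ∈ B)
    (c a b d e f : Fin 4) : m c a b d e f y = m c b a d e f y :=
  (hm c a b d e f).unique h.isOpen ((hm c b a d e f).congr
    (fun s hs y hy => by rw [h.osc_symm hs c a b hy]) fun _ _ => rfl) y hy

lemma swap (hm : HasQuadLimit B γ m) (h : MetricFamily B γ) {y : E4} (hy : y ∈ B)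
    (c a b d e f : Fin 4) : m c a b d e f y = m d e f c a b y :=
  (hm c a b d e f).unique h.isOpen ((hm d e f c a b).congr
    (fun _ _ _ _ => mul_comm _ _) fun _ _ => rfl) y hy

/-- The differentiation indices may be exchanged, since
`∂_c h ∂_d h' - ∂_d h ∂_c h' = ∂_c (h ∂_d h') - ∂_d (h ∂_c h')` tends weakly to zero. -/
lemma swap_pder (hm : HasQuadLimit B γ m) (h : MetricFamily B γ) {y : E4} (hy : y ∈ B)
    (c a b d e f : Fin 4) : m c a b d e f y = m d a b c e f y := by
  have hO := h.isOpen
  have k : ∀ p q, Wk B (fun s => pder p (fun z => (γ s z a b - γ 0 z a b) * osc γ q e f s z))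
      (fun _ => 0) := fun p q =>
    (((h.sml a b).mul_bd (h.bdd_osc q e f)).wk.pder hO
      (fun s hs => (h.dev_smooth hs a b).mul (h.osc_smooth hs q e f))
      contDiffOn_const p).congr (fun _ _ _ _ => rfl) (fun _ _ => by simp [pder])
  refine (hm c a b d e f).unique hO ((((k c d).sub hO (k d c)).add hO (hm d a b c e f)).congr
    (fun s hs y hy => ?_) fun _ _ => by ring) y hy
  have e1 : ∀ p q, pder p (fun z => (γ s z a b - γ 0 z a b) * osc γ q e f s z) y
      = osc γ p a b s y * osc γ q e f s y
        + (γ s y a b - γ 0 y a b) * pder p (osc γ q e f s) y := fun p q =>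
    pder_mul p (differentiableAt_of_contDiffOn hO (h.dev_smooth hs a b) hy)
      (differentiableAt_of_contDiffOn hO (h.osc_smooth hs q e f) hy)
  have e2 : pder c (osc γ d e f s) y = pder d (osc γ c e f s) y :=
    pder_comm hO (h.dev_smooth hs e f) hy c d
  rw [e1, e1, e2]; ring

end HasQuadLimit

end QuadraticLimits

end

section

open Filter

/-! ### Weak bounds and `L¹` bounds -/

/-- Families of continuous functions whose integrals against each test function are bounded for
small `s > 0`. -/
structure WBd (B : Set E4) (F : ℝ → E4 → ℝ) : Prop where
  cont : ∀ s, 0 < s → ContinuousOn (F s) B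
  bound : ∀ u, IsTestOn B u → ∃ C, ∀ᶠ s in 𝓝[>] (0 : ℝ), |∫ y, u y * F s y| ≤ C

/-- Families of continuous functions that are bounded in `L¹(B)` for small `s > 0`. -/
structure L1Bd (B : Set E4) (F : ℝ → E4 → ℝ) : Prop where
  cont : ∀ s, 0 < s → ContinuousOn (F s) B
  bound : ∃ C, ∀ᶠ s in 𝓝[>] (0 : ℝ), IntegrableOn (F s) B ∧ ∫ y in B, |F s y| ≤ C

variable {B : Set E4} {F F' G : ℝ → E4 → ℝ}

lemma IsTestOn.integral_congr {u f g : E4 → ℝ} (hu : IsTestOn B u) (h : ∀ y ∈ B, f y = g y) :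
    ∫ y, u y * f y = ∫ y, u y * g y := by
  refine integral_congr_ae (Eventually.of_forall fun y => ?_)
  by_cases hy : y ∈ tsupport u
  · simp [h y (hu.supp hy)]
  · simp [image_eq_zero_of_notMem_tsupport hy]

lemma Bd.wBd (h : Bd B F) : WBd B F := by
  refine ⟨h.cont, fun u hu => ?_⟩
  obtain ⟨C, hC⟩ := h.bound
  have hi : Integrable (fun y => |u y|) :=
    (hu.smooth.continuous.integrable_of_hasCompactSupport hu.compact).abs
  refine ⟨∫ y, C * |u y|, ?_⟩
  filter_upwards [hC] with s hs
  rw [← Real.norm_eq_abs]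
  refine norm_integral_le_of_norm_le (hi.const_mul _) (Eventually.of_forall fun y => ?_)
  rw [Real.norm_eq_abs, abs_mul, mul_comm]
  by_cases hy : y ∈ tsupport u
  · exact mul_le_mul_of_nonneg_right (hs y (hu.supp hy)) (abs_nonneg _)
  · simp [image_eq_zero_of_notMem_tsupport hy]

namespace WBd

lemma congr (h : WBd B F) (h' : ∀ s, 0 < s → ∀ y ∈ B, F' s y = F s y) : WBd B F' := by
  refine ⟨fun s hs => (h.cont s hs).congr (h' s hs), fun u hu => ?_⟩
  obtain ⟨C, hC⟩ := h.bound u hu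
  refine ⟨C, ?_⟩
  filter_upwards [hC, eventually_pos] with s h1 hs
  rwa [hu.integral_congr (h' s hs)]

lemma add (hB : IsOpen B) (h : WBd B F) (h' : WBd B F') :
    WBd B (fun s y => F s y + F' s y) := by
  refine ⟨fun s hs => (h.cont s hs).add (h'.cont s hs), fun u hu => ?_⟩
  obtain ⟨C, hC⟩ := h.bound u hu
  obtain ⟨C', hC'⟩ := h'.bound u hu
  refine ⟨C + C', ?_⟩
  filter_upwards [hC, hC', eventually_pos] with s h1 h2 hs
  simp only [mul_add]
  rw [integral_add (hu.integrable hB (h.cont s hs)) (hu.integrable hB (h'.cont s hs))]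
  exact (abs_add_le _ _).trans (add_le_add h1 h2)

lemma const_mul (c : ℝ) (h : WBd B F) : WBd B (fun s y => c * F s y) := by
  refine ⟨fun s hs => continuousOn_const.mul (h.cont s hs), fun u hu => ?_⟩
  obtain ⟨C, hC⟩ := h.bound u hu
  refine ⟨|c| * C, ?_⟩
  filter_upwards [hC] with s h1
  simp only [mul_left_comm _ c]
  rw [integral_const_mul, abs_mul]
  exact mul_le_mul_of_nonneg_left h1 (abs_nonneg _)

lemma sub (hB : IsOpen B) (h : WBd B F) (h' : WBd B F') :
    WBd B (fun s y => F s y - F' s y) :=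
  (h.add hB (h'.const_mul (-1))).congr fun _ _ _ _ => by ring

lemma sum (hB : IsOpen B) {ι : Type*} (I : Finset ι) {F : ι → ℝ → E4 → ℝ}
    (h : ∀ i ∈ I, WBd B (F i)) : WBd B (fun s y => ∑ i ∈ I, F i s y) := by
  classical
  induction I using Finset.induction_on with
  | empty => simpa using (Bd.const 0).wBd
  | insert a I ha ih =>
    simp only [Finset.sum_insert ha]
    exact (h a (by simp)).add hB (ih fun i hi => h i (by simp [hi]))

lemma pder (hB : IsOpen B) (h : Bd B F) (hF : ∀ s, 0 < s → ContDiffOn ℝ ∞ (F s) B) (a : Fin 4) :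
    WBd B (fun s => Spacetime.pder a (F s)) := by
  refine ⟨fun s hs => (contDiffOn_pder hB (hF s hs) a).continuousOn, fun u hu => ?_⟩
  obtain ⟨C, hC⟩ := h.wBd.bound _ (hu.pder a)
  refine ⟨C, ?_⟩
  filter_upwards [hC, eventually_pos] with s h1 hs
  rwa [hu.integral_pder hB (hF s hs), abs_neg]

/-- Families with bounded first derivatives may multiply a derivative of a bounded family. -/
lemma mul_pder (hB : IsOpen B) (hF : ∀ s, 0 < s → ContDiffOn ℝ ∞ (F s) B) (h : Bd B F)
    (a : Fin 4) (h' : Bd B (fun s => Spacetime.pder a (F s)))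
    (hG : ∀ s, 0 < s → ContDiffOn ℝ ∞ (G s) B) (hG' : Bd B G) :
    WBd B (fun s y => F s y * Spacetime.pder a (G s) y) := by
  refine ((WBd.pder hB (h.mul hG') (fun s hs => (hF s hs).mul (hG s hs)) a).sub hB
    (h'.mul hG').wBd).congr fun s hs y hy => ?_
  rw [pder_mul a (differentiableAt_of_contDiffOn hB (hF s hs) hy)
    (differentiableAt_of_contDiffOn hB (hG s hs) hy)]
  ring

/-- A weakly bounded family of nonnegative functions is locally bounded in `L¹`. -/
lemma l1Bd (hB : IsOpen B) (h : WBd B F) (hpos : ∀ᶠ s in 𝓝[>] (0 : ℝ), ∀ y ∈ B, 0 ≤ F s y)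
    {y₀ : E4} {r : ℝ} (hr : 0 < r) (hsub : Metric.closedBall y₀ (2 * r) ⊆ B) :
    L1Bd (Metric.ball y₀ r) F := by
  have hsub' : Metric.ball y₀ r ⊆ B :=
    (Metric.ball_subset_closedBall.trans (Metric.closedBall_subset_closedBall (by linarith))).trans
      hsub
  let u : ContDiffBump y₀ := ⟨r, 2 * r, hr, by linarith⟩
  have hu : IsTestOn B u := ⟨u.contDiff, u.hasCompactSupport, by rw [u.tsupport_eq]; exact hsub⟩
  obtain ⟨C, hC⟩ := h.bound u hu
  refine ⟨fun s hs => (h.cont s hs).mono hsub', C, ?_⟩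
  filter_upwards [hC, hpos, eventually_pos] with s h1 h2 hs
  have hi := hu.integrable hB (h.cont s hs)
  have e : ∀ y ∈ Metric.ball y₀ r, u y * F s y = F s y := fun y hy => by
    rw [u.one_of_mem_closedBall (Metric.ball_subset_closedBall hy), one_mul]
  have h0 : ∀ y, 0 ≤ u y * F s y := by
    intro y
    by_cases hy : y ∈ tsupport u
    · exact mul_nonneg u.nonneg (h2 y (hu.supp hy))
    · simp [image_eq_zero_of_notMem_tsupport hy]
  refine ⟨hi.integrableOn.congr_fun e measurableSet_ball, ?_⟩
  calc ∫ y in Metric.ball y₀ r, |F s y|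
      = ∫ y in Metric.ball y₀ r, u y * F s y := by
        refine setIntegral_congr_fun measurableSet_ball fun y hy => ?_
        rw [e y hy, abs_of_nonneg (h2 y (hsub' hy))]
    _ ≤ ∫ y, u y * F s y := setIntegral_le_integral hi (Eventually.of_forall h0)
    _ ≤ C := (le_abs_self _).trans h1

end WBd

namespace L1Bd

lemma of_le (hB : IsOpen B) (h : L1Bd B F) (hc : ∀ s, 0 < s → ContinuousOn (F' s) B)
    (hle : ∃ C, ∀ᶠ s in 𝓝[>] (0 : ℝ), ∀ y ∈ B, |F' s y| ≤ C * |F s y|) : L1Bd B F' := by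
  obtain ⟨C, hC⟩ := hle
  obtain ⟨K, hK⟩ := h.bound
  refine ⟨hc, |C| * K, ?_⟩
  filter_upwards [hC, hK, eventually_pos] with s h1 h2 hs
  have hle : ∀ y ∈ B, |F' s y| ≤ |C| * |F s y| := fun y hy =>
    (h1 y hy).trans (mul_le_mul_of_nonneg_right (le_abs_self _) (abs_nonneg _))
  have hi : IntegrableOn (fun y => |C| * |F s y|) B := h2.1.abs.const_mul _
  have hi' : IntegrableOn (F' s) B :=
    Integrable.mono' hi ((hc s hs).aestronglyMeasurable hB.measurableSet)
      ((ae_restrict_iff' hB.measurableSet).mpr (Eventually.of_forall hle))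
  refine ⟨hi', ?_⟩
  calc ∫ y in B, |F' s y| ≤ ∫ y in B, |C| * |F s y| :=
        setIntegral_mono_on hi'.abs hi hB.measurableSet hle
    _ = |C| * ∫ y in B, |F s y| := integral_const_mul _ _
    _ ≤ |C| * K := mul_le_mul_of_nonneg_left h2.2 (abs_nonneg _)

lemma congr (hB : IsOpen B) (h : L1Bd B F) (h' : ∀ s, 0 < s → ∀ y ∈ B, F' s y = F s y) :
    L1Bd B F' :=
  h.of_le hB (fun s hs => (h.cont s hs).congr (h' s hs)) ⟨1, by
    filter_upwards [eventually_pos] with s hs y hy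
    rw [h' s hs y hy, one_mul]⟩

lemma bd_mul (hB : IsOpen B) (hG : Bd B G) (h : L1Bd B F) :
    L1Bd B (fun s y => G s y * F s y) := by
  obtain ⟨C, hC⟩ := hG.bound
  refine h.of_le hB (fun s hs => (hG.cont s hs).mul (h.cont s hs)) ⟨C, ?_⟩
  filter_upwards [hC] with s hs y hy
  rw [abs_mul]
  exact mul_le_mul_of_nonneg_right (hs y hy) (abs_nonneg _)

lemma const_mul (hB : IsOpen B) (c : ℝ) (h : L1Bd B F) : L1Bd B (fun s y => c * F s y) :=
  bd_mul hB (Bd.const c) h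

lemma add (hB : IsOpen B) (h : L1Bd B F) (h' : L1Bd B F') :
    L1Bd B (fun s y => F s y + F' s y) := by
  obtain ⟨C, hC⟩ := h.bound
  obtain ⟨C', hC'⟩ := h'.bound
  refine ⟨fun s hs => (h.cont s hs).add (h'.cont s hs), C + C', ?_⟩
  filter_upwards [hC, hC'] with s h1 h2
  refine ⟨h1.1.add h2.1, ?_⟩
  calc ∫ y in B, |F s y + F' s y| ≤ ∫ y in B, (|F s y| + |F' s y|) :=
        setIntegral_mono_on (h1.1.add h2.1).abs (h1.1.abs.add h2.1.abs) hB.measurableSet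
          fun y _ => abs_add_le _ _
    _ = (∫ y in B, |F s y|) + ∫ y in B, |F' s y| := integral_add h1.1.abs h2.1.abs
    _ ≤ C + C' := add_le_add h1.2 h2.2

lemma sub (hB : IsOpen B) (h : L1Bd B F) (h' : L1Bd B F') :
    L1Bd B (fun s y => F s y - F' s y) :=
  (h.add hB (h'.const_mul hB (-1))).congr hB fun _ _ _ _ => by ring

lemma zero : L1Bd B (fun _ _ => 0) :=
  ⟨fun _ _ => continuousOn_const, 0, Eventually.of_forall fun _ => by simp⟩

lemma sum (hB : IsOpen B) {ι : Type*} (I : Finset ι) {F : ι → ℝ → E4 → ℝ}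
    (h : ∀ i ∈ I, L1Bd B (F i)) : L1Bd B (fun s y => ∑ i ∈ I, F i s y) := by
  classical
  induction I using Finset.induction_on with
  | empty => simpa using L1Bd.zero
  | insert a I ha ih =>
    simp only [Finset.sum_insert ha]
    exact (h a (by simp)).add hB (ih fun i hi => h i (by simp [hi]))

/-- A uniformly small family times an `L¹`-bounded family tends weakly to zero. -/
lemma wk_sml_mul (hB : IsOpen B) (hG : Sml B G) (h : L1Bd B F) :
    Wk B (fun s y => G s y * F s y) (fun _ => 0) := by
  refine ⟨fun s hs => (hG.cont s hs).mul (h.cont s hs), continuousOn_const, fun u hu => ?_⟩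
  obtain ⟨C, hC⟩ := hG.bound
  obtain ⟨K, hK⟩ := h.bound
  obtain ⟨U, hU⟩ := hu.compact.exists_bound_of_continuous hu.smooth.continuous
  simp only [mul_zero, integral_zero]
  have hU0 : 0 ≤ U := (norm_nonneg _).trans (hU 0)
  have hlim : Tendsto (fun s : ℝ => U * (|C| * s) * K) (𝓝[>] 0) (𝓝 0) := by
    have : Tendsto (fun s : ℝ => U * (|C| * s) * K) (𝓝 0) (𝓝 (U * (|C| * 0) * K)) :=
      ((continuous_const.mul (continuous_const.mul continuous_id)).mul
        continuous_const).tendsto _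
    simp only [mul_zero, zero_mul] at this
    exact this.mono_left nhdsWithin_le_nhds
  refine squeeze_zero_norm' ?_ hlim
  filter_upwards [hC, hK, eventually_pos] with s h1 h2 hs
  have e : ∫ y, u y * (G s y * F s y) = ∫ y in B, u y * (G s y * F s y) := by
    refine (setIntegral_eq_integral_of_forall_compl_eq_zero fun y hy => ?_).symm
    rw [image_eq_zero_of_notMem_tsupport fun hy' => hy (hu.supp hy'), zero_mul]
  rw [e]
  calc ‖∫ y in B, u y * (G s y * F s y)‖ ≤ ∫ y in B, U * (|C| * s) * |F s y| := by
        refine norm_integral_le_of_norm_le (h2.1.abs.const_mul _)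
          ((ae_restrict_iff' hB.measurableSet).mpr (Eventually.of_forall fun y hy => ?_))
        rw [Real.norm_eq_abs, abs_mul, abs_mul, ← mul_assoc]
        have h3 := hU y
        rw [Real.norm_eq_abs] at h3
        have h4 : |G s y| ≤ |C| * s :=
          (h1 y hy).trans (mul_le_mul_of_nonneg_right (le_abs_self _) hs.le)
        have : 0 ≤ |C| * s := by positivity
        gcongr
    _ = U * (|C| * s) * ∫ y in B, |F s y| := integral_const_mul _ _
    _ ≤ U * (|C| * s) * K := by
        have := h2.2
        gcongr

end L1Bd

/-! ### The weak energy condition and the limit of the Einstein tensor -/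

/-- The Einstein tensor of a matrix-valued function. -/
def locEin (γ : E4 → Mat4) (a b : Fin 4) (y : E4) : ℝ :=
  locRic γ a b y - (1 / 2) * γ y a b * ∑ c, ∑ d, (γ y)⁻¹ c d * locRic γ c d y

/-- The quadratic form of a matrix. -/
def quadForm (A : Mat4) (w : Fin 4 → ℝ) : ℝ := ∑ a, ∑ b, A a b * (w a * w b)

lemma quadForm_second_difference (A : Mat4) (t w : Fin 4 → ℝ) (δ : ℝ) :
    quadForm A (t + δ • w) + quadForm A (t + (-δ) • w) - 2 * quadForm A t
      = 2 * δ ^ 2 * quadForm A w := by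
  simp only [quadForm, Finset.mul_sum, ← Finset.sum_add_distrib, ← Finset.sum_sub_distrib]
  refine Finset.sum_congr rfl fun a _ => Finset.sum_congr rfl fun b _ => ?_
  simp only [Pi.add_apply, Pi.smul_apply, smul_eq_mul]; ring

lemma quadForm_single_add_single (A : Mat4) (i j : Fin 4) :
    quadForm A (Pi.single i 1 + Pi.single j 1) = A i i + A i j + A j i + A j j := by
  simp only [quadForm, Pi.add_apply, Pi.single_apply, mul_add, mul_ite, mul_one, mul_zero,
    Finset.sum_add_distrib, Finset.sum_ite_eq', Finset.mem_univ,
    if_true]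
  ring

/-- The entries of a symmetric matrix from its quadratic form. -/
lemma entry_eq_quadForm (A : Mat4) (hA : ∀ i j, A i j = A j i) (i j : Fin 4) :
    A i j = (1 / 2) * (quadForm A (Pi.single i 1 + Pi.single j 1)
      - (1 / 4) * quadForm A (Pi.single i 1 + Pi.single i 1)
      - (1 / 4) * quadForm A (Pi.single j 1 + Pi.single j 1)) := by
  simp only [quadForm_single_add_single]
  rw [hA j i]; ring

/-- Trace reversal of `S = G + Λ g`. -/
lemma IsMetricOn.ric_eq {γ : E4 → Mat4} (h : IsMetricOn B γ) {y : E4} (hy : y ∈ B) (Λ : ℝ)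
    {S : Mat4} (hS : ∀ a b, S a b = locEin γ a b y + Λ * γ y a b) (a b : Fin 4) :
    locRic γ a b y
      = S a b - (1 / 2) * γ y a b * (∑ c, ∑ d, (γ y)⁻¹ c d * S c d) + Λ * γ y a b := by
  have htr : ∑ c, ∑ d, (γ y)⁻¹ c d * γ y c d = 4 := by
    have h1 : ∀ c, ∑ d, (γ y)⁻¹ c d * γ y c d = 1 := by
      intro c
      have h2 := congrFun (congrFun (h.inv_mul hy) c) c
      rw [Matrix.mul_apply, Matrix.one_apply_eq] at h2
      rw [← h2]
      exact Finset.sum_congr rfl fun d _ => by rw [(h.symm y hy).apply c d]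
    simp [h1]
  set R := ∑ c, ∑ d, (γ y)⁻¹ c d * locRic γ c d y with hR
  have h3 : ∑ c, ∑ d, (γ y)⁻¹ c d * S c d = -R + 4 * Λ := by
    have : ∀ c d, (γ y)⁻¹ c d * S c d = (γ y)⁻¹ c d * locRic γ c d y
        + (Λ - (1 / 2) * R) * ((γ y)⁻¹ c d * γ y c d) := by
      intro c d
      rw [hS, locEin]; ring
    simp only [this, Finset.sum_add_distrib, ← Finset.mul_sum, htr]
    rw [← hR]; ring
  rw [h3, hS, locEin]; ring

namespace MetricFamily

variable {γ : ℝ → E4 → Mat4} {m : Fin 4 → Fin 4 → Fin 4 → Fin 4 → Fin 4 → Fin 4 → E4 → ℝ}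

lemma wBd_mul_ric (h : MetricFamily B γ) (hF : ∀ s, 0 < s → ContDiffOn ℝ ∞ (F s) B)
    (hb : Bd B F) (hb' : ∀ c, Bd B (fun s => pder c (F s))) (a b : Fin 4) :
    WBd B (fun s y => F s y * locRic (γ s) a b y) := by
  have hO := h.isOpen
  have h1 : ∀ p c a b, WBd B (fun s y => F s y * pder p (locChr (γ s) c a b) y) := fun p c a b =>
    WBd.mul_pder hO hF hb p (hb' p) (fun s hs => (h.metric s hs.le).chr_smooth hO c a b)
      (h.bdd_chr c a b)
  have h2 : ∀ c a b c' a' b', Bd B (fun s y => locChr (γ s) c a b y * locChr (γ s) c' a' b' y) :=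
    fun c a b c' a' b' => (h.bdd_chr c a b).mul (h.bdd_chr c' a' b')
  have h3 := (hb.mul (Bd.sum Finset.univ fun c _ => Bd.sum Finset.univ fun d _ =>
    (h2 d a b c c d).sub (h2 d c b c d a))).wBd
  refine ((WBd.sum hO Finset.univ fun c _ => (h1 c c a b).sub hO (h1 a c c b)).add hO h3).congr
    fun s _ y _ => ?_
  rw [locRic, mul_add, Finset.mul_sum]
  congr 1
  exact Finset.sum_congr rfl fun c _ => by ring

/-- The Einstein tensor is weakly bounded. -/
lemma wBd_ein (h : MetricFamily B γ) (a b : Fin 4) : WBd B (fun s => locEin (γ s) a b) := by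
  have hO := h.isOpen
  have hγ : ∀ s, 0 < s → ContDiffOn ℝ ∞ (fun y => γ s y a b) B := fun s hs =>
    (h.metric s hs.le).smooth a b
  have hi : ∀ c d s, 0 < s → ContDiffOn ℝ ∞ (fun y => (γ s y)⁻¹ c d) B := fun c d s hs =>
    (h.metric s hs.le).inv_smooth c d
  have h1 : WBd B (fun s y => 1 * locRic (γ s) a b y) :=
    h.wBd_mul_ric (F := fun _ _ => 1) (fun _ _ => contDiffOn_const) (Bd.const 1)
      (fun c => (Bd.const 0).congr fun _ _ _ _ => by simp [pder]) a b
  have h2 : ∀ c d, WBd B (fun s y => (γ s y a b * (γ s y)⁻¹ c d) * locRic (γ s) c d y) := by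
    intro c d
    refine h.wBd_mul_ric (fun s hs => (hγ s hs).mul (hi c d s hs))
      ((h.bdd_self a b).mul (h.bdd_inv_self c d)) (fun p => ?_) c d
    refine (((h.bdd_pder_self p a b).mul (h.bdd_inv_self c d)).add
      ((h.bdd_self a b).mul (h.bdd_pder_inv_self p c d))).congr fun s hs y hy => ?_
    exact pder_mul p (differentiableAt_of_contDiffOn hO (hγ s hs) hy)
      (differentiableAt_of_contDiffOn hO (hi c d s hs) hy)
  refine (h1.sub hO ((WBd.sum hO Finset.univ fun c _ => WBd.sum hO Finset.univ fun d _ =>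
    h2 c d).const_mul (1 / 2))).congr fun s _ y _ => ?_
  simp only [locEin, Finset.mul_sum]
  congr 1
  · ring
  · exact Finset.sum_congr rfl fun c _ => Finset.sum_congr rfl fun d _ => by ring

variable {Λ : ℝ} {S : Fin 4 → Fin 4 → ℝ → E4 → ℝ}

/-- The weak energy condition bounds the source in `L¹` near each point: the source is weakly
bounded, it is nonnegative on vectors timelike at the given point, and its components are linear
combinations of its values on such vectors. -/
lemma exists_l1Bd (h : MetricFamily B γ) {y₀ : E4} (hy₀ : y₀ ∈ B) {t : Fin 4 → ℝ}
    (ht : quadForm (γ 0 y₀) t < 0)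
    (hS : ∀ s, 0 < s → ∀ y ∈ B, ∀ a b, S a b s y = locEin (γ s) a b y + Λ * γ s y a b)
    (hpos : ∀ s, 0 < s → ∀ y ∈ B, ∀ w, quadForm (γ s y) w < 0 →
      0 ≤ quadForm (Matrix.of fun a b => S a b s y) w) :
    ∃ r, 0 < r ∧ Metric.ball y₀ r ⊆ B ∧ ∀ a b, L1Bd (Metric.ball y₀ r) (S a b) := by
  have hO := h.isOpen
  have hSw : ∀ a b, WBd B (S a b) := fun a b =>
    ((h.wBd_ein a b).add hO ((h.bdd_self a b).const_mul Λ).wBd).congr fun s hs y hy =>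
      hS s hs y hy a b
  let W : Fin 4 → Fin 4 → Fin 4 → ℝ := fun i j => Pi.single i 1 + Pi.single j 1
  -- vectors close to `t` are timelike at all points close to `y₀`
  set c := -quadForm (γ 0 y₀) t / 2 with hc
  have hc0 : 0 < c := by rw [hc]; linarith
  have hev : ∀ᶠ p : E4 × ℝ in 𝓝 (y₀, 0), ∀ i j, quadForm (γ 0 p.1) (t + p.2 • W i j) < -c := by
    rw [eventually_all]; intro i
    rw [eventually_all]; intro j
    have hcont : ContinuousAt (fun p : E4 × ℝ => quadForm (γ 0 p.1) (t + p.2 • W i j))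
        (y₀, 0) := by
      simp only [quadForm]
      refine tendsto_finsetSum _ fun a _ => tendsto_finsetSum _ fun b _ => ?_
      have h1 : ContinuousAt (fun p : E4 × ℝ => γ 0 p.1 a b) (y₀, 0) :=
        ContinuousAt.comp (x := ((y₀, 0) : E4 × ℝ)) (f := Prod.fst) (g := fun y => γ 0 y a b)
          ((((h.metric 0 le_rfl).smooth a b).continuousOn).continuousAt (hO.mem_nhds hy₀))
          continuousAt_fst
      have h2 : ∀ k, ContinuousAt (fun p : E4 × ℝ => (t + p.2 • W i j) k) (y₀, 0) := fun k => by
        simp only [Pi.add_apply, Pi.smul_apply, smul_eq_mul]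
        fun_prop
      exact h1.mul ((h2 a).mul (h2 b))
    refine hcont.eventually_lt_const ?_
    simp only [zero_smul, add_zero]
    rw [hc]; linarith
  obtain ⟨ε, hε, hball⟩ := Metric.eventually_nhds_iff_ball.mp
    (hev.and (continuousAt_fst.eventually (hO.mem_nhds hy₀)))
  have hmem : ∀ y ∈ Metric.ball y₀ ε, ∀ τ : ℝ, |τ| < ε → (y, τ) ∈ Metric.ball (y₀, (0 : ℝ)) ε :=
    fun y hy τ hτ => by
      rw [Metric.mem_ball, Prod.dist_eq, max_lt_iff]
      exact ⟨hy, by simpa using hτ⟩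
  have hB' : Metric.ball y₀ ε ⊆ B := fun y hy => (hball _ (hmem y hy 0 (by simpa using hε))).2
  have hO' : IsOpen (Metric.ball y₀ ε) := Metric.isOpen_ball
  have hq : ∀ (i j : Fin 4) (τ : ℝ), |τ| < ε →
      L1Bd (Metric.ball y₀ (ε / 3))
        (fun s y => quadForm (Matrix.of fun a b => S a b s y) (t + τ • W i j)) := by
    intro i j τ hτ
    set w := t + τ • W i j with hw
    have hwb : WBd (Metric.ball y₀ ε) (fun s y => quadForm (Matrix.of fun a b => S a b s y) w) := by
      have : WBd B (fun s y => quadForm (Matrix.of fun a b => S a b s y) w) :=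
        (WBd.sum hO Finset.univ fun a _ => WBd.sum hO Finset.univ fun b _ =>
          (hSw a b).const_mul (w a * w b)).congr fun s _ y _ => by
            simp only [quadForm, Matrix.of_apply]
            exact Finset.sum_congr rfl fun a _ => Finset.sum_congr rfl fun b _ => mul_comm _ _
      exact ⟨fun s hs => (this.cont s hs).mono hB', fun u hu => this.bound u (hu.mono hB')⟩
    refine hwb.l1Bd hO' ?_ (by linarith) ((Metric.closedBall_subset_ball (by linarith)))
    have hsm : Sml B (fun s y => ∑ a, ∑ b, w a * w b * (γ s y a b - γ 0 y a b)) :=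
      Sml.sum _ fun a _ => Sml.sum _ fun b _ => (h.sml a b).const_mul _
    obtain ⟨C, hC⟩ := hsm.bound
    have hlim : Tendsto (fun s : ℝ => C * s) (𝓝[>] 0) (𝓝 (C * 0)) :=
      ((continuous_const.mul continuous_id).tendsto _).mono_left nhdsWithin_le_nhds
    rw [mul_zero] at hlim
    filter_upwards [hC, hlim.eventually_lt_const hc0, eventually_pos] with s h1 h2 hs y hy
    refine hpos s hs y (hB' hy) w ?_
    have h3 := (hball _ (hmem y hy τ hτ)).1 i j
    simp only at h3
    rw [← hw] at h3
    have h4 : quadForm (γ s y) w = quadForm (γ 0 y) w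
        + ∑ a, ∑ b, w a * w b * (γ s y a b - γ 0 y a b) := by
      simp only [quadForm, ← Finset.sum_add_distrib]
      exact Finset.sum_congr rfl fun a _ => Finset.sum_congr rfl fun b _ => by ring
    rw [h4]
    linarith [(abs_le.mp (h1 y (hB' hy))).2]
  have hO3 : IsOpen (Metric.ball y₀ (ε / 3)) := Metric.isOpen_ball
  have hsub3 : Metric.ball y₀ (ε / 3) ⊆ B :=
    (Metric.ball_subset_ball (by linarith)).trans hB'
  have hqW : ∀ i j, L1Bd (Metric.ball y₀ (ε / 3))
      (fun s y => quadForm (Matrix.of fun a b => S a b s y) (W i j)) := by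
    intro i j
    have hpos2 : |ε / 2| < ε := by rw [abs_of_pos (by linarith)]; linarith
    refine ((((hq i j (ε / 2) hpos2).add hO3 (hq i j (-(ε / 2)) (by rwa [abs_neg]))).sub hO3
      ((hq i j 0 (by simpa using hε)).const_mul hO3 2)).const_mul hO3
        (1 / (2 * (ε / 2) ^ 2))).congr hO3 fun s _ y _ => ?_
    rw [zero_smul, add_zero, quadForm_second_difference]
    field_simp
  refine ⟨ε / 3, by linarith, hsub3, fun a b => ?_⟩
  refine (((hqW a b).sub hO3 ((hqW a a).const_mul hO3 (1 / 4))).sub hO3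
    ((hqW b b).const_mul hO3 (1 / 4))).const_mul hO3 (1 / 2) |>.congr hO3 fun s hs y hy => ?_
  refine entry_eq_quadForm (Matrix.of fun a b => S a b s y) (fun i j => ?_) a b
  have hm := h.metric s hs.le
  have hyB := hsub3 hy
  simp only [Matrix.of_apply, hS s hs y hyB, locEin]
  rw [hm.ric_symm hO hyB i j, (hm.symm y hyB).apply j i]

lemma l1Bd_ric (h : MetricFamily B γ) (hL : ∀ a b, L1Bd B (S a b))
    (hS : ∀ s, 0 < s → ∀ y ∈ B, ∀ a b, S a b s y = locEin (γ s) a b y + Λ * γ s y a b)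
    (hΛ : ∀ a b, L1Bd B (fun s y => γ s y a b)) (a b : Fin 4) :
    L1Bd B (fun s => locRic (γ s) a b) := by
  have hO := h.isOpen
  refine (((hL a b).sub hO (L1Bd.bd_mul hO ((h.bdd_self a b).const_mul (1 / 2))
    (L1Bd.sum hO Finset.univ fun c _ => L1Bd.sum hO Finset.univ fun d _ =>
      L1Bd.bd_mul hO (h.bdd_inv_self c d) (hL c d)))).add hO ((hΛ a b).const_mul hO Λ)).congr hO
    fun s hs y hy => ?_
  exact (h.metric s hs.le).ric_eq hy Λ (S := Matrix.of fun a b => S a b s y)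
    (fun a b => hS s hs y hy a b) a b

lemma _root_.Spacetime.Bd.l1Bd (hO : IsOpen B) (hv : volume B ≠ ⊤) (h : Bd B F) : L1Bd B F := by
  have h1 : L1Bd B (fun _ _ => (1 : ℝ)) :=
    ⟨fun _ _ => continuousOn_const, ∫ _ in B, |(1 : ℝ)|, Eventually.of_forall fun _ =>
      ⟨integrableOn_const hv, le_rfl⟩⟩
  exact (L1Bd.bd_mul hO h h1).congr hO fun _ _ _ _ => by ring

/-- The weak limit of `G_{ab} + Λ g_{ab}`. -/
lemma wk_source (h : MetricFamily B γ) (hm : HasQuadLimit B γ m)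
    (hR : ∀ a b, L1Bd B (fun s => locRic (γ s) a b))
    (hS : ∀ s, 0 < s → ∀ y ∈ B, ∀ a b, S a b s y = locEin (γ s) a b y + Λ * γ s y a b)
    (a b : Fin 4) :
    Wk B (S a b) (fun y => locEin (γ 0) a b y + Λ * γ 0 y a b + (limRic (γ 0) m a b y
      - (1 / 2) * γ 0 y a b * ∑ c, ∑ d, (γ 0 y)⁻¹ c d * limRic (γ 0) m c d y)) := by
  have hO := h.isOpen
  have h0 := h.metric 0 le_rfl
  have k1 := h.wk_ric hm a b
  have k2 : Wk B (fun s y => ∑ c, ∑ d, ((1 / 2) * γ 0 y a b * (γ 0 y)⁻¹ c d) * locRic (γ s) c d y)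
      (fun y => ∑ c, ∑ d, ((1 / 2) * γ 0 y a b * (γ 0 y)⁻¹ c d)
        * (locRic (γ 0) c d y + limRic (γ 0) m c d y)) :=
    Wk.sum hO Finset.univ fun c _ => Wk.sum hO Finset.univ fun d _ =>
      (h.wk_ric hm c d).smul hO ((contDiffOn_const.mul (h0.smooth a b)).mul (h0.inv_smooth c d))
  have k3 : Wk B (fun s y => ∑ c, ∑ d,
      (γ s y a b * (γ s y)⁻¹ c d - γ 0 y a b * (γ 0 y)⁻¹ c d) * locRic (γ s) c d y)
      (fun _ => ∑ _c : Fin 4, ∑ _d : Fin 4, 0) :=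
    Wk.sum hO Finset.univ fun c _ => Wk.sum hO Finset.univ fun d _ =>
      L1Bd.wk_sml_mul hO ((((h.sml a b).mul_bd (h.bdd_inv_self c d)).add
        (Sml.bd_mul (h.bdd a b) (h.inv_sml c d))).congr fun _ _ _ _ => by ring) (hR c d)
  have k4 : Wk B (fun s y => Λ * γ s y a b) (fun y => Λ * γ 0 y a b) :=
    ((Wk.const (h0.smooth a b).continuousOn).of_sub_sml hO (h.sml a b)).const_mul hO Λ
  refine (((k1.sub hO k2).sub hO (k3.const_mul hO (1 / 2))).add hO k4).congr
    (fun s hs y hy => ?_) (fun y _ => ?_)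
  · rw [hS s hs y hy, locEin, sub_sub]
    congr 2
    simp only [Finset.mul_sum, ← Finset.sum_add_distrib]
    exact Finset.sum_congr rfl fun c _ => Finset.sum_congr rfl fun d _ => by ring
  · simp only [locEin, Finset.sum_const_zero, mul_zero, sub_zero, mul_add, Finset.sum_add_distrib,
      mul_assoc, ← Finset.mul_sum]
    ring

end MetricFamily

end

section

open Filter

/-! ### Algebra of the limit tensor -/

/-- Contraction of two index pairs with a matrix. -/
def contr2 (G : Fin 4 → Fin 4 → ℝ) (F : Fin 4 → Fin 4 → Fin 4 → Fin 4 → ℝ) : ℝ :=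
  ∑ c, ∑ c', ∑ d, ∑ d', G c c' * G d d' * F c c' d d'

section contr2

variable {G : Fin 4 → Fin 4 → ℝ} {F F' : Fin 4 → Fin 4 → Fin 4 → Fin 4 → ℝ}

lemma contr2_congr (h : ∀ c c' d d', F c c' d d' = F' c c' d d') : contr2 G F = contr2 G F' := by
  simp only [contr2, h]

lemma contr2_add : contr2 G (fun c c' d d' => F c c' d d' + F' c c' d d')
    = contr2 G F + contr2 G F' := by
  simp only [contr2, mul_add, Finset.sum_add_distrib]

lemma contr2_sub : contr2 G (fun c c' d d' => F c c' d d' - F' c c' d d')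
    = contr2 G F - contr2 G F' := by
  simp only [contr2, mul_sub, Finset.sum_sub_distrib]

lemma contr2_const_mul (k : ℝ) : contr2 G (fun c c' d d' => k * F c c' d d')
    = k * contr2 G F := by
  simp only [contr2, Finset.mul_sum, mul_left_comm k]

lemma contr2_pair_swap : contr2 G (fun c c' d d' => F d d' c c') = contr2 G F := by
  calc contr2 G (fun c c' d d' => F d d' c c')
      = ∑ p : Fin 4 × Fin 4, ∑ q : Fin 4 × Fin 4,
          G p.1 p.2 * G q.1 q.2 * F q.1 q.2 p.1 p.2 := by
        simp only [contr2, Fintype.sum_prod_type]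
    _ = ∑ q : Fin 4 × Fin 4, ∑ p : Fin 4 × Fin 4,
          G p.1 p.2 * G q.1 q.2 * F q.1 q.2 p.1 p.2 := Finset.sum_comm
    _ = contr2 G F := by
        simp only [contr2, Fintype.sum_prod_type, mul_comm (G _ _) (G _ _)]

lemma contr2_swap_left (hG : ∀ a b, G a b = G b a) :
    contr2 G (fun c c' d d' => F c' c d d') = contr2 G F := by
  simp only [contr2]
  rw [Finset.sum_comm]
  refine Finset.sum_congr rfl fun c _ => Finset.sum_congr rfl fun c' _ => ?_
  rw [hG c' c]

lemma contr2_swap_right (hG : ∀ a b, G a b = G b a) :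
    contr2 G (fun c c' d d' => F c c' d' d) = contr2 G F := by
  rw [← contr2_pair_swap, contr2_swap_left (F := fun c c' d d' => F d d' c c') hG,
    contr2_pair_swap]

lemma contr2_eq_zero_of_left (h : ∀ d d', ∑ c, ∑ c', G c c' * F c c' d d' = 0) :
    contr2 G F = 0 := by
  rw [← contr2_pair_swap]
  simp only [contr2, mul_assoc, ← Finset.mul_sum]
  simp [h]

end contr2

/-- The symmetries of `μ_{pqabef}`, the weak limit of `∂_p h_{ab} ∂_q h_{ef}`. -/
structure MuSymm (n : Fin 4 → Fin 4 → Fin 4 → Fin 4 → Fin 4 → Fin 4 → ℝ) : Prop where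
  left : ∀ p q a b e f, n p q a b e f = n p q b a e f
  pair : ∀ p q a b e f, n p q a b e f = n p q e f a b
  pder : ∀ p q a b e f, n p q a b e f = n q p a b e f

/-- The doubly antisymmetrized array `α_{abcdef} = μ_{[c|[ab]|d]ef}`. -/
def alphaArr (n : Fin 4 → Fin 4 → Fin 4 → Fin 4 → Fin 4 → Fin 4 → ℝ)
    (a b c d e f : Fin 4) : ℝ :=
  (1 / 4) * (n c a b d e f - n c b a d e f - n d a b c e f + n d b a c e f)

/-- The integrand of twice the contraction `∂_p h_{ef} D^c_{ab}` in terms of `μ`. -/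
def chrArr (n : Fin 4 → Fin 4 → Fin 4 → Fin 4 → Fin 4 → Fin 4 → ℝ)
    (p e f d a b : Fin 4) : ℝ :=
  n p a e f b d + n p b e f a d - n p d e f a b

namespace MuSymm

variable {n : Fin 4 → Fin 4 → Fin 4 → Fin 4 → Fin 4 → Fin 4 → ℝ}
  {G : Fin 4 → Fin 4 → ℝ}

lemma right (h : MuSymm n) (p q a b e f : Fin 4) : n p q a b e f = n p q a b f e := by
  rw [h.pair, h.left, h.pair]

/-- The integration-by-parts identity for `h_{ef} R_{ab}` says exactly that the contraction of
`α` over its second and fourth index vanishes. -/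
lemma alpha_contract (h : MuSymm n)
    (hrel : ∀ e f a b, ∑ c, ((1 / 2) * ∑ d, G c d * chrArr n c e f d a b
      - (1 / 2) * ∑ d, G c d * chrArr n a e f d c b) = 0) (a b e f : Fin 4) :
    ∑ c, ∑ c', G c c' * alphaArr n a c b c' e f = 0 := by
  have h1 := hrel e f a b
  have h2 : ∑ c, ((1 / 2) * ∑ d, G c d * chrArr n c e f d a b
      - (1 / 2) * ∑ d, G c d * chrArr n a e f d c b)
      = -2 * ∑ c, ∑ c', G c c' * alphaArr n a c b c' e f := by
    simp only [Finset.mul_sum, ← Finset.sum_sub_distrib]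
    refine Finset.sum_congr rfl fun c _ => Finset.sum_congr rfl fun d _ => ?_
    simp only [chrArr, alphaArr]
    rw [h.pder c a e f b d, h.pair a c e f b d, h.pair c b e f a d, h.pder c b a d e f,
      h.pair c d e f a b, h.pder c d a b e f, h.pair a b e f c d, h.pder a b c d e f,
      h.pair a d e f c b, h.pder a d c b e f]
    ring
  rw [h2] at h1
  linarith

/-- The anomalous part of the Ricci tensor in terms of contractions of `μ`. -/
lemma ric_eq (h : MuSymm n) (hG : ∀ a b, G a b = G b a) (a b : Fin 4) :
    contr2 G (fun c c' d d' => (1 / 4) *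
      ((chrArr n a b d' c' c d + chrArr n b a d' c' c d - chrArr n d' a b c' c d)
        - (chrArr n c b d' c' d a + chrArr n b c d' c' d a - chrArr n d' c b c' d a)))
    = (1 / 4) * (contr2 G (fun c c' d d' => n a d b d' c c')
        + contr2 G (fun c c' d d' => n b d a d' c c')
        - contr2 G (fun c c' d d' => n c c' a b d d'))
      - (1 / 2) * contr2 G (fun c c' d d' => n c d a c' b d')
      + (1 / 2) * contr2 G (fun c c' d d' => n c c' a d b d')
      - (1 / 4) * contr2 G (fun c c' d d' => n a b c d c' d') := by
  -- the first three terms come from the contracted Christoffel symbol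
  have t1 : ∀ F : Fin 4 → Fin 4 → Fin 4 → Fin 4 → ℝ,
      contr2 G (fun c c' d d' => F c' c d d') = contr2 G F := fun F => contr2_swap_left hG
  have t2 : ∀ F : Fin 4 → Fin 4 → Fin 4 → Fin 4 → ℝ,
      contr2 G (fun c c' d d' => F c c' d' d) = contr2 G F := fun F => contr2_swap_right hG
  have t3 : ∀ F : Fin 4 → Fin 4 → Fin 4 → Fin 4 → ℝ,
      contr2 G (fun c c' d d' => F d d' c c') = contr2 G F := fun F => contr2_pair_swap
  have p1 : ∀ x y, contr2 G (fun c c' d d' => chrArr n x y d' c' c d)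
      = contr2 G (fun c c' d d' => n x d y d' c c') := by
    intro x y
    simp only [chrArr, contr2_add, contr2_sub]
    rw [← t1 fun c c' d d' => n x c y d' d c']
    have : ∀ c c' d d', n x c' y d' d c = n x c' y d' c d := fun c c' d d' => h.right _ _ _ _ _ _
    simp only [this]; ring
  have p2 : contr2 G (fun c c' d d' => chrArr n d' a b c' c d)
      = contr2 G (fun c c' d d' => n c c' a b d d') := by
    simp only [chrArr, contr2_add, contr2_sub]
    rw [← t1 fun c c' d d' => n d' c a b d c']
    have e : ∀ c c' d d', n d' c' a b d c = n d' c' a b c d := fun c c' d d' => h.right _ _ _ _ _ _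
    simp only [e]
    rw [← t3 fun c c' d d' => n c c' a b d d']
    have e : ∀ c c' d d', n d' d a b c c' = n d d' a b c c' := fun c c' d d' => h.pder _ _ _ _ _ _
    simp only [e]; ring
  have q1 : contr2 G (fun c c' d d' => chrArr n c b d' c' d a)
      = contr2 G (fun c c' d d' => n c d a c' b d')
        + contr2 G (fun c c' d d' => n a c c' d b d')
        - contr2 G (fun c c' d d' => n c c' a d b d') := by
    simp only [chrArr, contr2_add, contr2_sub]
    have e1 : ∀ c c' d d', n c d b d' a c' = n c d a c' b d' := fun _ _ _ _ => h.pair _ _ _ _ _ _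
    have e2 : ∀ c c' d d', n c a b d' d c' = n a c c' d b d' := fun c c' d d' => by
      rw [h.pder, h.pair, h.left]
    have e3 : ∀ c c' d d', n c c' b d' d a = n c c' a d b d' := fun c c' d d' => by
      rw [h.pair, h.left]
    simp only [e1, e2, e3]
  have q2 : contr2 G (fun c c' d d' => chrArr n b c d' c' d a)
      = contr2 G (fun c c' d d' => n a b c d c' d') := by
    simp only [chrArr, contr2_add, contr2_sub]
    rw [← t3 fun c c' d d' => n b d c d' a c', ← t1 fun c c' d d' => n b c d c' a d',
      ← t2 fun c c' d d' => n b c' d c a d']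
    have e1 : ∀ c c' d d', n b c' d' c a d = n b c' c d' d a := fun c c' d d' => by
      rw [h.left, h.right]
    have e2 : ∀ c c' d d', n b a c d' d c' = n a b c d' c' d := fun c c' d d' => by
      rw [h.pder, h.right]
    simp only [e1, e2]
    rw [t2 fun c c' d d' => n a b c d c' d']
    ring
  have q3 : contr2 G (fun c c' d d' => chrArr n d' c b c' d a)
      = contr2 G (fun c c' d d' => n c c' a d b d')
        + contr2 G (fun c c' d d' => n a c c' d b d')
        - contr2 G (fun c c' d d' => n c d a c' b d') := by
    simp only [chrArr, contr2_add, contr2_sub]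
    have e1 : ∀ c c' d d', n d' d c b a c' = n d d' a c' b c := fun c c' d d' => by
      rw [h.pder, h.pair, h.right]
    have e2 : ∀ c c' d d', n d' a c b d c' = n a d' d c' b c := fun c c' d d' => by
      rw [h.pder, h.pair, h.right]
    have e3 : ∀ c c' d d', n d' c' c b d a = n d' c' a d b c := fun c c' d d' => by
      rw [h.pair, h.left, h.right]
    simp only [e1, e2, e3]
    rw [← t3 fun c c' d d' => n c c' a d b d', ← t3 fun c c' d d' => n a c c' d b d',
      ← t3 fun c c' d d' => n c d a c' b d']
    rw [← t1 fun c c' d d' => n d d' a c b c', ← t1 fun c c' d d' => n a d d' c b c',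
      ← t1 fun c c' d d' => n d c a d' b c']
    rw [← t2 fun c c' d d' => n a d d' c' b c, ← t2 fun c c' d d' => n d c' a d' b c]
  have e : contr2 G (fun c c' d d' => (1 / 4) *
      ((chrArr n a b d' c' c d + chrArr n b a d' c' c d - chrArr n d' a b c' c d)
        - (chrArr n c b d' c' d a + chrArr n b c d' c' d a - chrArr n d' c b c' d a)))
      = (1 / 4) * ((contr2 G (fun c c' d d' => chrArr n a b d' c' c d)
          + contr2 G (fun c c' d d' => chrArr n b a d' c' c d)
          - contr2 G (fun c c' d d' => chrArr n d' a b c' c d))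
        - (contr2 G (fun c c' d d' => chrArr n c b d' c' d a)
          + contr2 G (fun c c' d d' => chrArr n b c d' c' d a)
          - contr2 G (fun c c' d d' => chrArr n d' c b c' d a))) := by
    rw [contr2_const_mul]
    simp only [contr2_add, contr2_sub]
  rw [e, p1, p1, p2, q1, q2, q3]
  ring

/-- When the contraction of `α` over its second and fourth index vanishes, the anomalous part of
the Ricci tensor is `-α_a^c_b^d_{cd}`. -/
lemma ric_eq_neg_alpha (h : MuSymm n) (hG : ∀ a b, G a b = G b a)
    (hα : ∀ a b e f, ∑ c, ∑ c', G c c' * alphaArr n a c b c' e f = 0) (a b : Fin 4) :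
    contr2 G (fun c c' d d' => (1 / 4) *
      ((chrArr n a b d' c' c d + chrArr n b a d' c' c d - chrArr n d' a b c' c d)
        - (chrArr n c b d' c' d a + chrArr n b c d' c' d a - chrArr n d' c b c' d a)))
    = -contr2 G (fun c c' d d' => alphaArr n a c b d c' d') := by
  rw [h.ric_eq hG]
  have t2 : ∀ F : Fin 4 → Fin 4 → Fin 4 → Fin 4 → ℝ,
      contr2 G (fun c c' d d' => F c c' d' d) = contr2 G F := fun F => contr2_swap_right hG
  have t1 : ∀ F : Fin 4 → Fin 4 → Fin 4 → Fin 4 → ℝ,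
      contr2 G (fun c c' d d' => F c' c d d') = contr2 G F := fun F => contr2_swap_left hG
  have t3 : ∀ F : Fin 4 → Fin 4 → Fin 4 → Fin 4 → ℝ,
      contr2 G (fun c c' d d' => F d d' c c') = contr2 G F := fun F => contr2_pair_swap
  have hS : contr2 G (fun c c' d d' => alphaArr n a c b d c' d')
      = (1 / 4) * (contr2 G (fun c c' d d' => n a b c d c' d')
        - contr2 G (fun c c' d d' => n b c c' d a d')
        - contr2 G (fun c c' d d' => n a c c' d b d')
        + contr2 G (fun c c' d d' => n c d a b c' d')) := by
    simp only [alphaArr]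
    rw [contr2_const_mul]
    simp only [contr2_add, contr2_sub]
    rw [← t3 fun c c' d d' => n d a c b c' d', ← t2 fun c c' d d' => n b c c' d a d',
      ← t2 fun c c' d d' => n a c c' d b d']
    have e1 : ∀ c c' d d', n b a c d c' d' = n a b c d c' d' := fun _ _ _ _ => h.pder _ _ _ _ _ _
    have e2 : ∀ c c' d d', n b c c' d' a d = n b c a d c' d' := fun _ _ _ _ => h.pair _ _ _ _ _ _
    have e3 : ∀ c c' d d', n a c c' d' b d = n c a d b d' c' := fun c c' d d' => by
      rw [h.pder, h.pair, h.left, h.right]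
    have e4 : ∀ c c' d d', n d c a b c' d' = n c d a b c' d' := fun _ _ _ _ => h.pder _ _ _ _ _ _
    rw [contr2_congr e1, contr2_congr e2, contr2_congr e3, contr2_congr e4]
  -- contraction of the identity for `α` in which one index of `b` is paired with one of `e`
  have r2 : ∀ a b, contr2 G (fun c c' d d' => n a d b d' c c')
      - contr2 G (fun c c' d d' => n c d a c' b d') - contr2 G (fun c c' d d' => n a c c' d b d')
      + contr2 G (fun c c' d d' => n c c' a d b d') = 0 := by
    intro a b
    have h0 : contr2 G (fun c c' d d' => alphaArr n a c d c' d' b) = 0 :=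
      contr2_eq_zero_of_left fun d d' => hα a d d' b
    simp only [alphaArr] at h0
    rw [contr2_const_mul] at h0
    simp only [contr2_add, contr2_sub] at h0
    rw [← t1 fun c c' d d' => n c' a c d d' b] at h0
    have e1 : ∀ c c' d d', n d a c c' d' b = n a d b d' c c' := fun c c' d d' => by
      rw [h.pder, h.pair, h.left]
    have e2 : ∀ c c' d d', n d c a c' d' b = n c d a c' b d' := fun c c' d d' => by
      rw [h.pder, h.right]
    have e3 : ∀ c c' d d', n c a c' d d' b = n a c c' d b d' := fun c c' d d' => by
      rw [h.pder, h.right]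
    have e4 : ∀ c c' d d', n c' c a d d' b = n c c' a d b d' := fun c c' d d' => by
      rw [h.pder, h.right]
    rw [contr2_congr e1, contr2_congr e2, contr2_congr e3, contr2_congr e4] at h0
    linarith
  have r2a := r2 a b
  have r2b := r2 b a
  have e5 : contr2 G (fun c c' d d' => n c d b c' a d')
      = contr2 G (fun c c' d d' => n c d a c' b d') := by
    rw [← t3 fun c c' d d' => n c d a c' b d']
    have e : ∀ c c' d d', n d c a d' b c' = n c d b c' a d' := fun c c' d d' => by
      rw [h.pder, h.pair]
    simp only [e]
  have e6 : contr2 G (fun c c' d d' => n c c' b d a d')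
      = contr2 G (fun c c' d d' => n c c' a d b d') := by
    rw [← t2 fun c c' d d' => n c c' a d b d']
    have e : ∀ c c' d d', n c c' a d' b d = n c c' b d a d' := fun c c' d d' => h.pair _ _ _ _ _ _
    simp only [e]
  rw [e5, e6] at r2b
  -- contraction of the identity for `α` over its first and third index
  have r3 : contr2 G (fun c c' d d' => n c d a b c' d')
      = contr2 G (fun c c' d d' => n c c' a b d d') := by
    have h0 : contr2 G (fun c c' d d' => alphaArr n d c d' c' a b) = 0 :=
      contr2_eq_zero_of_left fun d d' => hα d d' a b
    simp only [alphaArr] at h0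
    rw [contr2_const_mul] at h0
    simp only [contr2_add, contr2_sub] at h0
    rw [← t3 fun c c' d d' => n d' d c c' a b, ← t2 fun c c' d d' => n d' c d c' a b,
      ← t1 fun c c' d d' => n c' d c d' a b] at h0
    have e1 : ∀ c c' d d', n c' c d d' a b = n c c' a b d d' := fun c c' d d' => by
      rw [h.pder, h.pair]
    have e2 : ∀ c c' d d', n d c d' c' a b = n c d a b c' d' := fun c c' d d' => by
      rw [h.pder, h.pair, h.right]
    have e3 : ∀ c c' d d', n c d c' d' a b = n c d a b c' d' := fun c c' d d' => h.pair _ _ _ _ _ _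
    rw [contr2_congr e1, contr2_congr e2, contr2_congr e3] at h0
    linarith
  rw [hS, r3]
  linarith

end MuSymm

end

section

open Filter

section alphaArr

variable {n : Fin 4 → Fin 4 → Fin 4 → Fin 4 → Fin 4 → Fin 4 → ℝ} {G : Fin 4 → Fin 4 → ℝ}

lemma alphaArr_swap_left (a b c d e f : Fin 4) :
    alphaArr n a b c d e f = -alphaArr n b a c d e f := by
  simp only [alphaArr]; ring

lemma alphaArr_swap_right (a b c d e f : Fin 4) :
    alphaArr n a b c d e f = -alphaArr n a b d c e f := by
  simp only [alphaArr]; ring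

/-- The contraction over the first and third index vanishes with that over the second and
fourth. -/
lemma alphaArr_contract_left (hα : ∀ a b e f, ∑ c, ∑ c', G c c' * alphaArr n a c b c' e f = 0)
    (a b e f : Fin 4) : ∑ c, ∑ c', G c c' * alphaArr n c a c' b e f = 0 := by
  rw [← hα a b e f]
  refine Finset.sum_congr rfl fun c _ => Finset.sum_congr rfl fun c' _ => ?_
  rw [alphaArr_swap_left, alphaArr_swap_right, neg_neg]

lemma trace_alphaArr (hα : ∀ a b e f, ∑ c, ∑ c', G c c' * alphaArr n a c b c' e f = 0) :
    ∑ a, ∑ b, G a b * contr2 G (fun c c' d d' => alphaArr n a c b d c' d') = 0 := by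
  have h1 : ∀ c c' d d', ∑ a, ∑ b, G a b * alphaArr n a c b d c' d' = 0 := fun c c' d d' =>
    alphaArr_contract_left hα c d c' d'
  have h2 : ∑ a, ∑ b, G a b * contr2 G (fun c c' d d' => alphaArr n a c b d c' d')
      = contr2 G (fun c c' d d' => ∑ a, ∑ b, G a b * alphaArr n a c b d c' d') := by
    calc ∑ a, ∑ b, G a b * contr2 G (fun c c' d d' => alphaArr n a c b d c' d')
        = ∑ p : Fin 4 × Fin 4, ∑ q : Fin 4 × Fin 4 × Fin 4 × Fin 4,
            G q.1 q.2.1 * G q.2.2.1 q.2.2.2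
              * (G p.1 p.2 * alphaArr n p.1 q.1 p.2 q.2.2.1 q.2.1 q.2.2.2) := by
          simp only [Fintype.sum_prod_type, contr2, Finset.mul_sum, mul_left_comm, mul_assoc]
      _ = ∑ q : Fin 4 × Fin 4 × Fin 4 × Fin 4, ∑ p : Fin 4 × Fin 4,
            G q.1 q.2.1 * G q.2.2.1 q.2.2.2
              * (G p.1 p.2 * alphaArr n p.1 q.1 p.2 q.2.2.1 q.2.1 q.2.2.2) := Finset.sum_comm
      _ = _ := by simp only [Fintype.sum_prod_type, contr2, Finset.mul_sum]
  rw [h2]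
  simp only [h1]
  simp [contr2]

/-- All terms of the effective stress tensor but the first are contractions of `α` over one of its
first and one of its second pair of indices. -/
lemma effective_terms_eq_zero
    (hα : ∀ a b e f, ∑ c, ∑ c', G c c' * alphaArr n a c b c' e f = 0) :
    (∀ a b, contr2 G (fun c c' d d' => alphaArr n c d c' d' a b) = 0) ∧
    (∀ a b, contr2 G (fun c c' d d' => alphaArr n a c d c' d' b) = 0) ∧
    ∀ e e', contr2 G (fun c c' d d' => alphaArr n c d e c' d' e') = 0 := by
  refine ⟨fun a b => ?_, fun a b => ?_, fun e e' => ?_⟩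
  · exact contr2_eq_zero_of_left fun d d' => alphaArr_contract_left hα d d' a b
  · exact contr2_eq_zero_of_left fun d d' => hα a d d' b
  · refine contr2_eq_zero_of_left fun d d' => ?_
    have := hα d e d' e'
    simp only [fun c c' => alphaArr_swap_left (n := n) c d e c' d' e', mul_neg,
      Finset.sum_neg_distrib, this, neg_zero]

end alphaArr

/-! ### The local form of the theorem -/

section Local

variable {B : Set E4} {γ : ℝ → E4 → Mat4}
  {m : Fin 4 → Fin 4 → Fin 4 → Fin 4 → Fin 4 → Fin 4 → E4 → ℝ}

/-- The weak limits as an array in the index order of `μ_{pqabef}`. -/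
def muArr (m : Fin 4 → Fin 4 → Fin 4 → Fin 4 → Fin 4 → Fin 4 → E4 → ℝ) (y : E4) :
    Fin 4 → Fin 4 → Fin 4 → Fin 4 → Fin 4 → Fin 4 → ℝ :=
  fun p q a b e f => m p a b q e f y

lemma HasQuadLimit.muSymm (hm : HasQuadLimit B γ m) (h : MetricFamily B γ) {y : E4} (hy : y ∈ B) :
    MuSymm (muArr m y) where
  left p q a b e f := hm.symm_left h hy p a b q e f
  pair p q a b e f := by
    simp only [muArr]
    rw [hm.swap h hy, hm.swap_pder h hy]
  pder p q a b e f := hm.swap_pder h hy p a b q e f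

lemma limOscChr_eq (γ₀ : E4 → Mat4) (p e f c a b : Fin 4) (y : E4) :
    limOscChr γ₀ m p e f c a b y
      = (1 / 2) * ∑ d, (γ₀ y)⁻¹ c d * chrArr (muArr m y) p e f d a b := rfl

lemma limRic_eq (γ₀ : E4 → Mat4) (a b : Fin 4) (y : E4) :
    limRic γ₀ m a b y = contr2 (fun c d => (γ₀ y)⁻¹ c d) (fun c c' d d' => (1 / 4) *
      ((chrArr (muArr m y) a b d' c' c d + chrArr (muArr m y) b a d' c' c d
          - chrArr (muArr m y) d' a b c' c d)
        - (chrArr (muArr m y) c b d' c' d a + chrArr (muArr m y) b c d' c' d a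
          - chrArr (muArr m y) d' c b c' d a))) := by
  have hsum : ∀ F : Fin 4 → Fin 4 → Fin 4 → ℝ,
      ∑ d, ∑ e, ∑ g, F d e g = ∑ g, ∑ d, ∑ e, F d e g := fun F =>
    (Finset.sum_congr rfl fun d _ => Finset.sum_comm).trans Finset.sum_comm
  simp only [limRic, limChrChr, limOscChr_eq, contr2, Finset.mul_sum, ← Finset.sum_add_distrib,
    ← Finset.sum_sub_distrib]
  refine Finset.sum_congr rfl fun c _ => ?_
  rw [hsum]
  refine Finset.sum_congr rfl fun g _ => Finset.sum_congr rfl fun d _ =>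
    Finset.sum_congr rfl fun e _ => ?_
  ring

/-- The local form of the theorem, for the source `S = G + Λ g` and near a given point. -/
theorem MetricFamily.exists_local_limits (h : MetricFamily B γ) (hm : HasQuadLimit B γ m)
    {Λ : ℝ} {S : Fin 4 → Fin 4 → ℝ → E4 → ℝ} {y₀ : E4} (hy₀ : y₀ ∈ B) {t : Fin 4 → ℝ}
    (ht : quadForm (γ 0 y₀) t < 0)
    (hS : ∀ s, 0 < s → ∀ y ∈ B, ∀ a b, S a b s y = locEin (γ s) a b y + Λ * γ s y a b)
    (hpos : ∀ s, 0 < s → ∀ y ∈ B, ∀ w, quadForm (γ s y) w < 0 →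
      0 ≤ quadForm (Matrix.of fun a b => S a b s y) w) :
    ∃ r, 0 < r ∧ Metric.ball y₀ r ⊆ B ∧
      (∀ y ∈ Metric.ball y₀ r, ∀ a b e f,
        ∑ c, ∑ c', (γ 0 y)⁻¹ c c' * alphaArr (muArr m y) a c b c' e f = 0) ∧
      (∀ a b, Wk (Metric.ball y₀ r) (S a b) (fun y => locEin (γ 0) a b y + Λ * γ 0 y a b
        - contr2 (fun c d => (γ 0 y)⁻¹ c d)
            (fun c c' d d' => alphaArr (muArr m y) a c b d c' d'))) ∧
      ∀ e f a b, Wk (Metric.ball y₀ r) (fun s y => (γ s y e f - γ 0 y e f) * S a b s y)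
        (fun _ => 0) := by
  obtain ⟨r, hr, hsub, hL⟩ := h.exists_l1Bd hy₀ ht hS hpos
  have hO : IsOpen (Metric.ball y₀ r) := Metric.isOpen_ball
  have h' := h.mono hO hsub
  have hm' := hm.mono hsub
  have hS' : ∀ s, 0 < s → ∀ y ∈ Metric.ball y₀ r, ∀ a b,
      S a b s y = locEin (γ s) a b y + Λ * γ s y a b := fun s hs y hy => hS s hs y (hsub hy)
  have hR := h'.l1Bd_ric hL hS' fun a b =>
    (h'.bdd_self a b).l1Bd hO (measure_ball_lt_top).ne
  have hα : ∀ y ∈ Metric.ball y₀ r, ∀ a b e f,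
      ∑ c, ∑ c', (γ 0 y)⁻¹ c c' * alphaArr (muArr m y) a c b c' e f = 0 := by
    intro y hy
    refine (hm'.muSymm h' hy).alpha_contract (G := fun c d => (γ 0 y)⁻¹ c d) fun e f a b => ?_
    have h1 := (h'.wk_dev_ric hm' e f a b).unique hO
      (L1Bd.wk_sml_mul hO (h'.sml e f) (hR a b)) y hy
    rw [neg_eq_zero] at h1
    exact h1
  refine ⟨r, hr, hsub, hα, fun a b => ?_, fun e f a b => L1Bd.wk_sml_mul hO (h'.sml e f) (hL a b)⟩
  have hlim : ∀ y ∈ Metric.ball y₀ r, ∀ a b, limRic (γ 0) m a b y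
      = -contr2 (fun c d => (γ 0 y)⁻¹ c d)
          (fun c c' d d' => alphaArr (muArr m y) a c b d c' d') := fun y hy a b => by
    rw [limRic_eq]
    exact (hm'.muSymm h' hy).ric_eq_neg_alpha
      (fun a b => (h'.metric 0 le_rfl).inv_symm hy a b) (hα y hy) a b
  refine (h'.wk_source hm' hR hS' a b).congr (fun _ _ _ _ => rfl) fun y hy => ?_
  have htr := trace_alphaArr (hα y hy)
  have h0 : ∑ c, ∑ d, (γ 0 y)⁻¹ c d * limRic (γ 0) m c d y = 0 := by
    simp only [hlim y hy, mul_neg, Finset.sum_neg_distrib]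
    rw [neg_eq_zero]
    exact htr
  rw [h0, hlim y hy]
  ring

end Local

end

section

open Filter Bundle

/-! ### Coordinate frames -/

variable {M : Type*} [TopologicalSpace M] [ChartedSpace E4 M]

lemma mem_charts_mdifferentiable {φ : Chart M} (hφ : φ ∈ charts M) :
    φ.MDifferentiable (𝓡 4) (𝓡 4) :=
  ⟨(contMDiffOn_of_mem_maximalAtlas hφ).mdifferentiableOn (by simp),
    (contMDiffOn_symm_of_mem_maximalAtlas hφ).mdifferentiableOn (by simp)⟩

lemma chartAt_mem_charts [IsManifold (𝓡 4) ∞ M] (x : M) : chartAt E4 x ∈ charts M :=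
  IsManifold.chart_mem_maximalAtlas x

lemma proj_stdVec (a b : Fin 4) :
    (EuclideanSpace.proj a : E4 →L[ℝ] ℝ) (stdVec b) = if a = b then 1 else 0 := by
  simp [stdVec]

lemma eq_sum_stdVec (v : E4) : v = ∑ a, v a • stdVec a := by
  ext i
  simp [stdVec, Pi.single_apply]

/-- The covariant tensor at `x` with given components in a chart. -/
def covOfComp {k : ℕ} (φ : Chart M) (x : M) (F : (Fin k → Fin 4) → ℝ) :
    MultilinearMap ℝ (fun _ : Fin k => TangentSpace (𝓡 4) x) ℝ :=
  ∑ j, F j • (MultilinearMap.mkPiAlgebra ℝ (Fin k) ℝ).compLinearMap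
    (fun l => (coordForm φ (j l) x : TangentSpace (𝓡 4) x →ₗ[ℝ] ℝ))

lemma covOfComp_apply {k : ℕ} (φ : Chart M) (x : M) (F : (Fin k → Fin 4) → ℝ)
    (v : Fin k → TangentSpace (𝓡 4) x) :
    covOfComp φ x F v = ∑ j, F j * ∏ l, coordForm φ (j l) x (v l) := by
  simp [covOfComp]

/-- The contravariant tensor field with given components in a chart, extended by zero outside the
domain of the chart. -/
def conOfComp {k : ℕ} (φ : Chart M) (F : M → (Fin k → Fin 4) → ℝ) : Con M k := fun x =>
  ∑ j, F x j • (MultilinearMap.mkPiAlgebra ℝ (Fin k) ℝ).compLinearMap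
    (fun l => ({ toFun := fun w => w (coordVec φ (j l) x)
                 map_add' := fun _ _ => rfl
                 map_smul' := fun _ _ => rfl } : (TangentSpace (𝓡 4) x →L[ℝ] ℝ) →ₗ[ℝ] ℝ))

lemma conOfComp_apply {k : ℕ} (φ : Chart M) (F : M → (Fin k → Fin 4) → ℝ) (x : M)
    (w : Fin k → TangentSpace (𝓡 4) x →L[ℝ] ℝ) :
    conOfComp φ F x w = ∑ j, F x j * ∏ l, w l (coordVec φ (j l) x) := by
  simp [conOfComp]

/-- The coordinate vector field is the inverse image of a standard basis vector. -/
lemma mfderiv_coordVec {φ : Chart M} (hφ : φ ∈ charts M) {x : M} (hx : x ∈ φ.source)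
    (a : Fin 4) : mfderiv (𝓡 4) 𝓘(ℝ, E4) φ x (coordVec φ a x) = stdVec a := by
  have h := (mem_charts_mdifferentiable hφ).comp_symm_deriv (φ.map_source hx)
  rw [φ.left_inv hx] at h
  exact congrArg (fun L => L (stdVec a)) h

lemma coordForm_coordVec {φ : Chart M} (hφ : φ ∈ charts M) {x : M} (hx : x ∈ φ.source)
    (a b : Fin 4) : coordForm φ a x (coordVec φ b x) = if a = b then 1 else 0 := by
  have : coordForm φ a x (coordVec φ b x)
      = (EuclideanSpace.proj a : E4 →L[ℝ] ℝ) (mfderiv (𝓡 4) 𝓘(ℝ, E4) φ x (coordVec φ b x)) := rfl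
  rw [this, mfderiv_coordVec hφ hx, proj_stdVec]

/-- Expansion of a tangent vector in a coordinate frame. -/
lemma eq_sum_coordVec {φ : Chart M} (hφ : φ ∈ charts M) {x : M} (hx : x ∈ φ.source)
    (v : TangentSpace (𝓡 4) x) : v = ∑ a, coordForm φ a x v • coordVec φ a x := by
  have hinj := (mem_charts_mdifferentiable hφ).mfderiv_injective hx
  refine hinj ?_
  rw [map_sum]
  simp only [map_smul]
  have h1 : ∀ a, mfderiv (𝓡 4) (𝓡 4) φ x (coordVec φ a x) = stdVec a := mfderiv_coordVec hφ hx
  simp only [h1]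
  exact eq_sum_stdVec _

/-- Expansion of a tangent covector in a coordinate coframe. -/
lemma eq_sum_coordForm {φ : Chart M} (hφ : φ ∈ charts M) {x : M} (hx : x ∈ φ.source)
    (w : TangentSpace (𝓡 4) x →L[ℝ] ℝ) : w = ∑ a, w (coordVec φ a x) • coordForm φ a x := by
  ext v
  conv_lhs => rw [eq_sum_coordVec hφ hx v]
  simp only [map_sum, map_smul, smul_eq_mul, sum_apply,
    smul_apply]
  exact Finset.sum_congr rfl fun a _ => mul_comm _ _

/-- The Jacobian matrix `∂x_φ^b / ∂x_ψ^a` of two charts. -/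
def jac (φ ψ : Chart M) (x : M) (a b : Fin 4) : ℝ := coordForm φ b x (coordVec ψ a x)

lemma Cov.comp_change {k : ℕ} (A : Cov M k) {φ ψ : Chart M} (hφ : φ ∈ charts M) {x : M}
    (hx : x ∈ φ.source) (i : Fin k → Fin 4) :
    A.comp ψ x i = ∑ j : Fin k → Fin 4, (∏ l, jac φ ψ x (i l) (j l)) * A.comp φ x j := by
  have h : (fun l => coordVec ψ (i l) x)
      = fun l => ∑ a, coordForm φ a x (coordVec ψ (i l) x) • coordVec φ a x :=
    funext fun l => eq_sum_coordVec hφ hx _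
  simp only [Cov.comp]
  rw [h, MultilinearMap.map_sum]
  refine Finset.sum_congr rfl fun j _ => ?_
  rw [MultilinearMap.map_smul_univ]
  rfl

lemma Con.comp_change {k : ℕ} (f : Con M k) {φ ψ : Chart M} (hψ : ψ ∈ charts M) {x : M}
    (hx : x ∈ ψ.source) (j : Fin k → Fin 4) :
    f.comp φ x j = ∑ i : Fin k → Fin 4, (∏ l, jac φ ψ x (i l) (j l)) * f.comp ψ x i := by
  have h : (fun l => coordForm φ (j l) x)
      = fun l => ∑ a, coordForm φ (j l) x (coordVec ψ a x) • coordForm ψ a x :=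
    funext fun l => eq_sum_coordForm hψ hx _
  simp only [Con.comp]
  rw [h, MultilinearMap.map_sum]
  refine Finset.sum_congr rfl fun i _ => ?_
  rw [MultilinearMap.map_smul_univ]
  rfl

/-- The full contraction may be computed in any chart. -/
lemma contract_eq [IsManifold (𝓡 4) ∞ M] {k : ℕ} (f : Con M k) (A : Cov M k) {φ : Chart M}
    (hφ : φ ∈ charts M) {x : M}
    (hx : x ∈ φ.source) :
    contract f A.comp x = ∑ i, f.comp φ x i * A.comp φ x i := by
  set ψ := chartAt E4 x with hψ
  have hx' : x ∈ ψ.source := mem_chart_source E4 x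
  have h1 : contract f A.comp x = ∑ i, f.comp ψ x i * A.comp ψ x i := rfl
  rw [h1]
  simp only [A.comp_change (ψ := ψ) hφ hx, f.comp_change (φ := φ) (chartAt_mem_charts x) hx',
    Finset.mul_sum, Finset.sum_mul]
  rw [Finset.sum_comm]
  exact Finset.sum_congr rfl fun j _ => Finset.sum_congr rfl fun i _ => by rw [← hψ]; ring

lemma prod_ite_eq {k : ℕ} (i j : Fin k → Fin 4) :
    (∏ l, if j l = i l then (1 : ℝ) else 0) = if j = i then 1 else 0 := by
  rw [Finset.prod_ite_zero]
  simp [funext_iff]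

lemma covOfComp_coordVec {k : ℕ} {φ : Chart M} (hφ : φ ∈ charts M) {x : M} (hx : x ∈ φ.source)
    (F : (Fin k → Fin 4) → ℝ) (i : Fin k → Fin 4) :
    covOfComp φ x F (fun l => coordVec φ (i l) x) = F i := by
  rw [covOfComp_apply]
  simp only [coordForm_coordVec hφ hx, prod_ite_eq]
  simp

lemma conOfComp_comp {k : ℕ} {φ : Chart M} (hφ : φ ∈ charts M) {x : M} (hx : x ∈ φ.source)
    (F : M → (Fin k → Fin 4) → ℝ) (i : Fin k → Fin 4) :
    (conOfComp φ F).comp φ x i = F x i := by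
  rw [Con.comp, conOfComp_apply]
  simp only [coordForm_coordVec hφ hx, eq_comm (a := i _), prod_ite_eq]
  simp

/-! ### Regularity of frames and tensors -/

lemma coordVec_eq_mpullback {φ : Chart M} (hφ : φ ∈ charts M) {x : M} (hx : x ∈ φ.source)
    (a : Fin 4) : coordVec φ a x
      = VectorField.mpullback (𝓡 4) 𝓘(ℝ, E4) φ (fun _ => (stdVec a : E4)) x := by
  have hinj := (mem_charts_mdifferentiable hφ).mfderiv_injective hx
  have hinv : (mfderiv (𝓡 4) 𝓘(ℝ, E4) φ x).IsInvertible :=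
    ⟨(mem_charts_mdifferentiable hφ).mfderiv hx, rfl⟩
  refine hinj ?_
  have h1 : mfderiv (𝓡 4) (𝓡 4) φ x (coordVec φ a x) = stdVec a := mfderiv_coordVec hφ hx a
  exact h1.trans (hinv.self_apply_inverse (stdVec a)).symm

lemma contMDiffAt_coordVec [IsManifold (𝓡 4) ∞ M] {φ : Chart M} (hφ : φ ∈ charts M) {x : M}
    (hx : x ∈ φ.source)
    (a : Fin 4) :
    ContMDiffAt (𝓡 4) ((𝓡 4).prod 𝓘(ℝ, E4)) ∞
      (fun z => (⟨z, coordVec φ a z⟩ : TotalSpace E4 (TangentSpace (𝓡 4) : M → Type _))) x := by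
  have hinv : (mfderiv (𝓡 4) 𝓘(ℝ, E4) φ x).IsInvertible :=
    ⟨(mem_charts_mdifferentiable hφ).mfderiv hx, rfl⟩
  have h1 : ContMDiffAt 𝓘(ℝ, E4) (𝓘(ℝ, E4).prod 𝓘(ℝ, E4)) ∞
      (fun z => (⟨z, stdVec a⟩ : TotalSpace E4 (TangentSpace 𝓘(ℝ, E4) : E4 → Type _))) (φ x) :=
    contMDiffAt_vectorSpace_iff_contDiffAt.mpr contDiffAt_const
  have h2 := ContMDiffAt.mpullback_vectorField_preimage (n := ∞) (m := ∞)
    (V := fun _ => (stdVec a : E4)) h1 (contMDiffAt_of_mem_maximalAtlas hφ hx) hinv (by simp)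
  refine h2.congr_of_eventuallyEq ?_
  filter_upwards [φ.open_source.mem_nhds hx] with z hz
  rw [coordVec_eq_mpullback hφ hz]

lemma mfderiv_section_contMDiffOn [IsManifold (𝓡 4) ∞ M] {φ : Chart M} (hφ : φ ∈ charts M) :
    ContMDiffOn (𝓡 4).tangent 𝓘(ℝ, E4) ∞
      (fun p : TangentBundle (𝓡 4) M => (mfderiv (𝓡 4) 𝓘(ℝ, E4) φ p.1 p.2 : E4))
      (TotalSpace.proj ⁻¹' φ.source) := by
  have h1 := (contMDiffOn_of_mem_maximalAtlas hφ).contMDiffOn_tangentMapWithin (m := ∞) (n := ∞)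
    (by simp) φ.open_source.uniqueMDiffOn
  have h2 := (contMDiff_snd_tangentBundle_modelSpace (n := ∞) E4 𝓘(ℝ, E4)).comp_contMDiffOn h1
  refine h2.congr fun p hp => ?_
  simp only [Function.comp, tangentMapWithin]
  rw [mfderivWithin_of_isOpen φ.open_source hp]

end

section

open Filter Bundle

/-! ### The covariant derivative as a tensor field -/

variable {M : Type*} [TopologicalSpace M] [ChartedSpace E4 M]

section Bilinear

variable (h : Cov M 2) (x : M) (v v' w w' : TangentSpace (𝓡 4) x) (c : ℝ)

lemma update_pair_zero {α : Type*} (a b c : α) : Function.update ![a, b] 0 c = ![c, b] := by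
  funext i; fin_cases i <;> rfl

lemma update_pair_one {α : Type*} (a b c : α) : Function.update ![a, b] 1 c = ![a, c] := by
  funext i; fin_cases i <;> rfl

lemma Cov.add_left : h x ![v + v', w] = h x ![v, w] + h x ![v', w] := by
  have := (h x).map_update_add ![v, w] 0 v v'
  rwa [update_pair_zero, update_pair_zero, update_pair_zero] at this

lemma Cov.add_right : h x ![v, w + w'] = h x ![v, w] + h x ![v, w'] := by
  have := (h x).map_update_add ![v, w] 1 w w'
  rwa [update_pair_one, update_pair_one, update_pair_one] at this

lemma Cov.smul_left : h x ![c • v, w] = c * h x ![v, w] := by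
  have := (h x).map_update_smul ![v, w] 0 c v
  rwa [update_pair_zero, update_pair_zero] at this

lemma Cov.smul_right : h x ![v, c • w] = c * h x ![v, w] := by
  have := (h x).map_update_smul ![v, w] 1 c w
  rwa [update_pair_one, update_pair_one] at this

/-- A rank two covariant tensor as a bilinear form. -/
def Cov.bilin : TangentSpace (𝓡 4) x →ₗ[ℝ] TangentSpace (𝓡 4) x →ₗ[ℝ] ℝ :=
  LinearMap.mk₂ ℝ (fun v w => h x ![v, w]) (fun v v' w => h.add_left x v v' w)
    (fun c v w => h.smul_left x v w c) (fun v w w' => h.add_right x v w w')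
    (fun c v w => h.smul_right x v w c)

lemma Cov.bilin_apply : h.bilin x v w = h x ![v, w] := rfl

end Bilinear

lemma Cov.bilin_coordVec (h : Cov M 2) (φ : Chart M) (x : M) (a b : Fin 4) :
    h.bilin x (coordVec φ a x) (coordVec φ b x) = h.comp φ x ![a, b] := by
  rw [Cov.bilin_apply, Cov.comp]
  congr 1
  funext i; fin_cases i <;> rfl

lemma Cov.eq_sum_comp (h : Cov M 2) {φ : Chart M} (hφ : φ ∈ charts M) {x : M} (hx : x ∈ φ.source)
    (v w : TangentSpace (𝓡 4) x) :
    h x ![v, w] = ∑ a, ∑ b, coordForm φ a x v * coordForm φ b x w * h.comp φ x ![a, b] := by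
  rw [← Cov.bilin_apply]
  conv_lhs => rw [eq_sum_coordVec hφ hx v, eq_sum_coordVec hφ hx w]
  simp only [map_sum, map_smul, LinearMap.sum_apply, LinearMap.smul_apply, smul_eq_mul,
    Cov.bilin_coordVec, Finset.mul_sum]
  rw [Finset.sum_comm]
  refine Finset.sum_congr rfl fun a _ => Finset.sum_congr rfl fun b _ => ?_
  ring

lemma contMDiffAt_of_chart {φ : Chart M} (hφ : φ ∈ charts M) {u : M → ℝ}
    (hu : ContDiffOn ℝ ∞ (fun y => u (φ.symm y)) φ.target) {x : M} (hx : x ∈ φ.source) :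
    ContMDiffAt (𝓡 4) 𝓘(ℝ, ℝ) ∞ u x := by
  have h1 : ContMDiffAt 𝓘(ℝ, E4) 𝓘(ℝ, ℝ) ∞ (fun y => u (φ.symm y)) (φ x) :=
    (hu.contDiffAt (φ.open_target.mem_nhds (φ.map_source hx))).contMDiffAt
  refine (h1.comp x (contMDiffAt_of_mem_maximalAtlas hφ hx)).congr_of_eventuallyEq ?_
  filter_upwards [φ.open_source.mem_nhds hx] with z hz
  simp [φ.left_inv hz]

lemma contDiffOn_chart {φ : Chart M} (hφ : φ ∈ charts M) {u : M → ℝ}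
    (hu : ∀ x ∈ φ.source, ContMDiffAt (𝓡 4) 𝓘(ℝ, ℝ) ∞ u x) :
    ContDiffOn ℝ ∞ (fun y => u (φ.symm y)) φ.target := by
  intro y hy
  have h1 : ContMDiffAt 𝓘(ℝ, E4) 𝓘(ℝ, ℝ) ∞ (fun y => u (φ.symm y)) y :=
    (hu _ (φ.map_target hy)).comp y (contMDiffAt_symm_of_mem_maximalAtlas hφ hy)
  exact h1.contDiffAt.contDiffWithinAt

lemma Cov.Smooth.contMDiffAt {k : ℕ} {A : Cov M k} (hA : A.Smooth) {φ : Chart M}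
    (hφ : φ ∈ charts M) {x : M} (hx : x ∈ φ.source) (i : Fin k → Fin 4) :
    ContMDiffAt (𝓡 4) 𝓘(ℝ, ℝ) ∞ (fun z => A.comp φ z i) x :=
  contMDiffAt_of_chart hφ (hA φ hφ i) hx

/-- The frame coefficients of a smooth vector field are smooth. -/
lemma contMDiffAt_coordForm [IsManifold (𝓡 4) ∞ M] {φ : Chart M} (hφ : φ ∈ charts M) {x : M}
    (hx : x ∈ φ.source)
    {X : Π z : M, TangentSpace (𝓡 4) z} (hX : ContMDiffAt (𝓡 4) ((𝓡 4).prod 𝓘(ℝ, E4)) ∞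
      (fun z => (⟨z, X z⟩ : TotalSpace E4 (TangentSpace (𝓡 4) : M → Type _))) x) (a : Fin 4) :
    ContMDiffAt (𝓡 4) 𝓘(ℝ, ℝ) ∞ (fun z => coordForm φ a z (X z)) x := by
  have h1 := ((mfderiv_section_contMDiffOn hφ).contMDiffAt (x := ⟨x, X x⟩)
    ((φ.open_source.preimage (FiberBundle.continuous_proj E4 _)).mem_nhds hx))
  have h2 := ContMDiffAt.comp (I := 𝓡 4) (I' := (𝓡 4).tangent) (I'' := 𝓘(ℝ, E4)) x
    (f := fun z => (⟨z, X z⟩ : TangentBundle (𝓡 4) M)) h1 hX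
  exact ((EuclideanSpace.proj a : E4 →L[ℝ] ℝ).contMDiff (n := ∞)).contMDiffAt.comp x h2

lemma mdifferentiableAt_coordForm [IsManifold (𝓡 4) ∞ M] {φ : Chart M} (hφ : φ ∈ charts M) {x : M}
    (hx : x ∈ φ.source)
    {X : Π z : M, TangentSpace (𝓡 4) z} (hX : MDifferentiableAt (𝓡 4) ((𝓡 4).prod 𝓘(ℝ, E4))
      (fun z => (⟨z, X z⟩ : TotalSpace E4 (TangentSpace (𝓡 4) : M → Type _))) x) (a : Fin 4) :
    MDifferentiableAt (𝓡 4) 𝓘(ℝ, ℝ) (fun z => coordForm φ a z (X z)) x := by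
  have h1 := (((mfderiv_section_contMDiffOn hφ).contMDiffAt (x := ⟨x, X x⟩)
    ((φ.open_source.preimage (FiberBundle.continuous_proj E4 _)).mem_nhds hx)).mdifferentiableAt
      (by simp))
  have h2 := MDifferentiableAt.comp (I := 𝓡 4) (I' := (𝓡 4).tangent) (I'' := 𝓘(ℝ, E4)) x
    (f := fun z => (⟨z, X z⟩ : TangentBundle (𝓡 4) M)) h1 hX
  exact ((EuclideanSpace.proj a : E4 →L[ℝ] ℝ).mdifferentiableAt).comp x h2

lemma Cov.Smooth.mdifferentiableAt_apply [IsManifold (𝓡 4) ∞ M] {h : Cov M 2} (hh : h.Smooth)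
    {x : M}
    {X Y : Π z : M, TangentSpace (𝓡 4) z} (hX : MDifferentiableAt (𝓡 4) ((𝓡 4).prod 𝓘(ℝ, E4))
      (fun z => (⟨z, X z⟩ : TotalSpace E4 (TangentSpace (𝓡 4) : M → Type _))) x)
    (hY : MDifferentiableAt (𝓡 4) ((𝓡 4).prod 𝓘(ℝ, E4))
      (fun z => (⟨z, Y z⟩ : TotalSpace E4 (TangentSpace (𝓡 4) : M → Type _))) x) :
    MDifferentiableAt (𝓡 4) 𝓘(ℝ, ℝ) (fun z => h z ![X z, Y z]) x := by
  set φ := chartAt E4 x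
  have hφ : φ ∈ charts M := chartAt_mem_charts x
  have hx : x ∈ φ.source := mem_chart_source E4 x
  have h0 : ∀ p ∈ (Finset.univ : Finset (Fin 4 × Fin 4)), MDifferentiableAt (𝓡 4) 𝓘(ℝ, ℝ)
      (fun z => coordForm φ p.1 z (X z) * coordForm φ p.2 z (Y z) * h.comp φ z ![p.1, p.2]) x :=
    fun p _ => ((mdifferentiableAt_coordForm hφ hx hX p.1).mul
      (mdifferentiableAt_coordForm hφ hx hY p.2)).mul
      ((hh.contMDiffAt hφ hx ![p.1, p.2]).mdifferentiableAt (by simp))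
  have h1 := MDifferentiableAt.sum h0
  refine h1.congr_of_eventuallyEq ?_
  filter_upwards [φ.open_source.mem_nhds hx] with z hz
  rw [Finset.sum_apply, Fintype.sum_prod_type]
  exact h.eq_sum_comp hφ hz _ _

/-- The partial derivative in a chart is the derivative along the coordinate vector field. -/
lemma pd_eq_mvfderiv {φ : Chart M} (hφ : φ ∈ charts M) {x : M} (hx : x ∈ φ.source) (a : Fin 4)
    {u : M → ℝ} (hu : MDifferentiableAt (𝓡 4) 𝓘(ℝ, ℝ) u x) :
    pd φ a u x = mvfderiv (𝓡 4) u x (coordVec φ a x) := by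
  have hs : MDifferentiableAt 𝓘(ℝ, E4) (𝓡 4) φ.symm (φ x) :=
    (mem_charts_mdifferentiable hφ).mdifferentiableAt_symm (φ.map_source hx)
  have hu' : MDifferentiableAt (𝓡 4) 𝓘(ℝ, ℝ) u (φ.symm (φ x)) := by rwa [φ.left_inv hx]
  have h1 := mfderiv_comp (I := 𝓘(ℝ, E4)) (I' := 𝓡 4) (I'' := 𝓘(ℝ, ℝ)) (g := u) (f := φ.symm)
    (φ x) hu' hs
  rw [mfderiv_eq_fderiv] at h1
  have h2 := congrArg (fun L : E4 →L[ℝ] ℝ => L (stdVec a)) h1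
  rw [φ.left_inv hx] at h2
  exact h2

variable [IsManifold (𝓡 4) ∞ M] (D : Connection M) (h : Cov M 2)

/-- The expression `v(h(X, Y)) - h(∇_v X, Y) - h(X, ∇_v Y)`. -/
def covDerivAux (x : M) (v : TangentSpace (𝓡 4) x) (X Y : Π z : M, TangentSpace (𝓡 4) z) : ℝ :=
  mvfderiv (𝓡 4) (fun z => h z ![X z, Y z]) x v - h x ![D X x v, Y x] - h x ![X x, D Y x v]

variable {h}

lemma covDerivAux_tensorial_left [IsManifold (𝓡 4) ∞ M] (hh : h.Smooth) (x : M)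
    (v : TangentSpace (𝓡 4) x)
    (Y : Π z : M, TangentSpace (𝓡 4) z) (hY : MDifferentiableAt (𝓡 4) ((𝓡 4).prod 𝓘(ℝ, E4))
      (fun z => (⟨z, Y z⟩ : TotalSpace E4 (TangentSpace (𝓡 4) : M → Type _))) x) :
    TensorialAt (𝓡 4) E4 (covDerivAux D h x v · Y) x where
  smul {f X} hf hX := by
    have e : (fun z => h z ![(f • X) z, Y z]) = f * fun z => h z ![X z, Y z] :=
      funext fun z => h.smul_left z _ _ _
    have hd := D.isCovariantDerivativeOnUniv.leibniz hX hf
    have hd' : D (f • X) x v = f x • D X x v + mvfderiv (𝓡 4) f x v • X x := by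
      rw [hd]; rfl
    simp only [covDerivAux]
    rw [e, mvfderiv_mul hf (hh.mdifferentiableAt_apply hX hY), hd', h.add_left, h.smul_left,
      h.smul_left]
    have e3 : h x ![(f • X) x, D Y x v] = f x * h x ![X x, D Y x v] := h.smul_left x _ _ _
    rw [e3]
    simp
    ring
  add {X X'} hX hX' := by
    have e : (fun z => h z ![(X + X') z, Y z]) = (fun z => h z ![X z, Y z]) + fun z => h z ![X' z, Y z] :=
      funext fun z => h.add_left z _ _ _
    have hd := D.isCovariantDerivativeOnUniv.add hX hX'
    have hd' : D (X + X') x v = D X x v + D X' x v := by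
      rw [hd]; rfl
    simp only [covDerivAux]
    rw [e, mvfderiv_add (hh.mdifferentiableAt_apply hX hY) (hh.mdifferentiableAt_apply hX' hY),
      hd', h.add_left]
    have e3 : h x ![(X + X') x, D Y x v] = h x ![X x, D Y x v] + h x ![X' x, D Y x v] :=
      h.add_left x _ _ _
    rw [e3]
    simp
    ring

lemma covDerivAux_tensorial_right [IsManifold (𝓡 4) ∞ M] (hh : h.Smooth) (x : M)
    (v : TangentSpace (𝓡 4) x)
    (X : Π z : M, TangentSpace (𝓡 4) z) (hX : MDifferentiableAt (𝓡 4) ((𝓡 4).prod 𝓘(ℝ, E4))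
      (fun z => (⟨z, X z⟩ : TotalSpace E4 (TangentSpace (𝓡 4) : M → Type _))) x) :
    TensorialAt (𝓡 4) E4 (covDerivAux D h x v X) x where
  smul {f Y} hf hY := by
    have e : (fun z => h z ![X z, (f • Y) z]) = f * fun z => h z ![X z, Y z] :=
      funext fun z => h.smul_right z _ _ _
    have hd := D.isCovariantDerivativeOnUniv.leibniz hY hf
    have hd' : D (f • Y) x v = f x • D Y x v + mvfderiv (𝓡 4) f x v • Y x := by
      rw [hd]; rfl
    simp only [covDerivAux]
    rw [e, mvfderiv_mul hf (hh.mdifferentiableAt_apply hX hY), hd', h.add_right, h.smul_right,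
      h.smul_right]
    have e3 : h x ![D X x v, (f • Y) x] = f x * h x ![D X x v, Y x] := h.smul_right x _ _ _
    rw [e3]
    simp
    ring
  add {Y Y'} hY hY' := by
    have e : (fun z => h z ![X z, (Y + Y') z]) = (fun z => h z ![X z, Y z]) + fun z => h z ![X z, Y' z] :=
      funext fun z => h.add_right z _ _ _
    have hd := D.isCovariantDerivativeOnUniv.add hY hY'
    have hd' : D (Y + Y') x v = D Y x v + D Y' x v := by
      rw [hd]; rfl
    simp only [covDerivAux]
    rw [e, mvfderiv_add (hh.mdifferentiableAt_apply hX hY) (hh.mdifferentiableAt_apply hX hY'),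
      hd', h.add_right]
    have e3 : h x ![D X x v, (Y + Y') x] = h x ![D X x v, Y x] + h x ![D X x v, Y' x] :=
      h.add_right x _ _ _
    rw [e3]
    simp
    ring

lemma covDerivAux_linear (x : M) (X Y : Π z : M, TangentSpace (𝓡 4) z) (c : ℝ)
    (v v' : TangentSpace (𝓡 4) x) :
    covDerivAux D h x (v + v') X Y = covDerivAux D h x v X Y + covDerivAux D h x v' X Y ∧
    covDerivAux D h x (c • v) X Y = c * covDerivAux D h x v X Y := by
  constructor
  · simp only [covDerivAux, map_add, h.add_left, h.add_right]; ring
  · simp only [covDerivAux, map_smul, h.smul_left, h.smul_right, smul_eq_mul]; ring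

/-- The covariant derivative of a smooth rank two covariant tensor field, as a tensor field. -/
def covDerivTensor (hh : h.Smooth) : Cov M 3 := fun x =>
  { toFun := fun w => TensorialAt.mkHom₂ (covDerivAux D h x (w 0)) x
      (fun Y hY => covDerivAux_tensorial_left D hh x _ Y hY)
      (fun X hX => covDerivAux_tensorial_right D hh x _ X hX) (w 1) (w 2)
    map_update_add' := by
      intro inst w i v v'
      obtain rfl : inst = instDecidableEqFin 3 := Subsingleton.elim _ _
      obtain rfl | rfl | rfl : i = 0 ∨ i = 1 ∨ i = 2 := by omega
      · simp only [TensorialAt.mkHom₂_apply_eq_extend]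
        exact (covDerivAux_linear D x _ _ 0 v v').1
      · exact ContinuousLinearMap.map_add₂ _ v v' (w 2)
      · exact ContinuousLinearMap.map_add _ v v'
    map_update_smul' := by
      intro inst w i c v
      obtain rfl : inst = instDecidableEqFin 3 := Subsingleton.elim _ _
      obtain rfl | rfl | rfl : i = 0 ∨ i = 1 ∨ i = 2 := by omega
      · simp only [TensorialAt.mkHom₂_apply_eq_extend]
        exact (covDerivAux_linear D x _ _ c v v).2
      · exact ContinuousLinearMap.map_smul₂ _ c v (w 2)
      · exact ContinuousLinearMap.map_smul _ c v }

lemma covDerivTensor_comp [IsManifold (𝓡 4) ∞ M] (hh : h.Smooth) {φ : Chart M} (hφ : φ ∈ charts M)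
    {x : M}
    (hx : x ∈ φ.source) (i : Fin 3 → Fin 4) :
    (covDerivTensor D hh).comp φ x i = covDeriv D h φ x i := by
  have hX : ∀ a, MDifferentiableAt (𝓡 4) ((𝓡 4).prod 𝓘(ℝ, E4))
      (fun z => (⟨z, coordVec φ a z⟩ : TotalSpace E4 (TangentSpace (𝓡 4) : M → Type _))) x := fun a =>
    (contMDiffAt_coordVec hφ hx a).mdifferentiableAt (by simp)
  have h1 : (covDerivTensor D hh).comp φ x i
      = covDerivAux D h x (coordVec φ (i 0) x) (coordVec φ (i 1)) (coordVec φ (i 2)) :=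
    TensorialAt.mkHom₂_apply _ _ (hX (i 1)) (hX (i 2))
  have h2 : (fun z => h.comp φ z ![i 1, i 2])
      = fun z => h z ![coordVec φ (i 1) z, coordVec φ (i 2) z] :=
    funext fun z => (h.bilin_coordVec φ z _ _).symm
  rw [h1, covDeriv, h2, pd_eq_mvfderiv hφ hx _ (hh.mdifferentiableAt_apply (hX _) (hX _))]
  rfl

end

section

open Filter Bundle

/-! ### Connection coefficients -/

variable {M : Type*} [TopologicalSpace M] [ChartedSpace E4 M]

/-- The connection coefficients `Γ^d_{ca}` of `D` in a chart: `D_{∂_c} ∂_a = Γ^d_{ca} ∂_d`. -/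
def connCoeff [IsManifold (𝓡 4) ∞ M] (D : Connection M) (φ : Chart M) (d c a : Fin 4) (x : M) : ℝ :=
  coordForm φ d x (D (coordVec φ a) x (coordVec φ c x))

lemma covDeriv_eq [IsManifold (𝓡 4) ∞ M] (D : Connection M) (h : Cov M 2) {φ : Chart M}
    (hφ : φ ∈ charts M) {x : M}
    (hx : x ∈ φ.source) (c a b : Fin 4) :
    covDeriv D h φ x ![c, a, b] = pd φ c (fun z => h.comp φ z ![a, b]) x
      - ∑ d, connCoeff D φ d c a x * h.comp φ x ![d, b]
      - ∑ d, connCoeff D φ d c b x * h.comp φ x ![a, d] := by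
  have h1 : h x ![D (coordVec φ a) x (coordVec φ c x), coordVec φ b x]
      = ∑ d, connCoeff D φ d c a x * h.comp φ x ![d, b] := by
    rw [h.eq_sum_comp hφ hx]
    simp only [coordForm_coordVec hφ hx]
    simp [connCoeff]
  have h2 : h x ![coordVec φ a x, D (coordVec φ b) x (coordVec φ c x)]
      = ∑ d, connCoeff D φ d c b x * h.comp φ x ![a, d] := by
    rw [h.eq_sum_comp hφ hx, Finset.sum_comm]
    simp only [coordForm_coordVec hφ hx]
    simp [connCoeff]
  rw [← h1, ← h2]
  rfl

variable [T2Space M]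

lemma continuousAt_connCoeff [IsManifold (𝓡 4) ∞ M] {D : Connection M}
    (hD : D.ContMDiffCovariantDerivative ∞)
    {φ : Chart M} (hφ : φ ∈ charts M) {x : M} (hx : x ∈ φ.source) (d c a : Fin 4) :
    ContinuousAt (connCoeff D φ d c a) x := by
  -- A cut-off of `∂_a` is a globally smooth vector field.
  obtain ⟨χ, hχ, -⟩ := (SmoothBumpFunction.nhds_basis_support (I := 𝓡 4)
    (φ.open_source.mem_nhds hx)).mem_iff.mp (φ.open_source.mem_nhds hx)
  set X : Π z : M, TangentSpace (𝓡 4) z := fun z => χ z • coordVec φ a z with hX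
  have hXs : ContMDiff (𝓡 4) ((𝓡 4).prod 𝓘(ℝ, E4)) ∞
      (fun z => (⟨z, X z⟩ : TotalSpace E4 (TangentSpace (𝓡 4) : M → Type _))) := by
    intro z
    by_cases hz : z ∈ tsupport χ
    · exact ContMDiffAt.smul_section χ.contMDiffAt (contMDiffAt_coordVec hφ (hχ hz) a)
    · refine (contMDiff_zeroSection ℝ (TangentSpace (𝓡 4) : M → Type _)).contMDiffAt
        |>.congr_of_eventuallyEq ?_
      filter_upwards [(isClosed_tsupport χ).isOpen_compl.mem_nhds hz] with w hw
      have : χ w = 0 := image_eq_zero_of_notMem_tsupport hw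
      simp only [hX, this, zero_smul]
      rfl
  have hDX := hD.contMDiff.contMDiff (σ := X) hXs.contMDiffOn
  have hDX' := (hDX x trivial).contMDiffAt univ_mem
  have h1 := ContMDiffAt.clm_bundle_apply (E₁ := (TangentSpace (𝓡 4) : M → Type _))
    (E₂ := (TangentSpace (𝓡 4) : M → Type _)) (b := fun z => z) hDX'
    (contMDiffAt_coordVec hφ hx c)
  have h2 := (contMDiffAt_coordForm hφ hx h1 d).continuousAt
  refine h2.congr ?_
  filter_upwards [χ.eventuallyEq_one.eventually_nhds, φ.open_source.mem_nhds hx] with z hz hzφ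
  have h3 : D X z = D (coordVec φ a) z := by
    refine D.isCovariantDerivativeOnUniv.congr_of_eventuallyEq
      ((hXs z).mdifferentiableAt (by simp))
      ((contMDiffAt_coordVec hφ hzφ a).mdifferentiableAt (by simp)) univ_mem ?_
    filter_upwards [hz] with w hw
    simp [hX, hw]
  rw [connCoeff, ← h3]

end

section

open Filter Bundle

/-! ### Products of tensor fields -/

variable {M : Type*} [TopologicalSpace M] [ChartedSpace E4 M]

/-- The tensor product of two covariant tensor fields; `e` says which slot of the product is which
slot of the factors. -/
def Cov.tmul {m n k : ℕ} (e : Fin m ⊕ Fin n ≃ Fin k) (A : Cov M m) (B : Cov M n) : Cov M k :=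
  fun x => (LinearMap.mul' ℝ ℝ).compMultilinearMap
    ((MultilinearMap.domCoprod (A x) (B x)).domDomCongr e)

lemma Cov.tmul_comp {m n k : ℕ} (e : Fin m ⊕ Fin n ≃ Fin k) (A : Cov M m) (B : Cov M n)
    (φ : Chart M) (x : M) (i : Fin k → Fin 4) :
    (Cov.tmul e A B).comp φ x i
      = A.comp φ x (fun l => i (e (Sum.inl l))) * B.comp φ x (fun l => i (e (Sum.inr l))) := rfl

/-- The slots of `h_{ef} T_{ab}`. -/
def slots22 : Fin 2 ⊕ Fin 2 ≃ Fin 4 :=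
  Equiv.ofBijective (Sum.elim ![0, 1] ![2, 3]) (by decide)

/-- The slots of `∇_a h_{cd} ∇_b h_{ef}`. -/
def slots33 : Fin 3 ⊕ Fin 3 ≃ Fin 6 :=
  Equiv.ofBijective (Sum.elim ![0, 2, 3] ![1, 4, 5]) (by decide)

lemma tmul_slots22_comp (A B : Cov M 2) (φ : Chart M) (x : M) (i : Fin 4 → Fin 4) :
    (Cov.tmul slots22 A B).comp φ x i
      = A.comp φ x ![i 0, i 1] * B.comp φ x ![i 2, i 3] := by
  rw [Cov.tmul_comp]
  congr 2 <;> (funext l; fin_cases l <;> rfl)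

lemma tmul_slots33_comp (A B : Cov M 3) (φ : Chart M) (x : M) (i : Fin 6 → Fin 4) :
    (Cov.tmul slots33 A B).comp φ x i
      = A.comp φ x ![i 0, i 2, i 3] * B.comp φ x ![i 1, i 4, i 5] := by
  rw [Cov.tmul_comp]
  congr 2 <;> (funext l; fin_cases l <;> rfl)

lemma contract_congr {k : ℕ} (f : Con M k) {A B : Comp M k} {x : M}
    (h : ∀ i, A (chartAt E4 x) x i = B (chartAt E4 x) x i) : contract f A x = contract f B x :=
  Finset.sum_congr rfl fun i _ => by rw [h i]

end

section

open Filter Bundle Set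

/-! ### The volume measure in a chart -/

variable {M : Type*} [TopologicalSpace M] [ChartedSpace E4 M]

/-- The density `√|det g_{ab}|` of the volume measure in a chart. -/
def volDensity (g : Cov M 2) (φ : Chart M) (y : E4) : ℝ :=
  Real.sqrt |(metricMatrix g φ (φ.symm y)).det|

lemma volDensity_nonneg (g : Cov M 2) (φ : Chart M) (y : E4) : 0 ≤ volDensity g φ y :=
  Real.sqrt_nonneg _

/-- The chart measure `√|det g_{ab}| d^4x` on `M`. -/
def chartMeasure [MeasurableSpace M] (g : Cov M 2) (φ : Chart M) : Measure M :=
  (((volume : Measure E4).restrict φ.target).withDensity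
      (fun y => ENNReal.ofReal (volDensity g φ y))).map φ.symm

lemma aemeasurable_symm [MeasurableSpace M] [BorelSpace M] (g : Cov M 2) (φ : Chart M) :
    AEMeasurable φ.symm (((volume : Measure E4).restrict φ.target).withDensity
      (fun y => ENNReal.ofReal (volDensity g φ y))) :=
  (φ.continuousOn_symm.aemeasurable φ.open_target.measurableSet).mono_ac
    (withDensity_absolutelyContinuous _ _)

lemma measurableSet_image_chart [MeasurableSpace M] [BorelSpace M] (φ : Chart M)
    {S : Set M} (hS : MeasurableSet S) : MeasurableSet (φ '' (φ.source ∩ S)) := by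
  rw [φ.image_source_inter_eq' S]
  obtain ⟨t, ht, he⟩ := (φ.continuousOn_symm.domRestrict.measurable hS)
  have : φ.target ∩ φ.symm ⁻¹' S = φ.target ∩ t := by
    ext y
    constructor
    · rintro ⟨hy, hyS⟩
      exact ⟨hy, (Set.ext_iff.mp he ⟨y, hy⟩).mpr hyS⟩
    · rintro ⟨hy, hyS⟩
      exact ⟨hy, (Set.ext_iff.mp he ⟨y, hy⟩).mp hyS⟩
  rw [this]
  exact φ.open_target.measurableSet.inter ht

lemma chartMeasure_apply [MeasurableSpace M] [BorelSpace M] (g : Cov M 2) (φ : Chart M)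
    {S : Set M} (hS : MeasurableSet S) :
    chartMeasure g φ S = ∫⁻ y in φ '' (φ.source ∩ S), ENNReal.ofReal (volDensity g φ y) := by
  rw [chartMeasure, Measure.map_apply_of_aemeasurable (aemeasurable_symm g φ) hS,
    φ.image_source_inter_eq' S, withDensity_apply',
    Measure.restrict_restrict' φ.open_target.measurableSet, inter_comm]

lemma metricMatrix_change (g : Cov M 2) {φ ψ : Chart M} (hφ : φ ∈ charts M) {x : M}
    (hx : x ∈ φ.source) :
    metricMatrix g ψ x = Matrix.of (jac φ ψ x) * metricMatrix g φ x
      * (Matrix.of (jac φ ψ x)).transpose := by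
  ext a b
  rw [metricMatrix, Matrix.of_apply, ← Cov.bilin_coordVec, Cov.bilin_apply,
    g.eq_sum_comp hφ hx]
  simp only [Matrix.mul_apply, Matrix.transpose_apply, Matrix.of_apply, metricMatrix, jac,
    Finset.sum_mul]
  rw [Finset.sum_comm]
  exact Finset.sum_congr rfl fun c _ => Finset.sum_congr rfl fun d _ => by ring

lemma hasFDerivAt_transition {φ ψ : Chart M} (hφ : φ ∈ charts M) (hψ : ψ ∈ charts M) {y : E4}
    (hy : y ∈ ψ.target) (hy' : ψ.symm y ∈ φ.source) :
    HasFDerivAt (fun z => φ (ψ.symm z)) (fderiv ℝ (fun z => φ (ψ.symm z)) y) y ∧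
    |(fderiv ℝ (fun z => φ (ψ.symm z)) y).det|
      = |(Matrix.of (jac φ ψ (ψ.symm y))).det| := by
  have hs : MDifferentiableAt 𝓘(ℝ, E4) (𝓡 4) ψ.symm y :=
    (mem_charts_mdifferentiable hψ).mdifferentiableAt_symm hy
  have hf : MDifferentiableAt (𝓡 4) 𝓘(ℝ, E4) φ (ψ.symm y) :=
    (mem_charts_mdifferentiable hφ).mdifferentiableAt hy'
  have hd : DifferentiableAt ℝ (fun z => φ (ψ.symm z)) y :=
    (MDifferentiableAt.comp (I := 𝓘(ℝ, E4)) (I' := 𝓡 4) (I'' := 𝓘(ℝ, E4)) y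
      (g := φ) (f := ψ.symm) hf hs).differentiableAt
  refine ⟨hd.hasFDerivAt, ?_⟩
  have h1 := mfderiv_comp (I := 𝓘(ℝ, E4)) (I' := 𝓡 4) (I'' := 𝓘(ℝ, E4)) (g := φ) (f := ψ.symm)
    y hf hs
  rw [mfderiv_eq_fderiv] at h1
  have h2 : ∀ a b, (fderiv ℝ (fun z => φ (ψ.symm z)) y (stdVec a)) b = jac φ ψ (ψ.symm y) a b := by
    intro a b
    have h3 := congrArg (fun L : E4 →L[ℝ] E4 => L (stdVec a) b) h1
    refine h3.trans ?_
    rw [jac, coordVec, ψ.right_inv hy]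
    rfl
  have h4 : LinearMap.toMatrix (EuclideanSpace.basisFun (Fin 4) ℝ).toBasis
      (EuclideanSpace.basisFun (Fin 4) ℝ).toBasis
      (fderiv ℝ (fun z => φ (ψ.symm z)) y : E4 →ₗ[ℝ] E4)
      = (Matrix.of (jac φ ψ (ψ.symm y))).transpose := by
    ext b a
    rw [LinearMap.toMatrix_apply]
    simpa [stdVec] using h2 a b
  rw [← Matrix.det_transpose, ← h4, LinearMap.det_toMatrix]

lemma volDensity_change (g : Cov M 2) {φ ψ : Chart M} (hφ : φ ∈ charts M) (hψ : ψ ∈ charts M)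
    {y : E4} (hy : y ∈ ψ.target) (hy' : ψ.symm y ∈ φ.source) :
    volDensity g ψ y = |(fderiv ℝ (fun z => φ (ψ.symm z)) y).det|
      * volDensity g φ (φ (ψ.symm y)) := by
  rw [(hasFDerivAt_transition hφ hψ hy hy').2, volDensity, volDensity, φ.left_inv hy',
    metricMatrix_change g (φ := φ) (ψ := ψ) hφ hy', Matrix.det_mul, Matrix.det_mul,
    Matrix.det_transpose, abs_mul, abs_mul,
    show ∀ p q : ℝ, p * q * p = p ^ 2 * q from fun p q => by ring,
    Real.sqrt_mul (by positivity), Real.sqrt_sq (abs_nonneg _)]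

variable [MeasurableSpace M] [BorelSpace M]

/-- The chart measures of two charts agree on the common domain. -/
lemma chartMeasure_overlap (g : Cov M 2) {φ ψ : Chart M} (hφ : φ ∈ charts M) (hψ : ψ ∈ charts M)
    {S : Set M} (hS : MeasurableSet S) (h1 : S ⊆ φ.source) (h2 : S ⊆ ψ.source) :
    chartMeasure g φ S = chartMeasure g ψ S := by
  have hm : MeasurableSet (ψ '' S) := by
    have := measurableSet_image_chart ψ hS
    rwa [inter_eq_right.mpr h2] at this
  have himg : φ '' S = (fun z => φ (ψ.symm z)) '' (ψ '' S) := by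
    rw [image_image]
    exact image_congr fun x hx => by rw [ψ.left_inv (h2 hx)]
  rw [chartMeasure_apply g φ hS, chartMeasure_apply g ψ hS, inter_eq_right.mpr h1,
    inter_eq_right.mpr h2, himg]
  have ht : ∀ y ∈ ψ '' S, y ∈ ψ.target ∧ ψ.symm y ∈ φ.source := by
    rintro _ ⟨x, hx, rfl⟩
    exact ⟨ψ.map_source (h2 hx), by rw [ψ.left_inv (h2 hx)]; exact h1 hx⟩
  rw [lintegral_image_eq_lintegral_abs_det_fderiv_mul volume hm
    (fun y hy => (hasFDerivAt_transition hφ hψ (ht y hy).1 (ht y hy).2).1.hasFDerivWithinAt)]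
  · refine setLIntegral_congr_fun hm fun y hy => ?_
    rw [volDensity_change g hφ hψ (ht y hy).1 (ht y hy).2, ENNReal.ofReal_mul (abs_nonneg _)]
  · rintro _ ⟨x, hx, rfl⟩ _ ⟨x', hx', rfl⟩ h
    simp only [ψ.left_inv (h2 hx), ψ.left_inv (h2 hx')] at h
    rw [φ.injOn (h1 hx) (h1 hx') h]

lemma chartMeasure_source_compl (g : Cov M 2) (φ : Chart M) :
    chartMeasure g φ φ.sourceᶜ = 0 := by
  rw [chartMeasure_apply g φ φ.open_source.measurableSet.compl, inter_compl_self, image_empty]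
  simp

variable [SecondCountableTopology M]

/-- On the domain of a chart, the volume measure is the chart measure. -/
lemma volumeMeasure_apply [IsManifold (𝓡 4) ∞ M] (g : Cov M 2) {φ : Chart M} (hφ : φ ∈ charts M)
    {S : Set M} (hS : MeasurableSet S) (hSφ : S ⊆ φ.source) :
    volumeMeasure g S = chartMeasure g φ S := by
  rcases isEmpty_or_nonempty M with hM | hM
  · rw [Measure.eq_zero_of_isEmpty (volumeMeasure g), Measure.eq_zero_of_isEmpty (chartMeasure g φ)]
  have hvol : volumeMeasure g = ⨆ ψ ∈ charts M, chartMeasure g ψ := rfl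
  refine le_antisymm ?_ ?_
  · obtain ⟨s, hs, hcov⟩ := TopologicalSpace.countable_cover_nhds
      (fun x : M => chart_source_mem_nhds E4 x)
    have hsne : s.Nonempty := by
      by_contra h
      rw [not_nonempty_iff_eq_empty] at h
      simp [h] at hcov
      exact (Set.empty_ne_univ hcov)
    obtain ⟨p, rfl⟩ := hs.exists_eq_range hsne
    -- a countable atlas beginning with `φ`, and the corresponding partition of `M`
    set c : ℕ → Chart M := fun n => Nat.casesOn n φ fun k => chartAt E4 (p k) with hc
    have hcm : ∀ n, c n ∈ charts M := by
      rintro (_ | k)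
      · exact hφ
      · exact chartAt_mem_charts _
    set A : ℕ → Set M := disjointed fun n => (c n).source with hA
    have hAm : ∀ n, MeasurableSet (A n) :=
      MeasurableSet.disjointed fun n => (c n).open_source.measurableSet
    have hAs : ∀ n, A n ⊆ (c n).source := fun n => disjointed_subset _ n
    have hAU : ⋃ n, A n = univ := by
      rw [hA, iUnion_disjointed]
      refine eq_univ_of_univ_subset ?_
      rw [← hcov]
      simp only [biUnion_range]
      exact iUnion_subset fun k => subset_iUnion (fun n => (c n).source) (k + 1)
    have hAd : Pairwise (Function.onFun Disjoint A) := disjoint_disjointed _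
    have hle : volumeMeasure g ≤ Measure.sum fun n => (chartMeasure g (c n)).restrict (A n) := by
      rw [hvol]
      refine iSup₂_le fun ψ hψ => Measure.le_iff.mpr fun R hR => ?_
      have hψs := ψ.open_source.measurableSet
      have e1 : chartMeasure g ψ R = ∑' n, chartMeasure g ψ (R ∩ ψ.source ∩ A n) := by
        rw [← measure_iUnion (fun i j hij => (hAd hij).mono inter_subset_right inter_subset_right)
          (fun n => (hR.inter hψs).inter (hAm n)), ← inter_iUnion, hAU, inter_univ]
        refine le_antisymm ?_ (measure_mono inter_subset_left)
        calc chartMeasure g ψ R ≤ chartMeasure g ψ (R ∩ ψ.source ∪ ψ.sourceᶜ) :=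
              measure_mono fun x hx => by
                by_cases h : x ∈ ψ.source
                · exact Or.inl ⟨hx, h⟩
                · exact Or.inr h
          _ ≤ _ := (measure_union_le _ _).trans (by rw [chartMeasure_source_compl, add_zero])
      rw [e1, Measure.sum_apply _ hR]
      refine ENNReal.tsum_le_tsum fun n => ?_
      rw [Measure.restrict_apply hR, chartMeasure_overlap g hψ (hcm n)
        ((hR.inter hψs).inter (hAm n)) (fun x hx => hx.1.2) (fun x hx => hAs n hx.2)]
      exact measure_mono fun x hx => ⟨hx.1.1, hx.2⟩
    refine (hle S).trans ?_
    rw [Measure.sum_apply _ hS, tsum_eq_single 0]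
    · rw [Measure.restrict_apply hS]
      exact measure_mono inter_subset_left
    · intro n hn
      rw [Measure.restrict_apply hS]
      have h0 : A 0 = φ.source := disjointed_zero _
      have : S ∩ A n = ∅ := by
        have hd := hAd hn
        rw [Function.onFun, h0, Set.disjoint_left] at hd
        ext x
        simp only [mem_inter_iff, mem_empty_iff_false, iff_false, not_and]
        exact fun h1 h2 => hd h2 (hSφ h1)
      rw [this, measure_empty]
  · rw [hvol]
    exact le_iSup₂ (f := fun (ψ : Chart M) (_ : ψ ∈ charts M) => chartMeasure g ψ) φ hφ S

lemma volumeMeasure_restrict [IsManifold (𝓡 4) ∞ M] (g : Cov M 2) {φ : Chart M}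
    (hφ : φ ∈ charts M) :
    (volumeMeasure g).restrict φ.source = chartMeasure g φ := by
  ext S hS
  rw [Measure.restrict_apply hS, volumeMeasure_apply g hφ
    (hS.inter φ.open_source.measurableSet) inter_subset_right, chartMeasure_apply g φ hS,
    chartMeasure_apply g φ (hS.inter φ.open_source.measurableSet)]
  congr 2
  rw [inter_comm S, ← inter_assoc, inter_self]

lemma continuousOn_volDensity {g : Cov M 2} (hg : g.Smooth) {φ : Chart M} (hφ : φ ∈ charts M) :
    ContinuousOn (volDensity g φ) φ.target := by
  have h1 : ContinuousOn (fun y => (metricMatrix g φ (φ.symm y)).det) φ.target := by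
    simp only [Matrix.det_apply]
    refine continuousOn_finsetSum _ fun σ _ => ContinuousOn.const_smul
      (continuousOn_finsetProd _ fun i _ => (hg φ hφ _).continuousOn) _
  exact h1.abs.sqrt

/-- Integration in a chart. -/
lemma integral_volumeMeasure [IsManifold (𝓡 4) ∞ M] {g : Cov M 2} (hg : g.Smooth) {φ : Chart M}
    (hφ : φ ∈ charts M)
    {F : M → ℝ} (hF : ∀ x, x ∉ φ.source → F x = 0)
    (hFc : ContinuousOn (fun y => F (φ.symm y)) φ.target) :
    ∫ x, F x ∂(volumeMeasure g) = ∫ y in φ.target, F (φ.symm y) * volDensity g φ y ∧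
    (IntegrableOn (fun y => F (φ.symm y) * volDensity g φ y) φ.target →
      Integrable F (volumeMeasure g)) := by
  have hFc' : ContinuousOn F φ.source := by
    refine (hFc.comp φ.continuousOn φ.mapsTo).congr fun x hx => ?_
    simp [φ.left_inv hx]
  have hd := (continuousOn_volDensity hg hφ).aemeasurable φ.open_target.measurableSet
    (μ := (volume : Measure E4))
  have hmeas : AEStronglyMeasurable F (chartMeasure g φ) := by
    rw [← volumeMeasure_restrict g hφ]
    exact hFc'.aestronglyMeasurable φ.open_source.measurableSet
  have htoReal : ∀ y, (ENNReal.ofReal (volDensity g φ y)).toReal • F (φ.symm y)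
      = F (φ.symm y) * volDensity g φ y := fun y => by
    rw [ENNReal.toReal_ofReal (volDensity_nonneg g φ y), smul_eq_mul, mul_comm]
  constructor
  · rw [← setIntegral_eq_integral_of_forall_compl_eq_zero hF, volumeMeasure_restrict g hφ,
      chartMeasure, integral_map (aemeasurable_symm g φ) hmeas,
      integral_withDensity_eq_integral_toReal_smul₀ hd.ennreal_ofReal (by simp)]
    simp only [htoReal]
  · intro hi
    rw [← integrableOn_iff_integrable_of_support_subset (s := φ.source)
      (fun x hx => by_contra fun h => hx (hF x h)), IntegrableOn, volumeMeasure_restrict g hφ,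
      chartMeasure, integrable_map_measure hmeas (aemeasurable_symm g φ),
      integrable_withDensity_iff_integrable_smul₀' hd.ennreal_ofReal (by simp)]
    simp only [Function.comp, htoReal]
    exact hi

end

section

open Filter Bundle Set
open scoped MatrixOrder

/-! ### Component bounds from tensor norms -/

/-- A product over slots of linear changes of basis composes slotwise. -/
lemma sum_prod_mul_prod {k : ℕ} (P Q : Matrix (Fin 4) (Fin 4) ℝ) (i j : Fin k → Fin 4) :
    ∑ m : Fin k → Fin 4, (∏ l, P (i l) (m l)) * (∏ l, Q (m l) (j l))
      = ∏ l, (P * Q) (i l) (j l) := by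
  simp only [← Finset.prod_mul_distrib, Matrix.mul_apply, Finset.prod_univ_sum,
    Fintype.piFinset_univ]

lemma quad_eq_sum_sq {k : ℕ} (B : Matrix (Fin 4) (Fin 4) ℝ) (A : (Fin k → Fin 4) → ℝ) :
    ∑ p : Fin k → Fin 4, ∑ q : Fin k → Fin 4, (∏ l, (B.transpose * B) (p l) (q l)) * A p * A q
      = ∑ m : Fin k → Fin 4, (∑ j : Fin k → Fin 4, (∏ l, B (m l) (j l)) * A j) ^ 2 := by
  simp only [← sum_prod_mul_prod, sq, Finset.sum_mul, Finset.mul_sum]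
  rw [Finset.sum_congr rfl fun p _ => Finset.sum_comm, Finset.sum_comm]
  refine Finset.sum_congr rfl fun m _ => Finset.sum_congr rfl fun p _ =>
    Finset.sum_congr rfl fun q _ => ?_
  simp only [Matrix.transpose_apply]
  ring

/-- For a positive definite `E = BᵀB` the square of a component is controlled by the norm: this is
the Cauchy–Schwarz inequality in the frame given by `B`. -/
lemma sq_le_of_factor {k : ℕ} {B D : Matrix (Fin 4) (Fin 4) ℝ} (hDB : D * B = 1)
    (A : (Fin k → Fin 4) → ℝ) (i : Fin k → Fin 4) :
    (A i) ^ 2 ≤ (∏ l, (D * D.transpose) (i l) (i l)) *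
      ∑ m : Fin k → Fin 4, (∑ j : Fin k → Fin 4, (∏ l, B (m l) (j l)) * A j) ^ 2 := by
  have h1 : A i = ∑ m : Fin k → Fin 4, (∏ l, D (i l) (m l)) *
      ∑ j : Fin k → Fin 4, (∏ l, B (m l) (j l)) * A j := by
    simp only [Finset.mul_sum, ← mul_assoc]
    rw [Finset.sum_comm]
    simp only [← Finset.sum_mul, sum_prod_mul_prod, hDB, Matrix.one_apply]
    have : ∀ j : Fin k → Fin 4, (∏ l, if i l = j l then (1 : ℝ) else 0) = if i = j then 1 else 0 :=
      fun j => by rw [prod_ite_eq]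
    simp [this]
  have h3 : ∏ l, (D * D.transpose) (i l) (i l) = ∑ m : Fin k → Fin 4, (∏ l, D (i l) (m l)) ^ 2 := by
    rw [← sum_prod_mul_prod]
    simp [Matrix.transpose_apply, sq]
  rw [h3]
  conv_lhs => rw [h1]
  exact Finset.sum_mul_sq_le_sq_mul_sq _ _ _

variable {M : Type*} [TopologicalSpace M] [ChartedSpace E4 M]

lemma IsRiemannian.posDef {e : Cov M 2} (he : IsRiemannian e) {φ : Chart M} (hφ : φ ∈ charts M)
    {x : M} (hx : x ∈ φ.source) : (metricMatrix e φ x).PosDef := by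
  have hsymm : (metricMatrix e φ x).IsHermitian := by
    ext a b
    simp only [Matrix.conjTranspose_apply, metricMatrix, Matrix.of_apply, star_trivial]
    rw [← e.bilin_coordVec, ← e.bilin_coordVec]
    exact he.2.1 x _ _
  refine Matrix.PosDef.of_dotProduct_mulVec_pos hsymm fun v hv => ?_
  set w : TangentSpace (𝓡 4) x := ∑ a, v a • coordVec φ a x with hw
  have hwc : ∀ a, coordForm φ a x w = v a := by
    intro a
    rw [hw, map_sum]
    simp [coordForm_coordVec hφ hx]
  have hw0 : w ≠ 0 := by
    intro h
    refine hv (funext fun a => ?_)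
    rw [← hwc a, h, map_zero]
    rfl
  have := he.2.2 x w hw0
  rw [e.eq_sum_comp hφ hx] at this
  simp only [hwc] at this
  refine this.trans_eq ?_
  simp only [dotProduct, Matrix.mulVec, Finset.mul_sum, metricMatrix, Matrix.of_apply,
    star_trivial, Pi.star_apply]
  exact Finset.sum_congr rfl fun a _ => Finset.sum_congr rfl fun b _ => by ring

lemma sq_le_tensorNorm {e : Cov M 2} (he : IsRiemannian e) {φ : Chart M} (hφ : φ ∈ charts M)
    {x : M} (hx : x ∈ φ.source) {k : ℕ} (A : Comp M k) (i : Fin k → Fin 4) :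
    (A φ x i) ^ 2 ≤ (∏ l, e.comp φ x ![i l, i l]) * tensorNorm e A φ x ^ 2 := by
  have hpos := he.posDef hφ hx
  obtain ⟨B, hB⟩ := CStarAlgebra.nonneg_iff_eq_star_mul_self.mp hpos.inv.posSemidef.nonneg
  rw [Matrix.star_eq_conjTranspose, Matrix.conjTranspose_eq_transpose_of_trivial] at hB
  have hu : IsUnit (metricMatrix e φ x) := hpos.isUnit
  have h1 : metricMatrix e φ x * B.transpose * B = 1 := by
    rw [Matrix.mul_assoc, ← hB]
    exact Matrix.mul_nonsing_inv _ ((Matrix.isUnit_iff_isUnit_det _).mp hu)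
  have h2 : B * (metricMatrix e φ x * B.transpose) = 1 := mul_eq_one_comm.mp h1
  set D := metricMatrix e φ x * B.transpose with hD
  have h3 : D * D.transpose = metricMatrix e φ x := by
    have : B.transpose * D.transpose = 1 := by
      rw [← Matrix.transpose_mul, h1, Matrix.transpose_one]
    rw [hD, Matrix.mul_assoc, ← hD, this, Matrix.mul_one]
  have h4 := sq_le_of_factor h1 (A φ x) i
  rw [h3, ← quad_eq_sum_sq] at h4
  rw [tensorNorm, Real.sq_sqrt]
  · rwa [inv, hB]
  · rw [inv, hB, quad_eq_sum_sq]
    positivity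

end

section

open Filter Bundle Set

/-! ### Test fields and weak limits in charts -/

variable {M : Type*} [TopologicalSpace M] [ChartedSpace E4 M]

/-- A metric whose matrix in every chart is invertible. -/
def Nondegenerate (g : Cov M 2) : Prop :=
  ∀ φ ∈ charts M, ∀ y ∈ φ.target, (metricMatrix g φ (φ.symm y)).det ≠ 0

lemma volDensity_pos {g : Cov M 2} (hg : Nondegenerate g) {φ : Chart M} (hφ : φ ∈ charts M)
    {y : E4} (hy : y ∈ φ.target) : 0 < volDensity g φ y :=
  Real.sqrt_pos.mpr (abs_pos.mpr (hg φ hφ y hy))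

lemma contDiffOn_volDensity {g : Cov M 2} (hg : g.Smooth) (hn : Nondegenerate g) {φ : Chart M}
    (hφ : φ ∈ charts M) : ContDiffOn ℝ ∞ (volDensity g φ) φ.target := by
  intro y hy
  have h1 : ContDiffAt ℝ ∞ (fun y => (metricMatrix g φ (φ.symm y)).det) y :=
    (contDiffOn_det (γ := fun y => metricMatrix g φ (φ.symm y))
      fun a b => hg φ hφ ![a, b]).contDiffAt (φ.open_target.mem_nhds hy)
  have h2 := (contDiffAt_abs (n := (⊤ : ℕ∞)) (hn φ hφ y hy)).comp y h1
  exact (h2.sqrt (abs_pos.mpr (hn φ hφ y hy)).ne').contDiffWithinAt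

lemma contMDiffAt_jac [IsManifold (𝓡 4) ∞ M] {φ ψ : Chart M} (hφ : φ ∈ charts M)
    (hψ : ψ ∈ charts M) {x : M}
    (hx : x ∈ φ.source) (hx' : x ∈ ψ.source) (a b : Fin 4) :
    ContMDiffAt (𝓡 4) 𝓘(ℝ, ℝ) ∞ (fun z => jac φ ψ z a b) x :=
  contMDiffAt_coordForm hφ hx (contMDiffAt_coordVec hψ hx' a) b

/-- The components of `f` in a chart times the volume density, extended by zero. -/
def weighted {k : ℕ} (g : Cov M 2) (φ : Chart M) (f : Con M k) (i : Fin k → Fin 4) : E4 → ℝ :=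
  φ.target.indicator fun y => f.comp φ (φ.symm y) i * volDensity g φ y

section

variable {k : ℕ} {g : Cov M 2} {φ : Chart M} {f : Con M k} {K : Set M} {U : Set E4}

lemma weighted_of_mem {y : E4} (hy : y ∈ φ.target) (i : Fin k → Fin 4) :
    weighted g φ f i y = f.comp φ (φ.symm y) i * volDensity g φ y :=
  indicator_of_mem hy _

lemma comp_eq_zero {x : M} (hx : f x = 0) (i : Fin k → Fin 4) : f.comp φ x i = 0 := by
  rw [Con.comp, hx]; rfl

lemma contract_eq_zero (A : Comp M k) {x : M} (hx : f x = 0) : contract f A x = 0 :=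
  Finset.sum_eq_zero fun i _ => by rw [comp_eq_zero hx, zero_mul]

lemma isTestOn_weighted (hg : g.Smooth) (hn : Nondegenerate g) (hφ : φ ∈ charts M)
    (hf : f.Smooth) (hK : IsCompact K) (hf0 : ∀ x, x ∉ K → f x = 0)
    (hKU : K ⊆ φ.source ∩ φ ⁻¹' U) (i : Fin k → Fin 4) : IsTestOn U (weighted g φ f i) := by
  have hK' : IsCompact (φ '' K) := hK.image_of_continuousOn
    (φ.continuousOn.mono fun x hx => (hKU hx).1)
  have h0 : ∀ y, y ∉ φ '' K → weighted g φ f i y = 0 := by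
    intro y hy
    by_cases hyt : y ∈ φ.target
    · rw [weighted_of_mem hyt, comp_eq_zero (hf0 _ fun h => hy ⟨_, h, φ.right_inv hyt⟩), zero_mul]
    · exact indicator_of_notMem hyt _
  have hsupp : tsupport (weighted g φ f i) ⊆ φ '' K :=
    closure_minimal (fun y hy => by_contra fun h => hy (h0 y h)) hK'.isClosed
  refine ⟨?_, HasCompactSupport.intro hK' h0, hsupp.trans ?_⟩
  · rw [contDiff_iff_contDiffAt]
    intro y
    by_cases hyt : y ∈ φ.target
    · have h1 : ContDiffAt ℝ ∞ (fun y => f.comp φ (φ.symm y) i * volDensity g φ y) y :=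
        ((hf φ hφ i).mul (contDiffOn_volDensity hg hn hφ)).contDiffAt (φ.open_target.mem_nhds hyt)
      refine h1.congr_of_eventuallyEq ?_
      filter_upwards [φ.open_target.mem_nhds hyt] with z hz
      exact weighted_of_mem hz i
    · have hy : y ∈ (φ '' K)ᶜ := by
        rintro ⟨x, hx, rfl⟩
        exact hyt (φ.map_source (hKU hx).1)
      refine (contDiffAt_const (c := (0 : ℝ))).congr_of_eventuallyEq ?_
      filter_upwards [hK'.isClosed.isOpen_compl.mem_nhds hy] with z hz
      exact h0 z hz
  · rintro _ ⟨x, hx, rfl⟩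
    exact (hKU hx).2

variable [MeasurableSpace M] [BorelSpace M] [SecondCountableTopology M]

/-- The pairing of a test field supported in a chart with a tensor field, as a sum of integrals
over coordinate space. -/
lemma integral_contract [IsManifold (𝓡 4) ∞ M] (hg : g.Smooth) (hn : Nondegenerate g)
    (hφ : φ ∈ charts M)
    (hf : f.Smooth) (hK : IsCompact K) (hf0 : ∀ x, x ∉ K → f x = 0)
    (hKU : K ⊆ φ.source ∩ φ ⁻¹' U) (hU : IsOpen U) (hUt : U ⊆ φ.target) {A : Cov M k}
    (hA : ∀ i, ContinuousOn (fun y => A.comp φ (φ.symm y) i) U) :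
    ∫ x, contract f A.comp x ∂(volumeMeasure g)
      = ∑ i, ∫ y, weighted g φ f i y * A.comp φ (φ.symm y) i ∧
    Integrable (fun x => contract f A.comp x) (volumeMeasure g) := by
  have hv := isTestOn_weighted hg hn hφ hf hK hf0 hKU
  have h1 : ∀ y ∈ φ.target, contract f A.comp (φ.symm y) * volDensity g φ y
      = ∑ i, weighted g φ f i y * A.comp φ (φ.symm y) i := by
    intro y hy
    rw [contract_eq f A hφ (φ.map_target hy), Finset.sum_mul]
    refine Finset.sum_congr rfl fun i _ => ?_
    rw [weighted_of_mem hy]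
    ring
  have hcont : Continuous fun y => ∑ i, weighted g φ f i y * A.comp φ (φ.symm y) i :=
    continuous_finsetSum _ fun i _ =>
      continuous_of_tsupport_subset hU (hv i).smooth.continuous (hv i).supp (hA i)
  have hint : ∀ i ∈ (Finset.univ : Finset (Fin k → Fin 4)),
      Integrable fun y => weighted g φ f i y * A.comp φ (φ.symm y) i :=
    fun i _ => (hv i).integrable hU (hA i)
  have hF0 : ∀ x, x ∉ φ.source → contract f A.comp x = 0 := fun x hx =>
    contract_eq_zero _ (hf0 x fun h => hx (hKU h).1)
  have hFc : ContinuousOn (fun y => contract f A.comp (φ.symm y)) φ.target := by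
    refine (hcont.continuousOn.div (continuousOn_volDensity hg hφ)
      fun y hy => (volDensity_pos hn hφ hy).ne').congr fun y hy => ?_
    rw [Pi.div_apply, ← h1 y hy, mul_div_cancel_right₀ _ (volDensity_pos hn hφ hy).ne']
  obtain ⟨h2, h3⟩ := integral_volumeMeasure hg hφ hF0 hFc
  constructor
  · rw [h2, setIntegral_congr_fun φ.open_target.measurableSet h1,
      setIntegral_eq_integral_of_forall_compl_eq_zero, integral_finsetSum _ hint]
    intro y hy
    refine Finset.sum_eq_zero fun i _ => ?_
    rw [weighted, indicator_of_notMem hy, zero_mul]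
  · exact h3 (((integrable_finsetSum _ hint).integrableOn).congr_fun (fun y hy => (h1 y hy).symm)
      φ.open_target.measurableSet)

end

/-- Weak convergence of all components in a chart, on a subset of coordinate space. -/
def ChartWk {k : ℕ} (φ : Chart M) (U : Set E4) (A : ℝ → Cov M k) (B : Cov M k) : Prop :=
  ∀ i, Wk U (fun s y => (A s).comp φ (φ.symm y) i) (fun y => B.comp φ (φ.symm y) i)

section

variable {k : ℕ} {g : Cov M 2} {φ : Chart M} {U : Set E4}

/-- The test field in a chart with a single component `u / √|det g|`. -/
def testField (g : Cov M 2) (φ : Chart M) (u : E4 → ℝ) (i : Fin k → Fin 4) : Con M k :=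
  open Classical in
  conOfComp φ fun x j => if x ∈ φ.source ∧ j = i then u (φ x) / volDensity g φ (φ x) else 0

lemma testField_eq_zero {u : E4 → ℝ} (i : Fin k → Fin 4) {x : M}
    (hx : x ∉ φ.symm '' tsupport u) : testField g φ u i x = 0 := by
  ext w
  rw [testField, conOfComp_apply]
  refine Finset.sum_eq_zero fun j _ => ?_
  split_ifs with h
  · rw [image_eq_zero_of_notMem_tsupport fun hu => hx ⟨_, hu, φ.left_inv h.1⟩]
    simp
  · simp

lemma testField_comp (hφ : φ ∈ charts M) (u : E4 → ℝ) (i j : Fin k → Fin 4) {x : M}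
    (hx : x ∈ φ.source) : (testField g φ u i).comp φ x j
      = if j = i then u (φ x) / volDensity g φ (φ x) else 0 := by
  rw [testField, conOfComp_comp hφ hx]
  simp [hx]

lemma isCompact_image_tsupport (hUt : U ⊆ φ.target) {u : E4 → ℝ} (hu : IsTestOn U u) :
    IsCompact (φ.symm '' tsupport u) :=
  hu.compact.isCompact.image_of_continuousOn
    (φ.continuousOn_symm.mono (hu.supp.trans hUt))

lemma image_tsupport_subset (hUt : U ⊆ φ.target) {u : E4 → ℝ} (hu : IsTestOn U u) :
    φ.symm '' tsupport u ⊆ φ.source ∩ φ ⁻¹' U := by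
  rintro _ ⟨y, hy, rfl⟩
  refine ⟨φ.map_target (hUt (hu.supp hy)), ?_⟩
  rw [mem_preimage, φ.right_inv (hUt (hu.supp hy))]
  exact hu.supp hy

lemma weighted_testField (hn : Nondegenerate g) (hφ : φ ∈ charts M) (hUt : U ⊆ φ.target)
    {u : E4 → ℝ} (hu : IsTestOn U u) (i j : Fin k → Fin 4) (y : E4) :
    weighted g φ (testField g φ u i) j y = if j = i then u y else 0 := by
  by_cases hy : y ∈ φ.target
  · rw [weighted_of_mem hy, testField_comp hφ _ _ _ (φ.map_target hy), φ.right_inv hy]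
    split_ifs
    · rw [div_mul_cancel₀ _ (volDensity_pos hn hφ hy).ne']
    · simp
  · rw [weighted, indicator_of_notMem hy,
      image_eq_zero_of_notMem_tsupport fun h => hy (hUt (hu.supp h))]
    simp

variable [T2Space M]

lemma testField_smooth [IsManifold (𝓡 4) ∞ M] (hg : g.Smooth) (hn : Nondegenerate g)
    (hφ : φ ∈ charts M)
    (hUt : U ⊆ φ.target) {u : E4 → ℝ} (hu : IsTestOn U u) (i : Fin k → Fin 4) :
    (testField g φ u i).Smooth := by
  intro ψ hψ j
  refine contDiffOn_chart hψ (u := fun x => (testField g φ u i).comp ψ x j) fun x hx => ?_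
  by_cases hxφ : x ∈ φ.source
  · have h1 : ContMDiffAt (𝓡 4) 𝓘(ℝ, ℝ) ∞ (fun z => (∏ l, jac ψ φ z (i l) (j l))
        * (u (φ z) / volDensity g φ (φ z))) x := by
      refine ContMDiffAt.mul (contMDiffAt_finsetProd fun l _ => contMDiffAt_jac hψ hφ hx hxφ _ _) ?_
      have h2 : ContMDiffAt 𝓘(ℝ, E4) 𝓘(ℝ, ℝ) ∞ (fun y => u y / volDensity g φ y) (φ x) :=
        (hu.smooth.contDiffAt.div ((contDiffOn_volDensity hg hn hφ).contDiffAt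
          (φ.open_target.mem_nhds (φ.map_source hxφ)))
          (volDensity_pos hn hφ (φ.map_source hxφ)).ne').contMDiffAt
      exact h2.comp x (contMDiffAt_of_mem_maximalAtlas hφ hxφ)
    refine h1.congr_of_eventuallyEq ?_
    filter_upwards [φ.open_source.mem_nhds hxφ] with z hz
    rw [Con.comp_change _ hφ hz]
    simp only [testField_comp hφ _ _ _ hz]
    simp
  · have hx' : x ∈ (φ.symm '' tsupport u)ᶜ := fun h => hxφ (image_tsupport_subset hUt hu h).1
    refine (contMDiffAt_const (c := (0 : ℝ))).congr_of_eventuallyEq ?_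
    filter_upwards [(isCompact_image_tsupport hUt hu).isClosed.isOpen_compl.mem_nhds hx'] with z hz
    exact comp_eq_zero (testField_eq_zero i hz) j

lemma isTest_testField [IsManifold (𝓡 4) ∞ M] (hg : g.Smooth) (hn : Nondegenerate g)
    (hφ : φ ∈ charts M)
    (hUt : U ⊆ φ.target) {u : E4 → ℝ} (hu : IsTestOn U u) (i : Fin k → Fin 4) :
    IsTest (testField g φ u i) :=
  ⟨testField_smooth hg hn hφ hUt hu i, _, isCompact_image_tsupport hUt hu,
    fun _ hx => testField_eq_zero i hx⟩

variable [MeasurableSpace M] [BorelSpace M] [SecondCountableTopology M]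

lemma integral_testField [IsManifold (𝓡 4) ∞ M] (hg : g.Smooth) (hn : Nondegenerate g)
    (hφ : φ ∈ charts M)
    (hU : IsOpen U) (hUt : U ⊆ φ.target) {u : E4 → ℝ} (hu : IsTestOn U u) (i : Fin k → Fin 4)
    {A : Cov M k} (hA : ∀ i, ContinuousOn (fun y => A.comp φ (φ.symm y) i) U) :
    ∫ x, contract (testField g φ u i) A.comp x ∂(volumeMeasure g)
      = ∫ y, u y * A.comp φ (φ.symm y) i := by
  rw [(integral_contract hg hn hφ (testField_smooth hg hn hφ hUt hu i)
    (isCompact_image_tsupport hUt hu) (fun _ hx => testField_eq_zero i hx)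
    (image_tsupport_subset hUt hu) hU hUt hA).1]
  simp only [weighted_testField hn hφ hUt hu]
  rw [Finset.sum_eq_single i]
  · simp
  · intro j _ hj
    simp [hj]
  · simp

/-- Weak convergence on the manifold gives weak convergence of components in charts. -/
lemma WeakLim.chartWk [IsManifold (𝓡 4) ∞ M] (hg : g.Smooth) (hn : Nondegenerate g)
    (hφ : φ ∈ charts M)
    (hU : IsOpen U) (hUt : U ⊆ φ.target) {A : ℝ → Comp M k} {A' : ℝ → Cov M k} {B : Cov M k}
    (h : WeakLim (volumeMeasure g) A B.comp)
    (hA : ∀ s, 0 < s → ∀ x i, A s (chartAt E4 x) x i = (A' s).comp (chartAt E4 x) x i)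
    (hAc : ∀ s, 0 < s → ∀ i, ContinuousOn (fun y => (A' s).comp φ (φ.symm y) i) U)
    (hBc : ∀ i, ContinuousOn (fun y => B.comp φ (φ.symm y) i) U) :
    ChartWk φ U A' B := by
  intro i
  refine ⟨fun s hs => hAc s hs i, hBc i, fun u hu => ?_⟩
  have h1 := h _ (isTest_testField hg hn hφ hUt hu i)
  rw [integral_testField hg hn hφ hU hUt hu i hBc] at h1
  refine h1.congr' ?_
  filter_upwards [eventually_pos] with s hs
  rw [← integral_testField hg hn hφ hU hUt hu i (hAc s hs)]
  exact integral_congr_ae (ae_of_all _ fun x => contract_congr _ fun i => hA s hs x i)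

/-- Test fields supported in the domain of chartwise weak convergence. -/
lemma ChartWk.tendsto [IsManifold (𝓡 4) ∞ M] (hg : g.Smooth) (hn : Nondegenerate g)
    (hφ : φ ∈ charts M)
    (hU : IsOpen U) (hUt : U ⊆ φ.target) {A : ℝ → Cov M k} {B : Cov M k} (h : ChartWk φ U A B)
    {f : Con M k} (hf : f.Smooth) {K : Set M} (hK : IsCompact K) (hf0 : ∀ x, x ∉ K → f x = 0)
    (hKU : K ⊆ φ.source ∩ φ ⁻¹' U) :
    Tendsto (fun s => ∫ x, contract f (A s).comp x ∂(volumeMeasure g)) (𝓝[>] 0)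
      (𝓝 (∫ x, contract f B.comp x ∂(volumeMeasure g))) := by
  rw [(integral_contract hg hn hφ hf hK hf0 hKU hU hUt fun i => (h i).contL).1]
  refine (tendsto_finsetSum _ fun i _ => (h i).lim _
    (isTestOn_weighted hg hn hφ hf hK hf0 hKU i)).congr' ?_
  filter_upwards [eventually_pos] with s hs
  rw [(integral_contract hg hn hφ hf hK hf0 hKU hU hUt fun i => (h i).cont s hs).1]

end

end

section

open Filter Bundle Set

/-! ### From charts to the manifold -/

variable {M : Type*} [TopologicalSpace M] [ChartedSpace E4 M] [T2Space M]
  [MeasurableSpace M] [BorelSpace M] [SecondCountableTopology M]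

variable {k : ℕ} {g : Cov M 2} {A : ℝ → Cov M k} {B B' : Cov M k}

/-- Weak limits obtained in two charts agree as tensors on the common domain. -/
lemma ChartWk.comp_eq [IsManifold (𝓡 4) ∞ M] (hg : g.Smooth) (hn : Nondegenerate g) {φ ψ : Chart M}
    (hφ : φ ∈ charts M) (hψ : ψ ∈ charts M) {U V : Set E4} (hU : IsOpen U) (hUt : U ⊆ φ.target)
    (hV : IsOpen V) (hVt : V ⊆ ψ.target) (h : ChartWk φ U A B) (h' : ChartWk ψ V A B') {x : M}
    (hx : x ∈ φ.source ∩ φ ⁻¹' U) (hx' : x ∈ ψ.source ∩ ψ ⁻¹' V) (i : Fin k → Fin 4) :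
    B.comp φ x i = B'.comp φ x i := by
  set U' : Set E4 := U ∩ (φ.target ∩ φ.symm ⁻¹' (ψ.source ∩ ψ ⁻¹' V)) with hU'
  have hO : IsOpen U' := hU.inter (φ.isOpen_inter_preimage_symm (ψ.isOpen_inter_preimage hV))
  have hU't : U' ⊆ φ.target := inter_subset_left.trans hUt
  have hc : ∀ j, ContinuousOn (fun y => B'.comp φ (φ.symm y) j) U' := by
    intro j y hy
    have hφs : ContinuousAt φ.symm y := φ.continuousAt_symm hy.2.1
    have h1 : ContinuousAt (fun z => ∑ l : Fin k → Fin 4, (∏ m, jac ψ φ z (j m) (l m))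
        * B'.comp ψ (ψ.symm (ψ z)) l) (φ.symm y) := by
      refine tendsto_finsetSum _ fun l _ => Tendsto.mul ?_ ?_
      · exact tendsto_finsetProd _ fun m _ =>
          (contMDiffAt_jac hψ hφ hy.2.2.1 (φ.map_target hy.2.1) _ _).continuousAt
      · exact ContinuousAt.comp (g := fun w => B'.comp ψ (ψ.symm w) l) (f := ψ)
          ((h' l).contL.continuousAt (hV.mem_nhds hy.2.2.2)) (ψ.continuousAt hy.2.2.1)
    refine ((ContinuousAt.comp (f := φ.symm) h1 hφs).congr ?_).continuousWithinAt
    filter_upwards [hO.mem_nhds hy] with w hw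
    rw [B'.comp_change hψ hw.2.2.1, Function.comp]
    simp only [ψ.left_inv hw.2.2.1]
  have h1 : Wk U' (fun s y => (A s).comp φ (φ.symm y) i) (fun y => B'.comp φ (φ.symm y) i) := by
    refine ⟨fun s hs => ((h i).cont s hs).mono inter_subset_left, hc i, fun u hu => ?_⟩
    have h2 := h'.tendsto hg hn hψ hV hVt (testField_smooth hg hn hφ hU't hu i)
      (isCompact_image_tsupport hU't hu) (fun _ hx => testField_eq_zero i hx)
      ((image_tsupport_subset hU't hu).trans fun z hz => by
        have := hz.2.2.2
        rwa [mem_preimage, φ.left_inv hz.1] at this)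
    rw [integral_testField hg hn hφ hO hU't hu i hc] at h2
    refine h2.congr' ?_
    filter_upwards [eventually_pos] with s hs
    rw [integral_testField hg hn hφ hO hU't hu i fun j =>
      ((h j).cont s hs).mono inter_subset_left]
  have h3 : Wk U' (fun s y => (A s).comp φ (φ.symm y) i) (fun y => B.comp φ (φ.symm y) i) :=
    (h i).mono inter_subset_left
  have hφx : φ x ∈ U' := ⟨hx.2, φ.map_source hx.1, by
    rw [mem_preimage, φ.left_inv hx.1]; exact hx'⟩
  simpa [φ.left_inv hx.1] using h3.unique hO h1 (φ x) hφx

lemma contract_finset_sum {ι : Type*} (I : Finset ι) (F : ι → Con M k) (f : Con M k) (C : Comp M k)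
    {x : M} (hf : f x = ∑ i ∈ I, F i x) : contract f C x = ∑ i ∈ I, contract (F i) C x := by
  simp only [contract, Con.comp, hf, sum_apply, Finset.sum_mul]
  exact Finset.sum_comm

/-- Weak convergence may be checked locally in charts. -/
lemma weakLim_of_chartWk [IsManifold (𝓡 4) ∞ M] (hg : g.Smooth) (hn : Nondegenerate g)
    (h : ∀ x : M, ∃ φ ∈ charts M, ∃ U, IsOpen U ∧ U ⊆ φ.target ∧ x ∈ φ.source ∩ φ ⁻¹' U ∧
      ChartWk φ U A B) :
    WeakLim (volumeMeasure g) (fun s => (A s).comp) B.comp := by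
  rintro f ⟨hf, K, hK, hf0⟩
  choose φ hφ U hU hUt hxU hW using h
  have : LocallyCompactSpace M := ChartedSpace.locallyCompactSpace E4 M
  obtain ⟨χ, hχ⟩ := SmoothPartitionOfUnity.exists_isSubordinate (𝓡 4) isClosed_univ
    (fun x => (φ x).source ∩ φ x ⁻¹' U x) (fun x => (φ x).isOpen_inter_preimage (hU x))
    (fun x _ => mem_iUnion.mpr ⟨x, hxU x⟩)
  set I := (χ.locallyFinite.finite_nonempty_inter_compact hK).toFinset with hI
  set F : M → Con M k := fun i x => χ i x • f x with hF
  have hFs : ∀ i, (F i).Smooth := by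
    intro i ψ hψ j
    refine (ContDiffOn.mul (contDiffOn_chart hψ fun x _ => (χ i).contMDiff.contMDiffAt)
      (hf ψ hψ j)).congr fun y _ => ?_
    simp [Con.comp, hF]
  have hK' : ∀ i, IsCompact (K ∩ tsupport (χ i)) := fun i => hK.inter_right (isClosed_tsupport _)
  have hF0 : ∀ i x, x ∉ K ∩ tsupport (χ i) → F i x = 0 := by
    intro i x hx
    by_cases hxK : x ∈ K
    · simp [hF, image_eq_zero_of_notMem_tsupport fun h => hx ⟨hxK, h⟩]
    · simp [hF, hf0 x hxK]
  have hKU : ∀ i, K ∩ tsupport (χ i) ⊆ (φ i).source ∩ φ i ⁻¹' U i := fun i x hx => hχ i hx.2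
  have hsum : ∀ x, f x = ∑ i ∈ I, F i x := by
    intro x
    by_cases hxK : x ∈ K
    · have h1 : ∑ i ∈ I, χ i x = 1 := by
        rw [← χ.sum_eq_one (mem_univ x), finsum_eq_sum_of_support_subset]
        intro i hi
        rw [hI, Finite.coe_toFinset]
        exact ⟨x, hi, hxK⟩
      simp only [hF]
      rw [← Finset.sum_smul, h1, one_smul]
    · rw [hf0 x hxK]
      exact (Finset.sum_eq_zero fun i _ => hF0 i x fun h => hxK h.1).symm
  have hint : ∀ C : Cov M k, (∀ i j, ContinuousOn (fun y => C.comp (φ i) ((φ i).symm y) j) (U i)) →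
      ∫ x, contract f C.comp x ∂(volumeMeasure g)
        = ∑ i ∈ I, ∫ x, contract (F i) C.comp x ∂(volumeMeasure g) := by
    intro C hC
    simp only [contract_finset_sum I F f C.comp (hsum _)]
    exact integral_finsetSum _ fun i _ => (integral_contract hg hn (hφ i) (hFs i) (hK' i) (hF0 i)
      (hKU i) (hU i) (hUt i) (hC i)).2
  rw [hint B fun i j => (hW i j).contL]
  refine (tendsto_finsetSum I fun i _ => (hW i).tendsto hg hn (hφ i) (hU i) (hUt i) (hFs i)
    (hK' i) (hF0 i) (hKU i)).congr' ?_
  filter_upwards [eventually_pos] with s hs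
  rw [hint (A s) fun i j => (hW i j).cont s hs]

end

section

open Filter Bundle Set

variable {M : Type*} [TopologicalSpace M] [ChartedSpace E4 M]

/-! ### Lorentz metrics and their curvature in a chart -/

/-- The metric matrix of `g` as a function on coordinate space. -/
def chartMetric (g : Cov M 2) (φ : Chart M) (y : E4) : Mat4 := metricMatrix g φ (φ.symm y)

section

variable {g : Cov M 2} {φ : Chart M} {y : E4}

lemma pd_symm (a : Fin 4) (u : M → ℝ) (hy : y ∈ φ.target) :
    pd φ a u (φ.symm y) = pder a (fun z => u (φ.symm z)) y := by
  rw [pd, φ.right_inv hy, pder]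

lemma christoffel_symm (hy : y ∈ φ.target) (c a b : Fin 4) :
    christoffel g φ c a b (φ.symm y) = locChr (chartMetric g φ) c a b y := by
  simp only [christoffel, pd_symm _ _ hy]
  rfl

lemma ricci_symm (hy : y ∈ φ.target) (a b : Fin 4) :
    ricci g φ (φ.symm y) a b = locRic (chartMetric g φ) a b y := by
  have h : ∀ d c a b, pder d (fun z => christoffel g φ c a b (φ.symm z)) y
      = pder d (locChr (chartMetric g φ) c a b) y := fun d c a b =>
    pder_congr d φ.open_target hy fun z hz => christoffel_symm hz c a b
  simp only [ricci, pd_symm _ _ hy, h, christoffel_symm hy]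
  rfl

lemma einstein_symm (hy : y ∈ φ.target) (a b : Fin 4) :
    einstein g φ (φ.symm y) a b = locEin (chartMetric g φ) a b y := by
  simp only [einstein, ricci_symm hy]
  rfl

end

/-- The value of a rank two tensor on a pair of equal vectors, as a quadratic form in
coordinates. -/
lemma Cov.apply_self (g : Cov M 2) {φ : Chart M} (hφ : φ ∈ charts M) {x : M} (hx : x ∈ φ.source)
    (v : TangentSpace (𝓡 4) x) :
    g x ![v, v] = quadForm (metricMatrix g φ x) fun a => coordForm φ a x v := by
  rw [g.eq_sum_comp hφ hx, quadForm]
  exact Finset.sum_congr rfl fun a _ => Finset.sum_congr rfl fun b _ => mul_comm _ _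

lemma coordForm_sum {φ : Chart M} (hφ : φ ∈ charts M) {x : M} (hx : x ∈ φ.source)
    (w : Fin 4 → ℝ) (a : Fin 4) : coordForm φ a x (∑ b, w b • coordVec φ b x) = w a := by
  rw [map_sum]
  simp [coordForm_coordVec hφ hx]

/-- A tensor in an orthonormal basis. -/
lemma IsLorentz.apply_basis {g : Cov M 2} {x : M}
    {b : Module.Basis (Fin 4) ℝ (TangentSpace (𝓡 4) x)}
    (hb : ∀ i j, g x ![b i, b j] = if i = j then (if i = 0 then -1 else 1) else 0)
    (v : TangentSpace (𝓡 4) x) (j : Fin 4) :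
    g x ![v, b j] = (if j = 0 then -1 else 1) * b.repr v j ∧
    g x ![b j, v] = (if j = 0 then -1 else 1) * b.repr v j := by
  rw [← g.bilin_apply, ← g.bilin_apply]
  constructor
  · conv_lhs => rw [← b.sum_repr v]
    simp only [map_sum, map_smul, LinearMap.sum_apply, LinearMap.smul_apply, g.bilin_apply, hb]
    simp [mul_comm]
  · conv_lhs => rw [← b.sum_repr v]
    rw [map_sum]
    simp only [g.bilin_apply, g.smul_right, hb]
    simp [mul_comm]

lemma IsLorentz.isSymm {g : Cov M 2} (hg : IsLorentz g) (x : M) (v w : TangentSpace (𝓡 4) x) :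
    g x ![v, w] = g x ![w, v] := by
  obtain ⟨b, hb⟩ := hg.2 x
  rw [← g.bilin_apply, ← g.bilin_apply]
  conv_lhs => rw [← b.sum_repr w]
  conv_rhs => rw [← b.sum_repr w]
  rw [map_sum, map_sum, LinearMap.sum_apply]
  simp only [map_smul, LinearMap.smul_apply, smul_eq_mul, g.bilin_apply, g.smul_right,
    (IsLorentz.apply_basis hb v _).1, (IsLorentz.apply_basis hb v _).2]

lemma IsLorentz.nondegenerate {g : Cov M 2} (hg : IsLorentz g) : Nondegenerate g := by
  intro φ hφ y hy hdet
  set x := φ.symm y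
  have hx : x ∈ φ.source := φ.map_target hy
  obtain ⟨b, hb⟩ := hg.2 x
  obtain ⟨v, hv, hv0⟩ := Matrix.exists_mulVec_eq_zero_iff.mpr hdet
  set w : TangentSpace (𝓡 4) x := ∑ a, v a • coordVec φ a x with hw
  have h1 : ∀ u : TangentSpace (𝓡 4) x, g x ![u, w] = 0 := by
    intro u
    rw [g.eq_sum_comp hφ hx]
    simp only [hw, coordForm_sum hφ hx]
    refine Finset.sum_eq_zero fun a _ => ?_
    have h2 := congrFun hv0 a
    simp only [Matrix.mulVec, dotProduct, metricMatrix, Matrix.of_apply, Pi.zero_apply] at h2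
    simp only [mul_assoc, ← Finset.mul_sum, mul_comm (v _), h2, mul_zero]
  have hw0 : w = 0 := by
    refine b.ext_elem fun j => ?_
    have h2 := (IsLorentz.apply_basis hb w j).2
    rw [h1] at h2
    rw [map_zero, Finsupp.zero_apply]
    split_ifs at h2 <;> linarith
  refine hv (funext fun a => ?_)
  rw [← coordForm_sum hφ hx v a, ← hw, hw0, map_zero, Pi.zero_apply]

lemma IsLorentz.isMetricOn {g : Cov M 2} (hg : IsLorentz g) {φ : Chart M} (hφ : φ ∈ charts M) :
    IsMetricOn φ.target (chartMetric g φ) where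
  smooth a b := hg.1 φ hφ ![a, b]
  symm y _ := by
    ext a b
    simp only [Matrix.transpose_apply, chartMetric, metricMatrix, Matrix.of_apply,
      ← g.bilin_coordVec]
    exact hg.isSymm _ _ _
  det y hy := hg.nondegenerate φ hφ y hy

lemma IsLorentz.exists_timelike {g : Cov M 2} (hg : IsLorentz g) {φ : Chart M} (hφ : φ ∈ charts M)
    {x : M} (hx : x ∈ φ.source) : ∃ t, quadForm (metricMatrix g φ x) t < 0 := by
  obtain ⟨b, hb⟩ := hg.2 x
  refine ⟨_, (g.apply_self hφ hx (b 0)).symm.trans_lt ?_⟩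
  rw [hb]
  norm_num

lemma WeakEnergy.quadForm_nonneg {g T : Cov M 2} (h : WeakEnergy g T) {φ : Chart M}
    (hφ : φ ∈ charts M) {x : M} (hx : x ∈ φ.source) {w : Fin 4 → ℝ}
    (hw : quadForm (metricMatrix g φ x) w < 0) : 0 ≤ quadForm (metricMatrix T φ x) w := by
  have h1 : ∀ A : Cov M 2, quadForm (metricMatrix A φ x) w
      = A x ![∑ b, w b • coordVec φ b x, ∑ b, w b • coordVec φ b x] := by
    intro A
    rw [A.apply_self hφ hx]
    simp only [coordForm_sum hφ hx]
  rw [h1] at hw ⊢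
  exact h x _ hw

/-! ### Uniform bounds on coordinate balls -/

section

variable {φ : Chart M} {y₀ : E4} {r : ℝ}

lemma bd_of_continuousOn {f : E4 → ℝ} (hf : ContinuousOn f φ.target)
    (hr : Metric.closedBall y₀ r ⊆ φ.target) : Bd (Metric.ball y₀ r) (fun _ => f) := by
  obtain ⟨C, hC⟩ := (isCompact_closedBall y₀ r).exists_bound_of_continuousOn (hf.mono hr)
  exact ⟨fun _ _ => (hf.mono hr).mono Metric.ball_subset_closedBall, C,
    Eventually.of_forall fun _ y hy => hC y (Metric.ball_subset_closedBall hy)⟩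

/-- A bound on the tensor norm bounds the components, locally uniformly. -/
lemma exists_comp_bound {e : Cov M 2} (he : IsRiemannian e) (hφ : φ ∈ charts M)
    (hr : Metric.closedBall y₀ r ⊆ φ.target) {C : M → ℝ} (hC : Continuous C) {k : ℕ}
    (i : Fin k → Fin 4) :
    ∃ K, ∀ A : Comp M k, ∀ δ, 0 ≤ δ → ∀ y ∈ Metric.ball y₀ r,
      tensorNorm e A φ (φ.symm y) ≤ δ * C (φ.symm y) → |A φ (φ.symm y) i| ≤ K * δ := by
  have hc : ContinuousOn (fun y => (∏ l, e.comp φ (φ.symm y) ![i l, i l]) * C (φ.symm y) ^ 2)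
      φ.target :=
    (continuousOn_finsetProd _ fun l _ => (he.1 φ hφ _).continuousOn).mul
      ((hC.comp_continuousOn φ.continuousOn_symm).pow 2)
  obtain ⟨K, hK⟩ := (isCompact_closedBall y₀ r).exists_bound_of_continuousOn (hc.mono hr)
  refine ⟨Real.sqrt K, fun A δ hδ y hy hA => ?_⟩
  have hy' := Metric.ball_subset_closedBall hy
  have hx := φ.map_target (hr hy')
  have h1 := sq_le_tensorNorm he hφ hx A i
  have h2 : tensorNorm e A φ (φ.symm y) ^ 2 ≤ (δ * C (φ.symm y)) ^ 2 :=
    pow_le_pow_left₀ (Real.sqrt_nonneg _) hA 2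
  have h3 : 0 ≤ ∏ l, e.comp φ (φ.symm y) ![i l, i l] :=
    Finset.prod_nonneg fun l _ => (he.posDef hφ hx).posSemidef.diag_nonneg
  have h4 := (le_abs_self _).trans (hK y hy')
  have h5 : (A φ (φ.symm y) i) ^ 2 ≤ K * δ ^ 2 := by
    calc (A φ (φ.symm y) i) ^ 2 ≤ (∏ l, e.comp φ (φ.symm y) ![i l, i l]) * (δ * C (φ.symm y)) ^ 2 :=
          h1.trans (mul_le_mul_of_nonneg_left h2 h3)
      _ = ((∏ l, e.comp φ (φ.symm y) ![i l, i l]) * C (φ.symm y) ^ 2) * δ ^ 2 := by ring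
      _ ≤ K * δ ^ 2 := mul_le_mul_of_nonneg_right h4 (sq_nonneg _)
  have h6 := Real.abs_le_sqrt h5
  rwa [Real.sqrt_mul' _ (sq_nonneg _), Real.sqrt_sq hδ] at h6

end

/-! ### The family of metrics in a chart -/

section

variable [IsManifold (𝓡 4) ∞ M] [T2Space M] {D : Connection M} {e : Cov M 2} {g : ℝ → Cov M 2}
  {φ : Chart M}
  {y₀ : E4} {r : ℝ} {C₁ C₂ : M → ℝ}

lemma sml_deviation (he : IsRiemannian e) (hg : ∀ s, 0 ≤ s → IsLorentz (g s))
    (hC₁ : Continuous C₁) (hBound : ∀ s, 0 < s → ∀ φ ∈ charts M, ∀ x ∈ φ.source,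
      tensorNorm e (g s - g 0).comp φ x ≤ s * C₁ x) (hφ : φ ∈ charts M)
    (hr : Metric.closedBall y₀ r ⊆ φ.target) (a b : Fin 4) :
    Sml (Metric.ball y₀ r)
      (fun s y => chartMetric (g s) φ y a b - chartMetric (g 0) φ y a b) := by
  have hr' := Metric.ball_subset_closedBall.trans hr
  obtain ⟨K, hK⟩ := exists_comp_bound he hφ hr hC₁ ![a, b]
  refine ⟨fun s hs => (((hg s hs.le).isMetricOn hφ).smooth a b).continuousOn.mono hr' |>.sub
    ((((hg 0 le_rfl).isMetricOn hφ).smooth a b).continuousOn.mono hr'), K, ?_⟩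
  filter_upwards [eventually_pos] with s hs y hy
  exact hK _ s hs.le y hy (hBound s hs φ hφ _ (φ.map_target (hr' hy)))

/-- In coordinates, the difference between `∇_c h_{ab}` and `∂_c h_{ab}` is `O(s)`. -/
lemma covDeriv_symm_eq (hφ : φ ∈ charts M) {y : E4} (hy : y ∈ φ.target) (s : ℝ)
    (c a b : Fin 4) :
    covDeriv D (g s - g 0) φ (φ.symm y) ![c, a, b] = osc (fun s => chartMetric (g s) φ) c a b s y
      - ∑ d, connCoeff D φ d c a (φ.symm y)
          * (chartMetric (g s) φ y d b - chartMetric (g 0) φ y d b)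
      - ∑ d, connCoeff D φ d c b (φ.symm y)
          * (chartMetric (g s) φ y a d - chartMetric (g 0) φ y a d) := by
  rw [covDeriv_eq D _ hφ (φ.map_target hy), pd_symm _ _ hy]
  rfl

lemma sml_covDeriv_sub_osc (hD : D.ContMDiffCovariantDerivative ∞) (he : IsRiemannian e)
    (hg : ∀ s, 0 ≤ s → IsLorentz (g s)) (hC₁ : Continuous C₁)
    (hBound : ∀ s, 0 < s → ∀ φ ∈ charts M, ∀ x ∈ φ.source,
      tensorNorm e (g s - g 0).comp φ x ≤ s * C₁ x) (hφ : φ ∈ charts M)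
    (hr : Metric.closedBall y₀ r ⊆ φ.target) (c a b : Fin 4) :
    Sml (Metric.ball y₀ r) (fun s y => covDeriv D (g s - g 0) φ (φ.symm y) ![c, a, b]
      - osc (fun s => chartMetric (g s) φ) c a b s y) := by
  have hr' := Metric.ball_subset_closedBall.trans hr
  have hΓ : ∀ d c a, Bd (Metric.ball y₀ r) (fun _ y => connCoeff D φ d c a (φ.symm y)) :=
    fun d c a => bd_of_continuousOn (fun y hy => (ContinuousAt.comp (f := φ.symm)
      (continuousAt_connCoeff hD hφ (φ.map_target hy) d c a)
      (φ.continuousAt_symm hy)).continuousWithinAt) hr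
  have hh := sml_deviation he hg hC₁ hBound hφ hr
  refine ((Sml.sum Finset.univ fun d _ => Sml.bd_mul (hΓ d c a) (hh d b)).add
    (Sml.sum Finset.univ fun d _ => Sml.bd_mul (hΓ d c b) (hh a d))).neg.congr fun s _ y hy => ?_
  rw [covDeriv_symm_eq hφ (hr' hy)]
  ring

lemma bd_covDeriv (hD : D.ContMDiffCovariantDerivative ∞) (he : IsRiemannian e)
    (hg : ∀ s, 0 ≤ s → IsLorentz (g s)) (hC₁ : Continuous C₁)
    (hBound : ∀ s, 0 < s → ∀ φ ∈ charts M, ∀ x ∈ φ.source,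
      tensorNorm e (g s - g 0).comp φ x ≤ s * C₁ x)
    (hC₂ : Continuous C₂) (hBound' : ∀ s, 0 < s → ∀ φ ∈ charts M, ∀ x ∈ φ.source,
      tensorNorm e (covDeriv D (g s - g 0)) φ x ≤ C₂ x) (hφ : φ ∈ charts M)
    (hr : Metric.closedBall y₀ r ⊆ φ.target) (c a b : Fin 4) :
    Bd (Metric.ball y₀ r) (fun s y => covDeriv D (g s - g 0) φ (φ.symm y) ![c, a, b]) := by
  have hr' := Metric.ball_subset_closedBall.trans hr
  obtain ⟨K, hK⟩ := exists_comp_bound he hφ hr hC₂ ![c, a, b]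
  have h1 := sml_covDeriv_sub_osc hD he hg hC₁ hBound hφ hr c a b
  refine ⟨fun s hs => ?_, K, ?_⟩
  · have h2 : ContinuousOn (osc (fun s => chartMetric (g s) φ) c a b s) (Metric.ball y₀ r) :=
      (contDiffOn_pder φ.open_target ((((hg s hs.le).isMetricOn hφ).smooth a b).sub
        (((hg 0 le_rfl).isMetricOn hφ).smooth a b)) c).continuousOn.mono hr'
    exact ((h1.cont s hs).add h2).congr fun y _ => by simp
  · filter_upwards [eventually_pos] with s hs y hy
    have := hK (covDeriv D (g s - g 0)) 1 zero_le_one y hy (by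
      rw [one_mul]; exact hBound' s hs φ hφ _ (φ.map_target (hr' hy)))
    rwa [mul_one] at this

/-- The hypotheses on the metrics, in a coordinate ball. -/
lemma metricFamily_chart (hD : D.ContMDiffCovariantDerivative ∞) (he : IsRiemannian e)
    (hg : ∀ s, 0 ≤ s → IsLorentz (g s)) (hC₁ : Continuous C₁)
    (hBound : ∀ s, 0 < s → ∀ φ ∈ charts M, ∀ x ∈ φ.source,
      tensorNorm e (g s - g 0).comp φ x ≤ s * C₁ x)
    (hC₂ : Continuous C₂) (hBound' : ∀ s, 0 < s → ∀ φ ∈ charts M, ∀ x ∈ φ.source,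
      tensorNorm e (covDeriv D (g s - g 0)) φ x ≤ C₂ x) (hφ : φ ∈ charts M)
    (hr : Metric.closedBall y₀ r ⊆ φ.target) :
    MetricFamily (Metric.ball y₀ r) (fun s => chartMetric (g s) φ) where
  isOpen := Metric.isOpen_ball
  metric s hs := by
    have hr' := Metric.ball_subset_closedBall.trans hr
    have h := (hg s hs).isMetricOn hφ
    exact ⟨fun a b => (h.smooth a b).mono hr', fun y hy => h.symm y (hr' hy),
      fun y hy => h.det y (hr' hy)⟩
  bdd a b := bd_of_continuousOn (((hg 0 le_rfl).isMetricOn hφ).smooth a b).continuousOn hr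
  bdd_inv a b := bd_of_continuousOn (((hg 0 le_rfl).isMetricOn hφ).inv_smooth a b).continuousOn hr
  bdd_pder c a b := bd_of_continuousOn
    (((hg 0 le_rfl).isMetricOn hφ).pder_smooth φ.open_target c a b).continuousOn hr
  sml := sml_deviation he hg hC₁ hBound hφ hr
  bdd_osc c a b := ((bd_covDeriv hD he hg hC₁ hBound hC₂ hBound' hφ hr c a b).sub
    (sml_covDeriv_sub_osc hD he hg hC₁ hBound hφ hr c a b).bd).congr fun s _ y _ => by ring

variable [MeasurableSpace M] [BorelSpace M] [SecondCountableTopology M]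

/-- The quadratic weak limit in a coordinate ball, with coordinate instead of covariant
derivatives. -/
lemma hasQuadLimit_chart (hD : D.ContMDiffCovariantDerivative ∞) (he : IsRiemannian e)
    (hg : ∀ s, 0 ≤ s → IsLorentz (g s)) (hC₁ : Continuous C₁)
    (hBound : ∀ s, 0 < s → ∀ φ ∈ charts M, ∀ x ∈ φ.source,
      tensorNorm e (g s - g 0).comp φ x ≤ s * C₁ x)
    (hC₂ : Continuous C₂) (hBound' : ∀ s, 0 < s → ∀ φ ∈ charts M, ∀ x ∈ φ.source,
      tensorNorm e (covDeriv D (g s - g 0)) φ x ≤ C₂ x)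
    {μ : Cov M 6} (hμ : μ.Smooth)
    (hWeak : WeakLim (volumeMeasure (g 0))
      (fun s φ x i => covDeriv D (g s - g 0) φ x ![i 0, i 2, i 3]
        * covDeriv D (g s - g 0) φ x ![i 1, i 4, i 5]) μ.comp) (hφ : φ ∈ charts M)
    (hr : Metric.closedBall y₀ r ⊆ φ.target) :
    HasQuadLimit (Metric.ball y₀ r) (fun s => chartMetric (g s) φ)
      (fun c a b d e f y => μ.comp φ (φ.symm y) ![c, d, a, b, e, f]) := by
  classical
  intro c a b d e' f
  have hr' := Metric.ball_subset_closedBall.trans hr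
  have hO : IsOpen (Metric.ball y₀ r) := Metric.isOpen_ball
  have hsm : ∀ s, 0 < s → (g s - g 0).Smooth := fun s hs ψ hψ i =>
    ((hg s hs.le).1 ψ hψ i).sub ((hg 0 le_rfl).1 ψ hψ i)
  have hB := bd_covDeriv hD he hg hC₁ hBound hC₂ hBound' hφ hr
  have hS := sml_covDeriv_sub_osc hD he hg hC₁ hBound hφ hr
  have hF := metricFamily_chart hD he hg hC₁ hBound hC₂ hBound' hφ hr
  set A' : ℝ → Cov M 6 := fun s => if hs : (g s - g 0).Smooth then
    Cov.tmul slots33 (covDerivTensor D hs) (covDerivTensor D hs) else 0 with hA'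
  have hA : ∀ s, 0 < s → ∀ ψ ∈ charts M, ∀ x ∈ ψ.source, ∀ i, (A' s).comp ψ x i
      = covDeriv D (g s - g 0) ψ x ![i 0, i 2, i 3]
        * covDeriv D (g s - g 0) ψ x ![i 1, i 4, i 5] := by
    intro s hs ψ hψ x hx i
    simp only [hA', dif_pos (hsm s hs)]
    rw [tmul_slots33_comp, covDerivTensor_comp D _ hψ hx, covDerivTensor_comp D _ hψ hx]
  have h1 := WeakLim.chartWk (hg 0 le_rfl).1 (hg 0 le_rfl).nondegenerate hφ hO hr' hWeak
    (A' := A') (fun s hs x i => (hA s hs _ (chartAt_mem_charts x) x (mem_chart_source E4 x) i).symm)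
    (fun s hs i => (((hB _ _ _).cont s hs).mul ((hB _ _ _).cont s hs)).congr fun y hy =>
      hA s hs φ hφ _ (φ.map_target (hr' hy)) i)
    (fun i => (hμ φ hφ i).continuousOn.mono hr') ![c, d, a, b, e', f]
  have h2 : Wk (Metric.ball y₀ r) (fun s y => covDeriv D (g s - g 0) φ (φ.symm y) ![c, a, b]
      * covDeriv D (g s - g 0) φ (φ.symm y) ![d, e', f])
      (fun y => μ.comp φ (φ.symm y) ![c, d, a, b, e', f]) :=
    h1.congr (fun s hs y hy => (hA s hs φ hφ _ (φ.map_target (hr' hy)) ![c, d, a, b, e', f]).symm)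
      fun _ _ => rfl
  refine h2.of_sub_sml hO ((((hS c a b).mul_bd (hB d e' f)).add
    (Sml.bd_mul (hF.bdd_osc c a b) (hS d e' f))).neg.congr fun s _ y _ => ?_)
  ring

end

end

section

open Filter Bundle Set

/-! ### The background Einstein equation -/

variable {M : Type*} [TopologicalSpace M] [ChartedSpace E4 M]

/-- A one-parameter family of metrics, with matter of nonnegative energy density, whose deviation
from the background is `O(s)` with bounded first derivatives and convergent quadratic averages. -/
structure HighFrequencyLimit [IsManifold (𝓡 4) ∞ M] [MeasurableSpace M] (D : Connection M)
    (e : Cov M 2) (g : ℝ → Cov M 2)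
    (Λ : ℝ) (T : ℝ → Cov M 2) (C₁ C₂ : M → ℝ) (μ : Cov M 6) : Prop where
  smooth_conn : D.ContMDiffCovariantDerivative ∞
  riemannian : IsRiemannian e
  lorentz : ∀ s, 0 ≤ s → IsLorentz (g s)
  einstein_eq : ∀ s, 0 < s → ∀ φ ∈ charts M, ∀ x ∈ φ.source, ∀ a b,
    einstein (g s) φ x a b + Λ * (g s).comp φ x ![a, b] = 8 * Real.pi * (T s).comp φ x ![a, b]
  weakEnergy : ∀ s, 0 < s → WeakEnergy (g s) (T s)
  continuous_bound : Continuous C₁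
  bound : ∀ s, 0 < s → ∀ φ ∈ charts M, ∀ x ∈ φ.source,
    tensorNorm e (g s - g 0).comp φ x ≤ s * C₁ x
  continuous_bound_deriv : Continuous C₂
  bound_deriv : ∀ s, 0 < s → ∀ φ ∈ charts M, ∀ x ∈ φ.source,
    tensorNorm e (covDeriv D (g s - g 0)) φ x ≤ C₂ x
  smooth_quad : μ.Smooth
  quad : WeakLim (volumeMeasure (g 0))
      (fun s φ x i => covDeriv D (g s - g 0) φ x ![i 0, i 2, i 3]
        * covDeriv D (g s - g 0) φ x ![i 1, i 4, i 5]) μ.comp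

/-- The components of the limiting matter tensor in a chart, as dictated by the background
equation. -/
def limitSource (g : Cov M 2) (Λ : ℝ) (μ : Cov M 6) (φ : Chart M) (x : M) (i : Fin 2 → Fin 4) : ℝ :=
  (8 * Real.pi)⁻¹ * (einstein g φ x (i 0) (i 1) + Λ * g.comp φ x ![i 0, i 1]
    - tr2 g φ x (fun c c' d d' => alpha μ φ x (i 0) c (i 1) d c' d'))

/-- The limiting matter tensor computed in a chart. -/
def chartSource (g : Cov M 2) (Λ : ℝ) (μ : Cov M 6) (φ : Chart M) : Cov M 2 := fun x =>
  covOfComp φ x (limitSource g Λ μ φ x)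

lemma chartSource_comp (g : Cov M 2) (Λ : ℝ) (μ : Cov M 6) {φ : Chart M} (hφ : φ ∈ charts M)
    {x : M} (hx : x ∈ φ.source) (i : Fin 2 → Fin 4) :
    (chartSource g Λ μ φ).comp φ x i = limitSource g Λ μ φ x i :=
  covOfComp_coordVec hφ hx _ _

/-- The limiting matter tensor. That the chart used at each point does not matter is a consequence
of the uniqueness of weak limits. -/
def limitMatter (g : Cov M 2) (Λ : ℝ) (μ : Cov M 6) : Cov M 2 := fun x =>
  chartSource g Λ μ (chartAt E4 x) x

lemma limitMatter_apply (g : Cov M 2) (Λ : ℝ) (μ : Cov M 6) (x : M) :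
    limitMatter g Λ μ x = chartSource g Λ μ (chartAt E4 x) x := rfl

lemma pair_eta {α : Type*} (i : Fin 2 → α) : ![i 0, i 1] = i := by
  funext l; fin_cases l <;> rfl

/-- When the contraction `α_a^c_{bcef}` vanishes, only the first term of the effective
stress-energy tensor survives. -/
lemma effStress_eq {g : Cov M 2} {μ : Cov M 6} {φ : Chart M} {x : M}
    (h : ∀ a b e f, ∑ c, ∑ c', inv g φ x c c' * alpha μ φ x a c b c' e f = 0) (a b : Fin 4) :
    8 * Real.pi * effStress g μ φ x a b
      = tr2 g φ x (fun c c' d d' => alpha μ φ x a c b d c' d') := by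
  obtain ⟨h1, h2, h3⟩ := effective_terms_eq_zero (G := fun c d => inv g φ x c d)
    (n := fun p q a b e f => μ.comp φ x ![p, q, a, b, e, f]) h
  have e1 : tr2 g φ x (fun c c' d d' => alpha μ φ x c d c' d' a b) = 0 := h1 a b
  have e2 : ∀ a b, tr2 g φ x (fun c c' d d' => alpha μ φ x a c d c' d' b) = 0 := h2
  have e3 : tr3 g φ x (fun c c' d d' e e' => alpha μ φ x c d c' d' e e') = 0 :=
    Finset.sum_eq_zero fun e _ => Finset.sum_eq_zero fun e' _ => by
      have : tr2 g φ x (fun c c' d d' => alpha μ φ x c d c' d' e e') = 0 := h1 e e'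
      rw [this, mul_zero]
  have e4 : tr3 g φ x (fun c c' d d' e e' => alpha μ φ x c d e c' d' e') = 0 :=
    Finset.sum_eq_zero fun e _ => Finset.sum_eq_zero fun e' _ => by
      have : tr2 g φ x (fun c c' d d' => alpha μ φ x c d e c' d' e') = 0 := h3 e e'
      rw [this, mul_zero]
  rw [effStress, e1, e2, e2, e3, e4]
  field_simp
  ring

lemma trace_effStress_eq_zero {g : Cov M 2} {μ : Cov M 6} {φ : Chart M} {x : M}
    (h : ∀ a b e f, ∑ c, ∑ c', inv g φ x c c' * alpha μ φ x a c b c' e f = 0) :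
    ∑ a, ∑ b, inv g φ x a b * effStress g μ φ x a b = 0 := by
  have h1 : ∑ a, ∑ b, inv g φ x a b * tr2 g φ x (fun c c' d d' => alpha μ φ x a c b d c' d') = 0 :=
    trace_alphaArr (G := fun c d => inv g φ x c d)
      (n := fun p q a b e f => μ.comp φ x ![p, q, a, b, e, f]) h
  have h2 : 8 * Real.pi * ∑ a, ∑ b, inv g φ x a b * effStress g μ φ x a b = 0 := by
    rw [← h1]
    simp only [← effStress_eq h, Finset.mul_sum]
    exact Finset.sum_congr rfl fun a _ => Finset.sum_congr rfl fun b _ => by ring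
  exact (mul_eq_zero.mp h2).resolve_left (by positivity)

lemma limitSource_smooth {g : Cov M 2} (hg : IsLorentz g) (Λ : ℝ) {μ : Cov M 6} (hμ : μ.Smooth)
    {φ : Chart M} (hφ : φ ∈ charts M) (i : Fin 2 → Fin 4) :
    ContDiffOn ℝ ∞ (fun y => limitSource g Λ μ φ (φ.symm y) i) φ.target := by
  have hm := hg.isMetricOn hφ
  have hR := hm.ric_smooth φ.open_target
  have h1 : ContDiffOn ℝ ∞ (fun y => einstein g φ (φ.symm y) (i 0) (i 1)) φ.target :=
    ContDiffOn.congr (f := locEin (chartMetric g φ) (i 0) (i 1))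
      ((hR _ _).sub ((contDiffOn_const.mul (hm.smooth _ _)).mul
        (ContDiffOn.sum fun c _ => ContDiffOn.sum fun d _ => (hm.inv_smooth c d).mul (hR c d))))
      fun y hy => einstein_symm hy _ _
  have h2 : ∀ a b c d e f, ContDiffOn ℝ ∞ (fun y => alpha μ φ (φ.symm y) a b c d e f) φ.target :=
    fun a b c d e f => contDiffOn_const.mul
      ((((hμ φ hφ _).sub (hμ φ hφ _)).sub (hμ φ hφ _)).add (hμ φ hφ _))
  refine contDiffOn_const.mul ((h1.add (contDiffOn_const.mul (hg.1 φ hφ _))).sub ?_)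
  exact ContDiffOn.sum fun c _ => ContDiffOn.sum fun c' _ => ContDiffOn.sum fun d _ =>
    ContDiffOn.sum fun d' _ => ((hm.inv_smooth c c').mul (hm.inv_smooth d d')).mul (h2 _ _ _ _ _ _)

namespace HighFrequencyLimit

variable [IsManifold (𝓡 4) ∞ M] [T2Space M] [MeasurableSpace M] [BorelSpace M]
  [SecondCountableTopology M] {D : Connection M} {e : Cov M 2} {g : ℝ → Cov M 2} {Λ : ℝ} {T : ℝ → Cov M 2}
  {C₁ C₂ : M → ℝ}
  {μ : Cov M 6}

/-- All the weak limits, near a point and in an arbitrary chart. -/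
lemma exists_chartWk (H : HighFrequencyLimit D e g Λ T C₁ C₂ μ) {φ : Chart M} (hφ : φ ∈ charts M)
    {x : M} (hx : x ∈ φ.source) :
    (∀ a b e f, ∑ c, ∑ c', inv (g 0) φ x c c' * alpha μ φ x a c b c' e f = 0) ∧
    ∃ U, IsOpen U ∧ U ⊆ φ.target ∧ x ∈ φ.source ∩ φ ⁻¹' U ∧
      ChartWk φ U T (chartSource (g 0) Λ μ φ) ∧
      ChartWk φ U (fun s => Cov.tmul slots22 (g s - g 0) (T s)) 0 := by
  obtain ⟨R, hR, hRt⟩ := Metric.nhds_basis_closedBall.mem_iff.mp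
    (φ.open_target.mem_nhds (φ.map_source hx))
  have hRt' := Metric.ball_subset_closedBall.trans hRt
  have hF := metricFamily_chart H.smooth_conn H.riemannian H.lorentz H.continuous_bound H.bound
    H.continuous_bound_deriv H.bound_deriv hφ hRt
  have hQ := hasQuadLimit_chart H.smooth_conn H.riemannian H.lorentz H.continuous_bound H.bound
    H.continuous_bound_deriv H.bound_deriv H.smooth_quad H.quad hφ hRt
  obtain ⟨t, ht⟩ := (H.lorentz 0 le_rfl).exists_timelike hφ hx
  have ht' : quadForm (chartMetric (g 0) φ (φ x)) t < 0 := by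
    rwa [chartMetric, φ.left_inv hx]
  have hpi : 0 < 8 * Real.pi := by positivity
  obtain ⟨r, hr, hrR, hα, hT, hhT⟩ := hF.exists_local_limits hQ
    (S := fun a b s y => 8 * Real.pi * (T s).comp φ (φ.symm y) ![a, b]) (Λ := Λ)
    (Metric.mem_ball_self hR) ht'
    (fun s hs y hy a b => by
      rw [← H.einstein_eq s hs φ hφ _ (φ.map_target (hRt' hy)), einstein_symm (hRt' hy)]
      rfl)
    (fun s hs y hy w hw => by
      have h1 := (H.weakEnergy s hs).quadForm_nonneg hφ (φ.map_target (hRt' hy)) hw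
      have h2 : quadForm (Matrix.of fun a b => 8 * Real.pi * (T s).comp φ (φ.symm y) ![a, b]) w
          = 8 * Real.pi * quadForm (metricMatrix (T s) φ (φ.symm y)) w := by
        simp only [quadForm, Finset.mul_sum, metricMatrix, Matrix.of_apply, mul_assoc]
      rw [h2]
      positivity)
  have hrt : Metric.ball (φ x) r ⊆ φ.target := hrR.trans hRt'
  refine ⟨?_, Metric.ball (φ x) r, Metric.isOpen_ball, hrt, ⟨hx, Metric.mem_ball_self hr⟩, ?_, ?_⟩
  · intro a b e' f
    have h1 := hα (φ x) (Metric.mem_ball_self hr) a b e' f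
    simp only [chartMetric, alphaArr, muArr, φ.left_inv hx] at h1
    simpa only [inv, alpha] using h1
  · intro i
    refine ((hT (i 0) (i 1)).const_mul Metric.isOpen_ball (8 * Real.pi)⁻¹).congr
      (fun s _ y _ => ?_) fun y hy => ?_
    · rw [pair_eta, inv_mul_cancel_left₀ hpi.ne']
    · rw [chartSource_comp _ _ _ hφ (φ.map_target (hrt hy)), limitSource, einstein_symm (hrt hy)]
      rfl
  · intro i
    refine ((hhT (i 0) (i 1) (i 2) (i 3)).const_mul Metric.isOpen_ball (8 * Real.pi)⁻¹).congr
      (fun s _ y _ => ?_) fun y hy => (mul_zero _).symm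
    rw [tmul_slots22_comp, mul_left_comm, inv_mul_cancel_left₀ hpi.ne']
    rfl

lemma limitMatter_comp (H : HighFrequencyLimit D e g Λ T C₁ C₂ μ) {φ : Chart M}
    (hφ : φ ∈ charts M) {x : M} (hx : x ∈ φ.source) (i : Fin 2 → Fin 4) :
    (limitMatter (g 0) Λ μ).comp φ x i = limitSource (g 0) Λ μ φ x i := by
  obtain ⟨-, U, hU, hUt, hxU, hW, -⟩ := H.exists_chartWk hφ hx
  obtain ⟨-, V, hV, hVt, hxV, hW', -⟩ := H.exists_chartWk (chartAt_mem_charts x)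
    (mem_chart_source E4 x)
  have h1 : (limitMatter (g 0) Λ μ).comp φ x i
      = (chartSource (g 0) Λ μ (chartAt E4 x)).comp φ x i := by
    rw [Cov.comp, limitMatter_apply, ← Cov.comp]
  have h2 := hW.comp_eq (H.lorentz 0 le_rfl).1 (H.lorentz 0 le_rfl).nondegenerate hφ
    (chartAt_mem_charts x) hU hUt hV hVt hW' hxU hxV i
  rw [h1, ← h2, chartSource_comp _ _ _ hφ hx]

lemma limitMatter_smooth (H : HighFrequencyLimit D e g Λ T C₁ C₂ μ) :
    (limitMatter (g 0) Λ μ).Smooth := fun φ hφ i =>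
  (limitSource_smooth (H.lorentz 0 le_rfl) Λ H.smooth_quad hφ i).congr fun _ hy =>
    H.limitMatter_comp hφ (φ.map_target hy) i

lemma weakLim_matter (H : HighFrequencyLimit D e g Λ T C₁ C₂ μ) :
    WeakLim (volumeMeasure (g 0)) (fun s => (T s).comp) (limitMatter (g 0) Λ μ).comp := by
  refine weakLim_of_chartWk (H.lorentz 0 le_rfl).1 (H.lorentz 0 le_rfl).nondegenerate fun x => ?_
  obtain ⟨-, U, hU, hUt, hxU, hW, -⟩ := H.exists_chartWk (chartAt_mem_charts x)
    (mem_chart_source E4 x)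
  refine ⟨_, chartAt_mem_charts x, U, hU, hUt, hxU, fun i => (hW i).congr (fun _ _ _ _ => rfl)
    fun y hy => ?_⟩
  have hy' := (chartAt E4 x).map_target (hUt hy)
  rw [H.limitMatter_comp (chartAt_mem_charts x) hy',
    chartSource_comp _ _ _ (chartAt_mem_charts x) hy']

lemma weakLim_deviation_mul_matter (H : HighFrequencyLimit D e g Λ T C₁ C₂ μ) :
    WeakLim (volumeMeasure (g 0)) (fun s => (Cov.tmul slots22 (g s - g 0) (T s)).comp)
      (0 : Cov M 4).comp := by
  refine weakLim_of_chartWk (H.lorentz 0 le_rfl).1 (H.lorentz 0 le_rfl).nondegenerate fun x => ?_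
  obtain ⟨-, U, hU, hUt, hxU, -, hW⟩ := H.exists_chartWk (chartAt_mem_charts x)
    (mem_chart_source E4 x)
  exact ⟨_, chartAt_mem_charts x, U, hU, hUt, hxU, hW⟩

lemma einstein_background (H : HighFrequencyLimit D e g Λ T C₁ C₂ μ) {φ : Chart M}
    (hφ : φ ∈ charts M) {x : M} (hx : x ∈ φ.source) (a b : Fin 4) :
    einstein (g 0) φ x a b + Λ * (g 0).comp φ x ![a, b]
      = 8 * Real.pi * (limitMatter (g 0) Λ μ).comp φ x ![a, b]
        + 8 * Real.pi * effStress (g 0) μ φ x a b := by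
  rw [H.limitMatter_comp hφ hx, effStress_eq (H.exists_chartWk hφ hx).1, limitSource,
    mul_inv_cancel_left₀ (by positivity)]
  simp

end HighFrequencyLimit

end

end Spacetime

end

theorem theorem1 {M : Type*} [TopologicalSpace M] [ChartedSpace E4 M]
    [IsManifold (𝓡 4) ∞ M] [T2Space M] [SecondCountableTopology M]
    [MeasurableSpace M] [BorelSpace M]
    -- the fixed derivative operator and the auxiliary Riemannian metric
    (D : Connection M) (hD : D.ContMDiffCovariantDerivative ∞)
    (e : Cov M 2) (he : IsRiemannian e)
    -- the one-parameter family of metrics, defined for all `0 ≤ s`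
    (g : ℝ → Cov M 2) (hg : ∀ s, 0 ≤ s → IsLorentz (g s))
    (Λ : ℝ) (T : ℝ → Cov M 2)
    -- (i) Einstein's equation and the weak energy condition
    (hEinstein : ∀ s, 0 < s → ∀ φ ∈ charts M, ∀ x ∈ φ.source, ∀ a b,
      einstein (g s) φ x a b + Λ * (g s).comp φ x ![a, b]
        = 8 * Real.pi * (T s).comp φ x ![a, b])
    (hWEC : ∀ s, 0 < s → WeakEnergy (g s) (T s))
    -- (ii)
    (C₁ : M → ℝ) (hC₁ : ContMDiff (𝓡 4) 𝓘(ℝ, ℝ) ∞ C₁) (hC₁pos : ∀ x, 0 < C₁ x)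
    (hBound : ∀ s, 0 < s → ∀ φ ∈ charts M, ∀ x ∈ φ.source,
      tensorNorm e (g s - g 0).comp φ x ≤ s * C₁ x)
    -- (iii)
    (C₂ : M → ℝ) (hC₂ : ContMDiff (𝓡 4) 𝓘(ℝ, ℝ) ∞ C₂) (hC₂pos : ∀ x, 0 < C₂ x)
    (hBound' : ∀ s, 0 < s → ∀ φ ∈ charts M, ∀ x ∈ φ.source,
      tensorNorm e (covDeriv D (g s - g 0)) φ x ≤ C₂ x)
    -- (iv)
    (μ : Cov M 6) (hμ : μ.Smooth)
    (hWeak : WeakLim (volumeMeasure (g 0))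
      (fun s φ x i => covDeriv D (g s - g 0) φ x ![i 0, i 2, i 3]
        * covDeriv D (g s - g 0) φ x ![i 1, i 4, i 5]) μ.comp) :
    -- the matter tensor has a smooth weak limit, and the background equation holds
    (∃ T₀ : Cov M 2, T₀.Smooth ∧
      WeakLim (volumeMeasure (g 0)) (fun s => (T s).comp) T₀.comp ∧
      ∀ φ ∈ charts M, ∀ x ∈ φ.source, ∀ a b,
        einstein (g 0) φ x a b + Λ * (g 0).comp φ x ![a, b]
          = 8 * Real.pi * T₀.comp φ x ![a, b] + 8 * Real.pi * effStress (g 0) μ φ x a b) ∧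
    -- the weak limit of `h_{ef} T_{ab}` vanishes
    WeakLim (k := 4) (volumeMeasure (g 0))
      (fun s φ x i => (g s - g 0).comp φ x ![i 0, i 1] * (T s).comp φ x ![i 2, i 3])
      (fun _ _ _ => 0) ∧
    ∀ φ ∈ charts M, ∀ x ∈ φ.source,
      (∀ a b e f, ∑ c, ∑ c', inv (g 0) φ x c c' * alpha μ φ x a c b c' e f = 0) ∧
      (∀ a b, 8 * Real.pi * effStress (g 0) μ φ x a b
        = tr2 (g 0) φ x (fun c c' d d' => alpha μ φ x a c b d c' d')) ∧
      ∑ a, ∑ b, inv (g 0) φ x a b * effStress (g 0) μ φ x a b = 0 := by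
  have H : HighFrequencyLimit D e g Λ T C₁ C₂ μ :=
    ⟨hD, he, hg, hEinstein, hWEC, hC₁.continuous, hBound, hC₂.continuous, hBound', hμ, hWeak⟩
  refine ⟨⟨limitMatter (g 0) Λ μ, H.limitMatter_smooth, H.weakLim_matter,
    fun φ hφ x hx a b => H.einstein_background hφ hx a b⟩, ?_, fun φ hφ x hx => ?_⟩
  · intro f hf
    refine (H.weakLim_deviation_mul_matter f hf).congr fun s => ?_
    exact integral_congr_ae (ae_of_all _ fun x => contract_congr f fun i =>
      tmul_slots22_comp _ _ _ x i)
  · have hα := (H.exists_chartWk hφ hx).1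
    exact ⟨hα, effStress_eq hα, trace_effStress_eq_zero hα⟩
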